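/- Let $n\ge 0$ be an integer, let $\mathbb{D}\subset\mathbb{C}$ be the closed unit disk and let $\mathbb{M}\subset\partial\mathbb{D}$ be a set of $n+3$ distinct marked points. **Framed differentials.** Let $\phi$ be a meromorphic quadratic differential on $\mathbb{CP}^1$ all of whose zeros are simple and which has exactly one pole $p$, of order $n+5$. Let $\widetilde{\mathbb{D}}$ be the oriented real blowup of $\mathbb{CP}^1$ at $p$ (a disk whose boundary is the circle of tangent directions at $p$), and let $\widetilde{\mathbb{M}}\subset\partial\widetilde{\mathbb{D}}$ be the set of distinguished tangent directions at $p$, i.e. those to which some horizontal trajectory of $\phi$ tending to $p$ is asymptotic. A framing of $\phi$ is an orientation preserving diffeomorphism $f:\widetilde{\mathbb{D}}\to\mathbb{D}$ which induces a bijection $\widetilde{\mathbb{M}}\to\mathbb{M}$; framings are considered up to composition with diffeomorphisms of $\widetilde{\mathbb{D}}$ isotopic to the identity relative to $\widetilde{\mathbb{M}}$. Two framed differentials $(\phi_1,f_1)$, $(\phi_2,f_2)$ are equivalent if there is a biholomorphism $g:\mathbb{CP}^1\to\mathbb{CP}^1$ with $g^*\phi_2=\phi_1$ such that $f_2\circ\widetilde{g}$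 and $f_1$ agree up to isotopy, where $\widetilde g$ is the map of blowups induced by $g$. Let $\mathrm{Quad}_{fr}(\mathbb{D},\mathbb{M})$ be the set of equivalence classes. A map from an open set $U\subseteq\mathbb{C}^m$ to $\mathrm{Quad}_{fr}(\mathbb{D},\mathbb{M})$ is called holomorphic if locally on $U$ it is given by a family of framed differentials whose pole and differential depend holomorphically, and whose framing depends continuously, on the parameter; $\mathrm{Quad}_{fr}(\mathbb{D},\mathbb{M})$ carries the finest topology for which all these maps (for all $m$ and $U$) are continuous. **Polynomials.** For $a=(a_0,\dots,a_{n-1})\in\mathbb{C}^n$ put $P_a(z)=z^{n+1}+a_{n-1}z^{n-1}+\dots+a_1z+a_0$; these are the monic polynomials of degree $n+1$ whose roots $\alpha_1,\dots,\alpha_{n+1}$ sum to zero. Let $\Delta\subset\mathbb{C}^n$ be the discriminant locus $\prod_{i<j}(\alpha_i-\alpha_j)^2=0$. **Proposition.** There is a bijection $f_0$ from the set of $(n+3)$rd roots of unity to $\mathbb{M}$ which preserves the (counterclockwise) cyclic orderings. For every such $f_0$ there is an isomorphism $$\Phi:\mathrm{Quad}_{fr}(\mathbb{D},\mathbb{M})\longrightarrow\mathbb{C}^n\setminus\Delta$$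 with the following properties. It is a homeomorphism, and it is biholomorphic in the sense that a map $c$ from an open set $U\subseteq\mathbb{C}^m$ to $\mathrm{Quad}_{fr}(\mathbb{D},\mathbb{M})$ is holomorphic if and only if $\Phi\circ c$ is holomorphic. If $a\in\mathbb{C}^n\setminus\Delta$ and $f$ is a framing of $\phi=P_a(z)\,dz^{\otimes 2}$ (with pole $\infty$) which sends the direction at $\infty$ of the ray $\mathbb{R}_{>0}\zeta$ to $f_0(\zeta)$ for each $(n+3)$rd root of unity $\zeta$, then $\Phi$ sends the class of $(\phi,f)$ to $a$; and for every $a\in\mathbb{C}^n\setminus\Delta$ such a framing $f$ exists. -/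

import Mathlib

open Filter Topology

noncomputable section

namespace FramedQuad

/-! ### The Riemann sphere

The sphere `ℂℙ¹` is `OnePoint ℂ`, with its two standard coordinates `z` and `1/z`. -/

/-- The standard local coordinate centred at `p`: it is `z - a` if `p = a` is finite and `1/z` if
`p = ∞`. (The value at the one point outside the coordinate domain is irrelevant.) -/
def locCoord : OnePoint ℂ → OnePoint ℂ → ℂ
  | OnePoint.infty, OnePoint.infty => 0
  | OnePoint.infty, OnePoint.some z => z⁻¹
  | OnePoint.some _, OnePoint.infty => 0
  | OnePoint.some a, OnePoint.some z => z - a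

/-- The point of the sphere whose local coordinate centred at `p` is `w`. -/
def locPt : OnePoint ℂ → ℂ → OnePoint ℂ
  | OnePoint.infty, w => if w = 0 then OnePoint.infty else OnePoint.some w⁻¹
  | OnePoint.some a, w => OnePoint.some (a + w)

/-- The global coordinate `u` on the complement of `p`, given as a parametrization: `u = z` if
`p = ∞`, and `u = 1/(z - a)` if `p = a` is finite (so `u = 0` is the point `∞`). -/
def affPt : OnePoint ℂ → ℂ → OnePoint ℂ
  | OnePoint.infty, u => OnePoint.some u
  | OnePoint.some a, u => if u = 0 then OnePoint.infty else OnePoint.some (a + u⁻¹)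

/-- The expression of `g : ℂℙ¹ → ℂℙ¹` in the local coordinates centred at `p` (source) and
`q` (target). -/
def coordExpr (g : OnePoint ℂ → OnePoint ℂ) (p q : OnePoint ℂ) (w : ℂ) : ℂ :=
  locCoord q (g (locPt p w))

/-- `g` is a biholomorphism of the Riemann sphere. -/
def IsBiholomorphism (g : OnePoint ℂ ≃ₜ OnePoint ℂ) : Prop :=
  (∀ p, DifferentiableAt ℂ (coordExpr g p (g p)) 0) ∧
  (∀ p, DifferentiableAt ℂ (coordExpr g.symm p (g.symm p)) 0)

/-! ### Quadratic differentials -/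

/-- A meromorphic quadratic differential on `ℂℙ¹`: it is `coeff z dz²` in the coordinate `z` and
`coeffInfty w dw²` in the coordinate `w = 1/z`, with meromorphic coefficients (in normal form,
i.e. with the value `0` at poles and the limit value elsewhere), which satisfy the transformation
rule `coeff z = coeffInfty w * (dw/dz)²`. -/
structure QuadraticDifferential where
  coeff : ℂ → ℂ
  coeffInfty : ℂ → ℂ
  meromorphic_coeff : MeromorphicNFOn coeff Set.univ
  meromorphic_coeffInfty : MeromorphicNFOn coeffInfty Set.univ
  transform : ∀ z : ℂ, z ≠ 0 → coeff z = coeffInfty z⁻¹ * (-(z ^ 2)⁻¹) ^ 2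

namespace QuadraticDifferential

/-- The coefficient of `φ` in the local coordinate centred at `p`. -/
def localCoeff (φ : QuadraticDifferential) : OnePoint ℂ → ℂ → ℂ
  | OnePoint.infty, w => φ.coeffInfty w
  | OnePoint.some a, w => φ.coeff (a + w)

/-- The order of `φ` at the point `p`. -/
def orderAt (φ : QuadraticDifferential) (p : OnePoint ℂ) : WithTop ℤ :=
  meromorphicOrderAt (φ.localCoeff p) 0

/-- `φ` has a pole of order `n + 5` at `p`, no other poles, and only simple zeros. -/
def HasSimpleZerosAndPole (φ : QuadraticDifferential) (n : ℕ) (p : OnePoint ℂ) : Prop :=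
  φ.orderAt p = ((-((n : ℤ) + 5) : ℤ) : WithTop ℤ) ∧
  ∀ q, q ≠ p → φ.orderAt q = 0 ∨ φ.orderAt q = 1

/-- `φ₁` is the pullback `g^* φ₂`. -/
def IsPullback (g : OnePoint ℂ ≃ₜ OnePoint ℂ) (φ₂ φ₁ : QuadraticDifferential) : Prop :=
  ∀ p, ∀ᶠ w in 𝓝[≠] (0 : ℂ),
    φ₁.localCoeff p w =
      φ₂.localCoeff (g p) (coordExpr g p (g p) w) * (deriv (coordExpr g p (g p)) w) ^ 2

/-- The end of a horizontal trajectory tending to `p`, written in the local coordinate centred at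
`p`: a regular curve along which `φ` is real and positive (that is, `Im ∫ √φ` is constant along
the curve), avoiding the critical points of `φ` and converging to `p`. -/
def IsTrajectoryTo (φ : QuadraticDifferential) (p : OnePoint ℂ) (γ : ℝ → ℂ) : Prop :=
  (∀ t, 0 < t → γ t ≠ 0 ∧
    ∃ γ' : ℂ, HasDerivAt γ γ' t ∧ ∃ s : ℝ, 0 < s ∧ φ.localCoeff p (γ t) * γ' ^ 2 = (s : ℂ)) ∧
  Tendsto γ atTop (𝓝 0)

/-- The distinguished tangent directions of `φ` at `p`: the unit tangent vectors `v` (in the local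
coordinate centred at `p`) to which some horizontal trajectory tending to `p` is asymptotic. -/
def distinguishedDirections (φ : QuadraticDifferential) (p : OnePoint ℂ) : Set Circle :=
  {v | ∃ γ : ℝ → ℂ, φ.IsTrajectoryTo p γ ∧
    Tendsto (fun t => γ t / (‖γ t‖ : ℂ)) atTop (𝓝 (v : ℂ))}

end QuadraticDifferential

/-! ### The oriented real blowup of the sphere at a point -/

/-- The oriented real blowup of `ℂℙ¹` at `p`: the point `p` is replaced by the circle of tangent
directions at `p`. A direction is the unit vector spanning it in the local coordinate centred
at `p`. -/
inductive RealBlowup (p : OnePoint ℂ) : Type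
  | point (x : OnePoint ℂ) (hx : x ≠ p) : RealBlowup p
  | dir (v : Circle) : RealBlowup p

open Classical in
/-- The point of the blowup over `x ≠ p` (the value for `x = p` is irrelevant). -/
def RealBlowup.ofPoint (p x : OnePoint ℂ) : RealBlowup p :=
  if hx : x = p then RealBlowup.dir 1 else RealBlowup.point x hx

/-- The direction of a non-zero complex number. -/
def direction (c : ℂ) : Circle := Circle.exp (Complex.arg c)

/-- Polar coordinates `(r, θ)`, `0 ≤ r`, on the blowup at `p`: for `r > 0` this is the point with
local coordinate `r e^{iθ}`, and for `r = 0` the direction `e^{iθ}`. -/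
def polar (p : OnePoint ℂ) (r θ : ℝ) : RealBlowup p :=
  if r ≤ 0 then RealBlowup.dir (Circle.exp θ)
  else RealBlowup.ofPoint p (locPt p ((r : ℂ) * (Circle.exp θ : ℂ)))

/-- Polar coordinates on the blowup at `p`, measured in the local coordinate centred at a nearby
point `q`. -/
def polarAt (q p : OnePoint ℂ) (r θ : ℝ) : RealBlowup p :=
  if r ≤ 0 then
    RealBlowup.dir (direction
      (deriv (fun w => locCoord p (locPt q (locCoord q p + w))) 0 * (Circle.exp θ : ℂ)))
  else RealBlowup.ofPoint p (locPt q (locCoord q p + (r : ℂ) * (Circle.exp θ : ℂ)))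

/-- The map of blowups induced by a biholomorphism `g` with `g p = q`: it is `g` away from `p`,
and the derivative of `g` at `p` on directions. -/
def blowupMap (g : OnePoint ℂ ≃ₜ OnePoint ℂ) (p q : OnePoint ℂ) : RealBlowup p → RealBlowup q
  | RealBlowup.point x _ => RealBlowup.ofPoint q (g x)
  | RealBlowup.dir v => RealBlowup.dir (direction (deriv (coordExpr g p q) 0 * (v : ℂ)))

/-! ### Framings -/

/-- The closed unit disk. -/
abbrev Disk : Type := Metric.closedBall (0 : ℂ) 1

/-- A point of the unit circle as a boundary point of the disk. -/
def bdry (v : Circle) : Disk := ⟨(v : ℂ), mem_closedBall_zero_iff.2 (Circle.norm_coe v).le⟩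

/-- The determinant of the real matrix with columns `a` and `b`. -/
def det₂ (a b : ℂ) : ℝ := a.re * b.im - a.im * b.re

/-- An orientation preserving diffeomorphism from the oriented real blowup at `p` onto the closed
disk: a bijection matching the boundaries which is smooth with positive Jacobian determinant, both
in the coordinate `u` of the interior and in polar coordinates up to and including the boundary.
(By the inverse function theorem the inverse is then smooth as well. The pair `(r, θ)` is a
positively oriented pair of coordinates.) -/
structure IsOrientedDiffeo (p : OnePoint ℂ) (f : RealBlowup p → Disk) : Prop where
  bijective : Function.Bijective f
  boundary : ∀ v : Circle, ‖(f (RealBlowup.dir v) : ℂ)‖ = 1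
  smooth_interior :
    ContDiff ℝ (⊤ : ℕ∞) (fun u : ℂ => (f (RealBlowup.ofPoint p (affPt p u)) : ℂ))
  jacobian_interior : ∀ u : ℂ,
    0 < det₂ (fderiv ℝ (fun u : ℂ => (f (RealBlowup.ofPoint p (affPt p u)) : ℂ)) u 1)
      (fderiv ℝ (fun u : ℂ => (f (RealBlowup.ofPoint p (affPt p u)) : ℂ)) u Complex.I)
  smooth_boundary :
    ContDiffOn ℝ (⊤ : ℕ∞) (fun y : ℝ × ℝ => (f (polar p y.1 y.2) : ℂ)) {y | 0 ≤ y.1}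
  jacobian_boundary : ∀ y : ℝ × ℝ, 0 ≤ y.1 →
    0 < det₂
      (fderivWithin ℝ (fun y : ℝ × ℝ => (f (polar p y.1 y.2) : ℂ)) {y | 0 ≤ y.1} y (1, 0))
      (fderivWithin ℝ (fun y : ℝ × ℝ => (f (polar p y.1 y.2) : ℂ)) {y | 0 ≤ y.1} y (0, 1))

/-- A quadratic differential on `ℂℙ¹` with simple zeros and a single pole, of order `n + 5`,
together with an orientation preserving diffeomorphism from the oriented real blowup at the pole to
the disk which induces a bijection from the distinguished tangent directions to the set `M` of
marked points. -/
structure FramedDifferential (n : ℕ) (M : Finset Circle) where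
  diff : QuadraticDifferential
  pole : OnePoint ℂ
  simple : diff.HasSimpleZerosAndPole n pole
  framing : RealBlowup pole → Disk
  diffeo : IsOrientedDiffeo pole framing
  marked : Set.BijOn (fun v => framing (RealBlowup.dir v))
    (diff.distinguishedDirections pole) (bdry '' (M : Set Circle))

/-- Two maps `f₁, f₂` to the disk with marked points `M` differ by an isotopy: there is an isotopy
`H` of the disk, fixing the marked points, from the identity to a homeomorphism `H₁` with
`f₂ = H₁ ∘ f₁`. For framings `f₁, f₂` this says that `f₂ = f₁ ∘ h`, where
`h = f₁⁻¹ ∘ H₁ ∘ f₁` is a diffeomorphism of the source of `f₁` isotopic to the identity relative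
to the marked points. -/
def IsotopicMaps {X : Type} (M : Finset Circle) (f₁ f₂ : X → Disk) : Prop :=
  ∃ H : unitInterval → (Disk ≃ₜ Disk),
    Continuous (fun y : unitInterval × Disk => H y.1 y.2) ∧
    (∀ x, H 0 x = x) ∧
    (∀ t, ∀ m ∈ M, H t (bdry m) = bdry m) ∧
    (∀ x, f₂ x = H 1 (f₁ x))

/-- Equivalence of framed differentials, framings being considered up to isotopy: there is a
biholomorphism `g` of `ℂℙ¹` with `g^* φ₂ = φ₁` which carries the framing `f₂` to `f₁`. -/
def Equivalent {n : ℕ} {M : Finset Circle} (x₁ x₂ : FramedDifferential n M) : Prop :=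
  ∃ g : OnePoint ℂ ≃ₜ OnePoint ℂ, IsBiholomorphism g ∧ g x₁.pole = x₂.pole ∧
    QuadraticDifferential.IsPullback g x₂.diff x₁.diff ∧
    IsotopicMaps M x₁.framing (x₂.framing ∘ blowupMap g x₁.pole x₂.pole)

/-- The moduli space of framed quadratic differentials, as the set of equivalence classes. -/
def QuadFr (n : ℕ) (M : Finset Circle) : Type :=
  Quot (Equivalent (n := n) (M := M))

/-- The equivalence class of a framed differential. -/
def QuadFr.mk {n : ℕ} {M : Finset Circle} (x : FramedDifferential n M) : QuadFr n M :=
  Quot.mk _ x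

/-! ### The complex structure of the moduli space -/

/-- A holomorphic family of framed differentials over an open set `U ⊆ ℂᵐ`: the pole depends
holomorphically on the parameter, the differential is jointly holomorphic in the parameter and the
point of `ℂℙ¹` away from the pole, and the framing is jointly continuous in the parameter and the
point of the blowup, in the interior and along the boundary circle. -/
structure IsHolomorphicFamily {n : ℕ} {M : Finset Circle} {m : ℕ} (U : Set (Fin m → ℂ))
    (x : (Fin m → ℂ) → FramedDifferential n M) : Prop where
  pole_continuous : ∀ b ∈ U, ContinuousAt (fun b' => (x b').pole) b
  pole_holomorphic : ∀ b ∈ U,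
    DifferentiableAt ℂ (fun b' => locCoord (x b).pole (x b').pole) b
  diff_holomorphic : ∀ b ∈ U, ∀ q, q ≠ (x b).pole →
    DifferentiableAt ℂ (fun y : (Fin m → ℂ) × ℂ => (x y.1).diff.localCoeff q y.2) (b, 0)
  framing_interior : ∀ b ∈ U, ∀ q, q ≠ (x b).pole →
    ContinuousAt (fun y : (Fin m → ℂ) × OnePoint ℂ =>
      (x y.1).framing (RealBlowup.ofPoint (x y.1).pole y.2)) (b, q)
  framing_boundary : ∀ b ∈ U, ∀ θ : ℝ,
    ContinuousWithinAt (fun y : (Fin m → ℂ) × ℝ × ℝ =>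
      (x y.1).framing (polarAt (x b).pole (x y.1).pole y.2.1 y.2.2))
      {y | 0 ≤ y.2.1} (b, 0, θ)

/-- A map from an open set `U ⊆ ℂᵐ` to the moduli space is holomorphic if locally on `U` it is the
classifying map of a holomorphic family. (A complex manifold structure is determined by the
holomorphic maps into it from open subsets of the spaces `ℂᵐ`.) -/
def IsHolomorphicMap {n : ℕ} {M : Finset Circle} {m : ℕ} (U : Set (Fin m → ℂ))
    (c : (Fin m → ℂ) → QuadFr n M) : Prop :=
  ∀ b ∈ U, ∃ V : Set (Fin m → ℂ), IsOpen V ∧ b ∈ V ∧ V ⊆ U ∧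
    ∃ x : (Fin m → ℂ) → FramedDifferential n M,
      IsHolomorphicFamily V x ∧ ∀ b' ∈ V, QuadFr.mk (x b') = c b'

/-- The topology of the moduli space: the finest one for which the holomorphic maps from open
subsets of the spaces `ℂᵐ` are continuous. -/
instance {n : ℕ} {M : Finset Circle} : TopologicalSpace (QuadFr n M) where
  IsOpen W := ∀ (m : ℕ) (U : Set (Fin m → ℂ)) (c : (Fin m → ℂ) → QuadFr n M),
    IsOpen U → IsHolomorphicMap U c → IsOpen (U ∩ c ⁻¹' W)
  isOpen_univ := by
    intro m U c hU _
    simpa using hU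
  isOpen_inter := by
    intro W₁ W₂ h₁ h₂ m U c hU hc
    have h := (h₁ m U c hU hc).inter (h₂ m U c hU hc)
    rwa [← Set.inter_inter_distrib_left, ← Set.preimage_inter] at h
  isOpen_sUnion := by
    intro S hS m U c hU hc
    rw [Set.preimage_sUnion, Set.inter_iUnion₂]
    exact isOpen_biUnion fun W hW => hS W hW m U c hU hc

/-! ### Polynomials and the discriminant locus -/

/-- The polynomial `z^{n+1} + a_{n-1} z^{n-1} + ⋯ + a₁ z + a₀`. -/
def centredPoly {n : ℕ} (a : Fin n → ℂ) : Polynomial ℂ :=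
  Polynomial.X ^ (n + 1) + ∑ i : Fin n, Polynomial.C (a i) * Polynomial.X ^ (i : ℕ)

/-- The discriminant locus `Δ ⊆ ℂⁿ`: the coefficient vectors of those polynomials
`∏ (z - αᵢ)` for which `∏_{i<j} (αᵢ - αⱼ)² = 0`. -/
def discriminantLocus (n : ℕ) : Set (Fin n → ℂ) :=
  {a | ∃ α : Fin (n + 1) → ℂ,
    centredPoly a = ∏ i, (Polynomial.X - Polynomial.C (α i)) ∧
    ∏ i, ∏ j ∈ Finset.Ioi i, (α i - α j) ^ 2 = 0}

/-- `f₀ k`, `0 ≤ k < n + 3`, is an enumeration of `M` in counterclockwise order; equivalently,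
`e^{2πik/(n+3)} ↦ f₀ k` is a bijection from the `(n+3)`rd roots of unity to `M` which preserves the
cyclic orders. -/
def IsCyclicLabelling {n : ℕ} (M : Finset Circle) (f₀ : Fin (n + 3) → Circle) : Prop :=
  (∃ t : Fin (n + 3) → ℝ, StrictMono t ∧ (∀ i j, t j < t i + 2 * Real.pi) ∧
    ∀ k, f₀ k = Circle.exp (t k)) ∧
  Set.range f₀ = (M : Set Circle)

/-- `x` is the framed differential `(P(z) dz², f)` with `P = z^{n+1} + a_{n-1} z^{n-1} + ⋯ + a₀`,
whose pole is `∞`, where the framing `f` sends the direction at `∞` of the ray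
`ℝ_{>0} e^{2πik/(n+3)}` to the marked point `f₀ k`. (In the coordinate `1/z` at `∞` that direction
is `e^{-2πik/(n+3)}`.) -/
def IsNormalForm {n : ℕ} {M : Finset Circle} (f₀ : Fin (n + 3) → Circle)
    (x : FramedDifferential n M) (a : Fin n → ℂ) : Prop :=
  x.pole = OnePoint.infty ∧
  (∀ z : ℂ, x.diff.coeff z = (centredPoly a).eval z) ∧
  ∀ k : Fin (n + 3),
    x.framing (RealBlowup.dir (Circle.exp (-(2 * Real.pi * (k : ℝ) / ((n : ℝ) + 3))))) =
      bdry (f₀ k)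

end FramedQuad

end

open Filter Topology

noncomputable section

namespace FramedQuad

/-! ### Polynomials -/

/-! Off the pole the sphere has a global affine coordinate `u`, in which the differential is `Q(u)
du²` with `Q` entire. A pole of order `n + 5` in `1/u` means that `Q` grows like `u ^ (n + 1)`,
because `du²` itself accounts for order four; so `Q` is a polynomial of degree `n + 1`, with simple
roots since the zeros are simple (`QuadraticDifferential.exists_polynomial`).

An affine substitution `u = α z + β` replaces `Q` by `α² Q(α z + β)`. Making this monic and centred
determines `β`, and determines `α` up to an `(n + 3)`rd root of unity. The framing removes the
ambiguity. If `c` is the leading coefficient, the distinguished directions `v` satisfy `c v⁻⁽ⁿ⁺³⁾ >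
0`, and there are exactly `n + 3` of them. A framing restricts to an orientation preserving map of
boundary circles (`IsOrientedDiffeo.exists_boundary_lift`), hence carries these directions to the
marked points in cyclic order. Exactly one choice of `α` therefore makes the labelling equal to `f₀`
(`exists_normalizes`, `Normalizes.unique`). The resulting coefficient vector is an invariant of the
class: biholomorphisms matching the poles are affine in `u` (`IsBiholomorphism.exists_affine`), and
isotopies fix the marked points.

The invariant is complete because two framings that agree at the marked points are isotopic: the
displacement on the boundary is contracted linearly while the interior is handled by the Alexander
trick (`exists_isotopy`, `IsNormalForm.equivalent`). It takes every value off the discriminant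
because one explicit framing of the blowup at `∞` serves all centred polynomials at once
(`exists_framing`).

For a holomorphic family, the coefficients of the polynomial are recovered from finitely many of its
values, and continuity of the framing forces `α` to follow a single holomorphic branch of the root
(`IsHolomorphicFamily.differentiableAt`). Conversely, a holomorphic family of coefficient vectors
with the constant framing is a holomorphic family of framed differentials. The topology of the
moduli space is defined through holomorphic maps, so this equivalence also yields the homeomorphism.
-/

open Polynomial in
theorem exists_polynomial_of_growth (k : ℕ) : ∀ {f : ℂ → ℂ}, Differentiable ℂ f → ∀ {C R : ℝ},
    (∀ z, R ≤ ‖z‖ → ‖f z‖ ≤ C * ‖z‖ ^ k) →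
    ∃ Q : ℂ[X], Q.natDegree ≤ k ∧ ∀ z, f z = Q.eval z := by
  induction k with
  | zero =>
    intro f hf C R h
    -- Base case: the bound outside a disk and compactness inside it make `f` bounded, so
    -- Liouville's theorem applies.
    have hb : Bornology.IsBounded (Set.range f) := by
      obtain ⟨B, hB⟩ := (isCompact_closedBall (0 : ℂ) R).exists_bound_of_continuousOn
        hf.continuous.continuousOn
      refine isBounded_iff_forall_norm_le.2 ⟨max B C, ?_⟩
      rintro _ ⟨z, rfl⟩
      rcases le_total R ‖z‖ with hz | hz
      · exact (by simpa using h z hz : ‖f z‖ ≤ C).trans (le_max_right _ _)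
      · exact (hB z (by simpa using hz)).trans (le_max_left _ _)
    exact ⟨Polynomial.C (f 0), by simp, fun z => by simpa using hf.apply_eq_apply_of_bounded hb z 0⟩
  | succ k ih =>
    intro f hf C R h
    -- The quotient `(f z - f 0) / z` is again entire and its growth exponent is one lower.
    have hd : Differentiable ℂ (dslope f 0) := by
      rw [← differentiableOn_univ]
      exact (Complex.differentiableOn_dslope Filter.univ_mem).2 hf.differentiableOn
    -- Enlarging the radius to at least `1` lets `‖z‖ ^ (k + 1)` absorb the constant `‖f 0‖`.
    obtain ⟨Q, hQ, hQe⟩ := ih (f := dslope f 0) hd (C := C + ‖f 0‖) (R := max R 1) (by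
      intro z hz
      have hR := (le_max_left _ _).trans hz
      have h1 := (le_max_right _ _).trans hz
      have hz0 : z ≠ 0 := by rintro rfl; norm_num at h1
      have hz' : 0 < ‖z‖ := by positivity
      rw [dslope_of_ne _ hz0, slope_def_field, norm_div, sub_zero, div_le_iff₀ hz']
      calc ‖f z - f 0‖ ≤ ‖f z‖ + ‖f 0‖ := norm_sub_le _ _
        _ ≤ C * ‖z‖ ^ (k + 1) + ‖f 0‖ * ‖z‖ ^ (k + 1) := by
          gcongr
          · exact h z hR
          · exact le_mul_of_one_le_right (norm_nonneg _) (one_le_pow₀ h1)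
        _ = _ := by ring)
    refine ⟨X * Q + Polynomial.C (f 0), ?_, fun z => ?_⟩
    · refine (natDegree_add_C).trans_le ((natDegree_mul_le).trans ?_)
      have := natDegree_X_le (R := ℂ)
      omega
    · rw [eval_add, eval_mul, eval_X, eval_C, ← hQe]
      have := sub_smul_dslope f 0 z
      simp only [sub_zero, smul_eq_mul] at this
      rw [this]; ring

open Polynomial in
theorem tendsto_eval_div_pow {Q : ℂ[X]} {k : ℕ} (hQ : Q.natDegree ≤ k) :
    Tendsto (fun u : ℂ => Q.eval u / u ^ k) (Bornology.cobounded ℂ) (𝓝 (Q.coeff k)) := by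
  have h1 : Tendsto (fun u : ℂ => ∑ i ∈ Finset.range (k + 1), Q.coeff i * (u⁻¹) ^ (k - i))
      (Bornology.cobounded ℂ) (𝓝 (∑ i ∈ Finset.range (k + 1), Q.coeff i * (0 : ℂ) ^ (k - i))) :=
    tendsto_finsetSum _ fun i _ => ((tendsto_inv₀_cobounded).pow _).const_mul _
  have h2 : (∑ i ∈ Finset.range (k + 1), Q.coeff i * (0 : ℂ) ^ (k - i)) = Q.coeff k := by
    rw [Finset.sum_range_succ, Finset.sum_eq_zero]
    · simp
    · intro i hi
      rw [Finset.mem_range] at hi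
      rw [zero_pow (by omega), mul_zero]
  rw [h2] at h1
  refine h1.congr' ?_
  have : ∀ᶠ u : ℂ in Bornology.cobounded ℂ, u ≠ 0 := (Metric.hasBasis_cobounded_compl_closedBall (0 : ℂ)).mem_of_mem (i := 0) trivial |> fun h => by
      filter_upwards [h] with u hu h0; simp [h0] at hu
  filter_upwards [this] with u hu
  rw [eval_eq_sum_range' (Nat.lt_succ_of_le hQ), Finset.sum_div]
  refine Finset.sum_congr rfl fun i hi => ?_
  rw [Finset.mem_range] at hi
  have : u ^ k = u ^ i * u ^ (k - i) := by rw [← pow_add]; congr 1; omega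
  rw [this, inv_pow]
  field_simp

open Polynomial in
theorem natDegree_eq_of_tendsto {Q : ℂ[X]} {k : ℕ} (hQ : Q.natDegree ≤ k) {c : ℂ} (hc : c ≠ 0)
    (h : Tendsto (fun u : ℂ => Q.eval u / u ^ k) (Bornology.cobounded ℂ) (𝓝 c)) :
    Q.natDegree = k ∧ Q.coeff k = c := by
  have h1 := tendsto_nhds_unique (tendsto_eval_div_pow hQ) h
  exact ⟨natDegree_eq_of_le_of_coeff_ne_zero hQ (h1 ▸ hc), h1⟩

open Polynomial in
theorem coeff_centredPoly {n : ℕ} (a : Fin n → ℂ) (i : Fin n) :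
    (centredPoly a).coeff i = a i := by
  rw [centredPoly, coeff_add, coeff_X_pow, if_neg (by have := i.2; omega), zero_add,
    finsetSum_coeff, Finset.sum_eq_single i]
  · simp
  · intro j _ hj
    rw [coeff_C_mul_X_pow, if_neg (fun h => hj (Fin.ext h.symm))]
  · simp

open Polynomial in
theorem coeff_sum_lt {n : ℕ} (a : Fin n → ℂ) {k : ℕ} (hk : n ≤ k) :
    (∑ i : Fin n, C (a i) * X ^ (i : ℕ)).coeff k = 0 := by
  rw [finsetSum_coeff]
  refine Finset.sum_eq_zero fun j _ => ?_
  rw [coeff_C_mul_X_pow, if_neg (by have := j.2; omega)]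

open Polynomial in
theorem coeff_centredPoly_self {n : ℕ} (a : Fin n → ℂ) : (centredPoly a).coeff n = 0 := by
  rw [centredPoly, coeff_add, coeff_sum_lt a le_rfl, coeff_X_pow, if_neg (by omega), add_zero]

open Polynomial in
theorem coeff_centredPoly_succ {n : ℕ} (a : Fin n → ℂ) : (centredPoly a).coeff (n + 1) = 1 := by
  rw [centredPoly, coeff_add, coeff_sum_lt a (by omega), coeff_X_pow, if_pos rfl, add_zero]

open Polynomial in
theorem natDegree_centredPoly {n : ℕ} (a : Fin n → ℂ) : (centredPoly a).natDegree = n + 1 := by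
  refine natDegree_eq_of_le_of_coeff_ne_zero ?_ (by rw [coeff_centredPoly_succ]; exact one_ne_zero)
  rw [natDegree_le_iff_coeff_eq_zero]
  intro k hk
  rw [centredPoly, coeff_add, coeff_sum_lt a (by omega), coeff_X_pow, if_neg (by omega), add_zero]

open Polynomial in
theorem eq_centredPoly {n : ℕ} {Q : ℂ[X]} (h : Q.natDegree ≤ n + 1) (h1 : Q.coeff (n + 1) = 1)
    (h0 : Q.coeff n = 0) : Q = centredPoly fun i : Fin n => Q.coeff i := by
  ext k
  rcases lt_trichotomy k n with hk | rfl | hk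
  · exact (coeff_centredPoly (fun i : Fin n => Q.coeff i) ⟨k, hk⟩).symm
  · rw [h0, coeff_centredPoly_self]
  · rcases eq_or_lt_of_le (Nat.succ_le_of_lt hk) with rfl | hk'
    · rw [coeff_centredPoly_succ]; exact h1
    · rw [coeff_eq_zero_of_natDegree_lt (by omega),
        coeff_eq_zero_of_natDegree_lt (by rw [natDegree_centredPoly]; omega)]

theorem centredPoly_injective {n : ℕ} {a b : Fin n → ℂ} (h : centredPoly a = centredPoly b) :
    a = b := by
  ext i; rw [← coeff_centredPoly a i, h, coeff_centredPoly]

open Polynomial in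
/-- The two top coefficients of a polynomial after an affine substitution. -/
theorem coeff_comp_affine {Q : ℂ[X]} {n : ℕ} (hQ : Q.natDegree ≤ n + 1) (α β : ℂ) :
    (Q.comp (C α * X + C β)).natDegree ≤ n + 1 ∧
    (Q.comp (C α * X + C β)).coeff (n + 1) = Q.coeff (n + 1) * α ^ (n + 1) ∧
    (Q.comp (C α * X + C β)).coeff n =
      Q.coeff n * α ^ n + Q.coeff (n + 1) * ((n + 1) * α ^ n * β) := by
  have hlin : (C α * X + C β : ℂ[X]).natDegree ≤ 1 := natDegree_linear_le
  -- The formula also holds for `k > m`: the truncated exponent `m - k` is harmless because the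
  -- binomial coefficient vanishes.
  have hco : ∀ m k, ((C α * X + C β : ℂ[X]) ^ m).coeff k = α ^ k * β ^ (m - k) * (m.choose k) := by
    intro m k
    rw [add_pow, finsetSum_coeff]
    have : ∀ j ∈ Finset.range (m + 1), ((C α * X) ^ j * C β ^ (m - j) * ((m.choose j : ℕ) : ℂ[X])).coeff k
        = if k = j then α ^ k * β ^ (m - k) * (m.choose k) else 0 := by
      intro j _
      rw [mul_pow, ← C_pow, ← C_pow, ← C_eq_natCast, mul_right_comm _ (X ^ j) _, mul_right_comm _ (X ^ j) _,
        ← C_mul, ← C_mul, coeff_C_mul_X_pow]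
      by_cases h : k = j
      · subst h; simp
      · simp [h]
    rw [Finset.sum_congr rfl this, Finset.sum_ite_eq]
    split_ifs with h
    · rfl
    · rw [Finset.mem_range] at h
      rw [Nat.choose_eq_zero_of_lt (by omega)]; simp
  have hsum : Q.comp (C α * X + C β) =
      ∑ i ∈ Finset.range (n + 2), C (Q.coeff i) * (C α * X + C β) ^ i := by
    rw [comp, eval₂_eq_sum_range' C (Nat.lt_succ_of_le hQ)]
  refine ⟨natDegree_comp_le.trans ?_, ?_, ?_⟩
  · calc Q.natDegree * _ ≤ (n + 1) * 1 := Nat.mul_le_mul hQ hlin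
      _ = _ := mul_one _
  · rw [hsum, finsetSum_coeff, Finset.sum_range_succ, Finset.sum_eq_zero]
    · simp [coeff_C_mul, hco]
    · intro i hi
      rw [Finset.mem_range] at hi
      rw [coeff_C_mul, hco, Nat.choose_eq_zero_of_lt (by omega)]; simp
  · rw [hsum, finsetSum_coeff, Finset.sum_range_succ, Finset.sum_range_succ, Finset.sum_eq_zero]
    · simp only [coeff_C_mul, hco, Nat.sub_self, pow_zero, Nat.choose_self, Nat.choose_succ_self_right,
        Nat.add_sub_cancel_left, pow_one]
      push_cast; ring
    · intro i hi
      rw [Finset.mem_range] at hi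
      rw [coeff_C_mul, hco, Nat.choose_eq_zero_of_lt (by omega)]; simp

open Polynomial in
/-- Coefficients depend differentiably on a parameter if the values do. -/
theorem differentiableAt_coeff {E : Type*} [NormedAddCommGroup E] [NormedSpace ℂ E]
    {R : E → ℂ[X]} {d : ℕ} {b₀ : E} (hd : ∀ᶠ b in 𝓝 b₀, (R b).natDegree ≤ d)
    (h : ∀ z ≠ 0, DifferentiableAt ℂ (fun b => (R b).eval z) b₀) (i : ℕ) :
    DifferentiableAt ℂ (fun b => (R b).coeff i) b₀ := by
  -- Lagrange interpolation at `1, …, d + 1` expresses each coefficient as a fixed linear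
  -- combination of values. The node `0` is avoided since nothing is assumed there.
  set v : ℕ → ℂ := fun j => (j : ℂ) + 1 with hv
  set s : Finset ℕ := Finset.range (d + 1)
  have hinj : Set.InjOn v s := fun x _ y _ hxy => by simpa [hv] using hxy
  have hne : ∀ j, v j ≠ 0 := fun j => Nat.cast_add_one_ne_zero j
  have key : ∀ᶠ b in 𝓝 b₀, (R b).coeff i =
      ∑ j ∈ s, (R b).eval (v j) * (Lagrange.basis s v j).coeff i := by
    filter_upwards [hd] with b hb
    have hdeg : (R b).degree < s.card := by
      refine degree_le_natDegree.trans_lt ?_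
      simp only [s, Finset.card_range]
      exact_mod_cast Nat.lt_succ_of_le hb
    conv_lhs => rw [Lagrange.eq_interpolate hinj hdeg]
    rw [Lagrange.interpolate_apply, finsetSum_coeff]
    exact Finset.sum_congr rfl fun j _ => coeff_C_mul _
  refine DifferentiableAt.congr_of_eventuallyEq ?_ key
  refine DifferentiableAt.fun_sum fun j _ => ?_
  exact (h _ (hne j)).mul_const _

/-! ### The discriminant locus -/

-- A repeated root is a common root of the polynomial and its derivative. In this form the condition
-- is closed in the pair (coefficients, root) and is stable under affine substitutions.
open Polynomial in
theorem mem_discriminantLocus_iff {n : ℕ} {a : Fin n → ℂ} :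
    a ∈ discriminantLocus n ↔
      ∃ z, (centredPoly a).eval z = 0 ∧ (derivative (centredPoly a)).eval z = 0 := by
  constructor
  · rintro ⟨α, hα, h⟩
    obtain ⟨i, -, hi⟩ := Finset.prod_eq_zero_iff.1 h
    obtain ⟨j, hj, hij⟩ := Finset.prod_eq_zero_iff.1 hi
    have hne : i ≠ j := (Finset.mem_Ioi.1 hj).ne
    have heq : α i = α j := sub_eq_zero.1 (pow_eq_zero_iff two_ne_zero |>.1 hij)
    have h1 : centredPoly a = (X - C (α j)) * ((X - C (α j)) *
        ∏ k ∈ (Finset.univ.erase i).erase j, (X - C (α k))) := by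
      rw [Finset.mul_prod_erase (Finset.univ.erase i) (fun k => X - C (α k)) (by simp [hne.symm]),
        ← heq, Finset.mul_prod_erase Finset.univ (fun k => X - C (α k)) (by simp), hα]
    refine ⟨α j, ?_, ?_⟩
    · rw [h1]; simp
    · rw [h1]; simp [derivative_mul]
  · rintro ⟨z, hz, hz'⟩
    have hmonic : (centredPoly a).Monic := by
      rw [Monic, leadingCoeff, natDegree_centredPoly, coeff_centredPoly_succ]
    have hsplit := IsAlgClosed.splits (centredPoly a)
    have hcard : (centredPoly a).roots.toList.length = n + 1 := by
      rw [Multiset.length_toList, ← hsplit.natDegree_eq_card_roots, natDegree_centredPoly]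
    set α : Fin (n + 1) → ℂ := fun i => (centredPoly a).roots.toList.get (i.cast hcard.symm) with hαd
    have hα : centredPoly a = ∏ i, (X - C (α i)) := by
      conv_lhs => rw [hsplit.eq_prod_roots_of_monic hmonic, ← Multiset.coe_toList (centredPoly a).roots,
        Multiset.map_coe, Multiset.prod_coe,
        ← Fin.prod_univ_fun_getElem (centredPoly a).roots.toList (fun x => X - C x)]
      exact (Fintype.prod_equiv (finCongr hcard.symm) _ _ fun i => rfl).symm
    refine ⟨α, hα, ?_⟩
    obtain ⟨i, -, hi⟩ := Finset.prod_eq_zero_iff.1 (by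
      rw [hα, eval_prod] at hz; exact hz)
    have hiz : z = α i := by simpa [sub_eq_zero] using hi
    have h1 : centredPoly a = (X - C (α i)) * ∏ k ∈ Finset.univ.erase i, (X - C (α k)) := by
      rw [Finset.mul_prod_erase Finset.univ (fun k => X - C (α k)) (by simp), hα]
    rw [h1] at hz'
    simp only [derivative_mul, derivative_sub, derivative_X, derivative_C, eval_add, eval_mul, eval_sub,
      eval_X, eval_C, hiz, sub_self, zero_mul, add_zero, sub_zero, one_mul] at hz'
    rw [eval_prod] at hz'
    obtain ⟨j, hj, hj'⟩ := Finset.prod_eq_zero_iff.1 hz'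
    have hji : α i = α j := by simpa [sub_eq_zero] using hj'
    have hne : j ≠ i := Finset.ne_of_mem_erase hj
    rcases lt_or_gt_of_ne hne with hlt | hlt
    · exact Finset.prod_eq_zero (Finset.mem_univ j)
        (Finset.prod_eq_zero (Finset.mem_Ioi.2 hlt) (by simp [hji]))
    · exact Finset.prod_eq_zero (Finset.mem_univ i)
        (Finset.prod_eq_zero (Finset.mem_Ioi.2 hlt) (by simp [hji]))

theorem eval_centredPoly {n : ℕ} (a : Fin n → ℂ) (z : ℂ) :
    (centredPoly a).eval z = z ^ (n + 1) + ∑ i : Fin n, a i * z ^ (i : ℕ) := by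
  simp [centredPoly, Polynomial.eval_finsetSum]

theorem eval_derivative_centredPoly {n : ℕ} (a : Fin n → ℂ) (z : ℂ) :
    (Polynomial.derivative (centredPoly a)).eval z =
      (n + 1) * z ^ n + ∑ i : Fin n, a i * (i * z ^ ((i : ℕ) - 1)) := by
  simp [centredPoly, Polynomial.eval_finsetSum, Polynomial.derivative_X_pow]

/-- A root of a centred polynomial is bounded in terms of the coefficients. -/
theorem norm_le_of_eval_centredPoly_eq_zero {n : ℕ} {a : Fin n → ℂ} {z : ℂ}
    (hz : (centredPoly a).eval z = 0) : ‖z‖ ≤ 1 + ∑ i, ‖a i‖ := by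
  have hS : 0 ≤ ∑ i, ‖a i‖ := Finset.sum_nonneg fun i _ => norm_nonneg _
  by_contra! h
  have h1 : 1 ≤ ‖z‖ := by linarith
  have h2 : ‖z‖ ^ (n + 1) ≤ (∑ i, ‖a i‖) * ‖z‖ ^ n := by
    rw [eval_centredPoly] at hz
    rw [← norm_pow, eq_neg_of_add_eq_zero_left hz, norm_neg, Finset.sum_mul]
    refine (norm_sum_le _ _).trans (Finset.sum_le_sum fun i _ => ?_)
    rw [norm_mul, norm_pow]
    gcongr
    exact i.2.le
  have h3 : 0 < ‖z‖ ^ n := by positivity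
  rw [pow_succ'] at h2
  have := le_of_mul_le_mul_right h2 h3
  linarith

/-- The pairs of a coefficient vector and a multiple root form a closed set. Roots are bounded
locally uniformly in the coefficients, so locally the discriminant locus is the projection of that
set along a compact ball, and such projections are closed maps. -/
theorem isClosed_discriminantLocus (n : ℕ) : IsClosed (discriminantLocus n) := by
  rw [← isOpen_compl_iff, isOpen_iff_mem_nhds]
  intro a₀ ha₀
  -- One more than the root bound at `a₀`, so that the bound stays below `B` for all nearby `a`.
  set B : ℝ := 2 + ∑ i, ‖a₀ i‖
  have hcl : IsClosed {y : (Fin n → ℂ) × Metric.closedBall (0 : ℂ) B |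
      (centredPoly y.1).eval (y.2 : ℂ) = 0 ∧
      (Polynomial.derivative (centredPoly y.1)).eval (y.2 : ℂ) = 0} := by
    simp only [eval_centredPoly, eval_derivative_centredPoly]
    exact (isClosed_eq (by fun_prop) (by fun_prop)).inter (isClosed_eq (by fun_prop) (by fun_prop))
  have : CompactSpace (Metric.closedBall (0 : ℂ) B) :=
    isCompact_iff_compactSpace.1 (isCompact_closedBall _ _)
  have hcl2 := (isClosedMap_fst_of_compactSpace
    (X := Fin n → ℂ) (Y := Metric.closedBall (0 : ℂ) B)) _ hcl
  have hb : ∀ᶠ a : Fin n → ℂ in 𝓝 a₀, 1 + ∑ i, ‖a i‖ < B := by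
    have : Continuous fun a : Fin n → ℂ => 1 + ∑ i, ‖a i‖ := by fun_prop
    exact this.continuousAt.eventually_lt continuousAt_const (by simp only [B]; linarith)
  have hn : ∀ᶠ a in 𝓝 a₀, a ∉ Prod.fst '' {y : (Fin n → ℂ) × Metric.closedBall (0 : ℂ) B |
      (centredPoly y.1).eval (y.2 : ℂ) = 0 ∧
      (Polynomial.derivative (centredPoly y.1)).eval (y.2 : ℂ) = 0} := by
    refine hcl2.isOpen_compl.mem_nhds ?_
    rintro ⟨y, ⟨h1, h2⟩, hy⟩
    rw [hy] at h1 h2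
    exact ha₀ (mem_discriminantLocus_iff.2 ⟨_, h1, h2⟩)
  filter_upwards [hb, hn] with a h1 h2 h3
  obtain ⟨z, hz, hz'⟩ := mem_discriminantLocus_iff.1 h3
  exact h2 ⟨⟨a, ⟨z, by
    simpa using (norm_le_of_eval_centredPoly_eq_zero hz).trans h1.le⟩⟩, ⟨hz, hz'⟩, rfl⟩

/-! ### Charts of the sphere -/

open OnePoint in
@[simp] theorem locPt_zero (p : OnePoint ℂ) : locPt p 0 = p := by
  induction p using OnePoint.rec <;> simp [locPt]

@[simp] theorem locCoord_self (p : OnePoint ℂ) : locCoord p p = 0 := by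
  induction p using OnePoint.rec <;> simp [locCoord]

@[simp] theorem locCoord_locPt (p : OnePoint ℂ) (w : ℂ) : locCoord p (locPt p w) = w := by
  induction p using OnePoint.rec with
  | infty =>
    by_cases h : w = 0
    · simp [locPt, h, locCoord]
    · simp [locPt, h, locCoord]
  | coe a => simp [locPt, locCoord]

theorem locPt_injective (p : OnePoint ℂ) : Function.Injective (locPt p) := fun w w' h => by
  rw [← locCoord_locPt p w, h, locCoord_locPt]

theorem locPt_ne {p : OnePoint ℂ} {w : ℂ} (hw : w ≠ 0) : locPt p w ≠ p := fun h =>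
  hw (locPt_injective p (h.trans (locPt_zero p).symm))

/-- The affine coordinate on the complement of `p` is the reciprocal of the local coordinate at `p`,
whether `p` is finite or not. This permits a uniform treatment of the two kinds of pole. -/
theorem affPt_inv {p : OnePoint ℂ} {w : ℂ} (hw : w ≠ 0) : affPt p w⁻¹ = locPt p w := by
  induction p using OnePoint.rec with
  | infty => simp [affPt, locPt, hw]
  | coe a => simp [affPt, locPt, hw]

theorem locPt_inv {p : OnePoint ℂ} {u : ℂ} (hu : u ≠ 0) : locPt p u⁻¹ = affPt p u := by
  rw [← affPt_inv (inv_ne_zero hu), inv_inv]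

theorem affPt_ne (p : OnePoint ℂ) (u : ℂ) : affPt p u ≠ p := by
  induction p using OnePoint.rec with
  | infty => simp [affPt]
  | coe a =>
    by_cases h : u = 0
    · simp [affPt, h]
    · simp [affPt, h]

theorem exists_affPt {p x : OnePoint ℂ} (hx : x ≠ p) : ∃ u, affPt p u = x := by
  induction p using OnePoint.rec with
  | infty =>
    induction x using OnePoint.rec with
    | infty => exact absurd rfl hx
    | coe z => exact ⟨z, rfl⟩
  | coe a =>
    induction x using OnePoint.rec with
    | infty => exact ⟨0, by simp [affPt]⟩
    | coe z =>
      have : z - a ≠ 0 := fun h => hx (by rw [sub_eq_zero.1 h])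
      exact ⟨(z - a)⁻¹, by simp [affPt, this]⟩

theorem affPt_injective (p : OnePoint ℂ) : Function.Injective (affPt p) := by
  intro u u' h
  induction p using OnePoint.rec with
  | infty => simpa [affPt] using h
  | coe a =>
    by_cases h0 : u = 0 <;> by_cases h1 : u' = 0 <;> simp_all [affPt]

theorem tendsto_locPt (p : OnePoint ℂ) : Tendsto (locPt p) (𝓝 0) (𝓝 p) := by
  induction p using OnePoint.rec with
  | infty =>
    rw [← pure_sup_nhdsNE, tendsto_sup]
    constructor
    · rw [tendsto_pure_left]
      intro s hs
      rw [locPt_zero]; exact mem_of_mem_nhds hs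
    · have h1 : Tendsto (fun w : ℂ => ((w⁻¹ : ℂ) : OnePoint ℂ)) (𝓝[≠] 0) (𝓝 OnePoint.infty) := by
        refine OnePoint.tendsto_coe_infty.comp ?_
        rw [Filter.coclosedCompact_eq_cocompact, ← Metric.cobounded_eq_cocompact]
        exact tendsto_inv₀_nhdsNE_zero
      refine h1.congr' ?_
      filter_upwards [self_mem_nhdsWithin] with w hw
      have hw : w ≠ 0 := hw
      simp [locPt, hw]
  | coe a =>
    have : Tendsto (fun w : ℂ => a + w) (𝓝 0) (𝓝 (a + 0)) :=
      (continuous_const.add continuous_id).tendsto 0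
    rw [add_zero] at this
    exact (OnePoint.continuous_coe.tendsto a).comp this

theorem locPt_locCoord_eventually (p : OnePoint ℂ) :
    ∀ᶠ y in 𝓝 p, locPt p (locCoord p y) = y := by
  induction p using OnePoint.rec with
  | infty =>
    have : ∀ᶠ y : OnePoint ℂ in 𝓝 OnePoint.infty, y ≠ ((0 : ℂ) : OnePoint ℂ) :=
      isOpen_ne.mem_nhds (OnePoint.infty_ne_coe 0)
    filter_upwards [this] with y hy
    induction y using OnePoint.rec with
    | infty => simp
    | coe z =>
      have : z ≠ 0 := fun h => hy (by rw [h])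
      simp [locCoord, locPt, this]
  | coe a =>
    have : ∀ᶠ y : OnePoint ℂ in 𝓝 (a : OnePoint ℂ), y ≠ OnePoint.infty :=
      isOpen_ne.mem_nhds (OnePoint.coe_ne_infty a)
    filter_upwards [this] with y hy
    induction y using OnePoint.rec with
    | infty => exact absurd rfl hy
    | coe z => simp [locCoord, locPt]

theorem tendsto_locCoord (p : OnePoint ℂ) : Tendsto (locCoord p) (𝓝 p) (𝓝 0) := by
  induction p using OnePoint.rec with
  | infty =>
    rw [OnePoint.nhds_infty_eq, tendsto_sup, tendsto_map'_iff, coclosedCompact_eq_cocompact,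
      ← Metric.cobounded_eq_cocompact]
    refine ⟨tendsto_inv₀_cobounded, ?_⟩
    rw [tendsto_pure_left]
    intro s hs
    rw [locCoord_self]; exact mem_of_mem_nhds hs
  | coe a =>
    rw [OnePoint.nhds_coe_eq, tendsto_map'_iff]
    have : Tendsto (fun z : ℂ => z - a) (𝓝 a) (𝓝 (a - a)) :=
      (continuous_id.sub continuous_const).tendsto a
    rw [sub_self] at this
    exact this

/-! ### Analytic functions with at most simple zeros -/

/-- `f` is analytic at `z` with at most a simple zero. -/
def SimpleAt (f : ℂ → ℂ) (z : ℂ) : Prop :=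
  AnalyticAt ℂ f z ∧ (f z = 0 → deriv f z ≠ 0)

/-- Normal form turns non-negative order into honest analyticity; if `f` and its derivative both
vanished at `z`, the order would be at least two. -/
theorem simpleAt_of_order {f : ℂ → ℂ} {z : ℂ} (hf : MeromorphicNFAt f z)
    (h : meromorphicOrderAt f z = 0 ∨ meromorphicOrderAt f z = 1) : SimpleAt f z := by
  have ha : AnalyticAt ℂ f z := hf.meromorphicOrderAt_nonneg_iff_analyticAt.1 (by
    rcases h with h | h <;> rw [h]
    exact zero_le_one)
  refine ⟨ha, fun h0 h1 => ?_⟩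
  have h2 : (2 : ℕ∞) ≤ analyticOrderAt f z := by
    have := (natCast_le_analyticOrderAt_iff_iteratedDeriv_eq_zero ha (n := 2)).2 (by
      intro i hi
      interval_cases i
      · simpa using h0
      · simpa using h1)
    exact_mod_cast this
  rw [ha.meromorphicOrderAt_eq] at h
  cases ho : analyticOrderAt f z with
  | top => rw [ho] at h; simp at h
  | coe m =>
    rw [ho] at h h2
    have h2' : 2 ≤ m := by exact_mod_cast h2
    simp only [ENat.map_natCast] at h
    rcases h with h | h
    · have : (m : ℤ) = 0 := by exact_mod_cast h
      omega
    · have : (m : ℤ) = 1 := by exact_mod_cast h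
      omega

theorem SimpleAt.order {f : ℂ → ℂ} {z : ℂ} (h : SimpleAt f z) :
    meromorphicOrderAt f z = 0 ∨ meromorphicOrderAt f z = 1 := by
  rw [h.1.meromorphicOrderAt_eq]
  by_cases h0 : f z = 0
  · right
    rw [h.1.analyticOrderAt_eq_one_of_zero_deriv_ne_zero h0 (h.2 h0)]; rfl
  · left
    rw [h.1.analyticOrderAt_eq_zero.2 h0]; rfl

/-- This is the shape of the transformation rule of a quadratic differential: a conformal
substitution followed by multiplication with a unit. At a zero of `f`, only the term of the product
rule that differentiates `f` survives. -/
theorem SimpleAt.comp_mul {f g k : ℂ → ℂ} {z : ℂ} (hf : SimpleAt f (g z)) (hg : AnalyticAt ℂ g z)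
    (hg' : deriv g z ≠ 0) (hk : AnalyticAt ℂ k z) (hk0 : k z ≠ 0) :
    SimpleAt (fun u => f (g u) * k u) z := by
  refine ⟨(hf.1.fun_comp hg).mul hk, fun h => ?_⟩
  have h0 : f (g z) = 0 := (mul_eq_zero.1 h).resolve_right hk0
  have hd := (hf.1.differentiableAt.hasDerivAt.comp z hg.differentiableAt.hasDerivAt).mul
    hk.differentiableAt.hasDerivAt
  have : deriv (fun u => f (g u) * k u) z = _ := hd.deriv
  rw [this]
  simp only [Function.comp_apply, h0, zero_mul, add_zero]
  exact mul_ne_zero (mul_ne_zero (hf.2 h0) hg') hk0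

theorem SimpleAt.congr {f g : ℂ → ℂ} {z : ℂ} (hf : SimpleAt f z) (h : f =ᶠ[𝓝 z] g) :
    SimpleAt g z :=
  ⟨hf.1.congr h, fun h0 => by rw [← h.deriv_eq]; exact hf.2 (h.eq_of_nhds.trans h0)⟩

/-! ### Differentials with a single pole and simple zeros are polynomial -/

namespace QuadraticDifferential

variable (φ : QuadraticDifferential)

theorem orderAt_coe (z : ℂ) : φ.orderAt (z : OnePoint ℂ) = meromorphicOrderAt φ.coeff z := by
  have := meromorphicOrderAt_comp_add_const_eq_meromorphicOrderAt (f := φ.coeff) (c := z)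
    (x := 0)
  rw [zero_add] at this
  rw [← this, orderAt]
  congr 1
  ext w
  exact congrArg φ.coeff (add_comm _ _)

theorem orderAt_infty : φ.orderAt OnePoint.infty = meromorphicOrderAt φ.coeffInfty 0 := rfl

theorem localCoeff_coe (a w : ℂ) : φ.localCoeff (a : OnePoint ℂ) w = φ.coeff (a + w) := rfl

theorem localCoeff_infty (w : ℂ) : φ.localCoeff OnePoint.infty w = φ.coeffInfty w := rfl

theorem coeffInfty_inv {z : ℂ} (hz : z ≠ 0) : φ.coeffInfty z⁻¹ = φ.coeff z * z ^ 4 := by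
  rw [φ.transform z hz]; field_simp

theorem coeff_inv {w : ℂ} (hw : w ≠ 0) : φ.coeff w⁻¹ = φ.coeffInfty w * w ^ 4 := by
  rw [φ.transform _ (inv_ne_zero hw), inv_inv]; field_simp

theorem meromorphicAt_localCoeff (p : OnePoint ℂ) : MeromorphicAt (φ.localCoeff p) 0 := by
  induction p using OnePoint.rec with
  | infty => exact (φ.meromorphic_coeffInfty (Set.mem_univ 0)).meromorphicAt
  | coe a =>
    have h := (φ.meromorphic_coeff (Set.mem_univ a)).meromorphicAt
    refine MeromorphicAt.comp_analyticAt (g := fun w => a + w) (by simpa using h) (by fun_prop)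

variable {φ}

/-- The coefficient of `φ` in the coordinate `u`, up to the value at `u = 0`. -/
theorem exists_entire {n : ℕ} {p : OnePoint ℂ} (h : φ.HasSimpleZerosAndPole n p) :
    ∃ q : ℂ → ℂ, (∀ u, SimpleAt q u) ∧ ∀ u ≠ 0, φ.localCoeff p u⁻¹ = q u * u ^ 4 := by
  have hs : ∀ z : ℂ, (z : OnePoint ℂ) ≠ p → SimpleAt φ.coeff z := fun z hz =>
    simpleAt_of_order (φ.meromorphic_coeff (Set.mem_univ z)) (by
      rw [← orderAt_coe]; exact h.2 _ hz)
  induction p using OnePoint.rec with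
  | infty =>
    exact ⟨φ.coeff, fun z => hs z (OnePoint.coe_ne_infty z), fun u hu => φ.coeffInfty_inv hu⟩
  | coe a =>
    have hi : SimpleAt φ.coeffInfty 0 :=
      simpleAt_of_order (φ.meromorphic_coeffInfty (Set.mem_univ 0)) (by
        rw [← orderAt_infty]; exact h.2 _ (OnePoint.infty_ne_coe a))
    -- For a finite pole, `u = 0` is the point `∞` of the sphere, so the value there comes from the
    -- other chart; elsewhere `z = a + 1/u` and `dz² = u⁻⁴ du²`.
    refine ⟨fun u => if u = 0 then φ.coeffInfty 0 else φ.coeff (a + u⁻¹) * (u ^ 4)⁻¹,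
      fun u => ?_, fun u hu => ?_⟩
    · by_cases hu : u = 0
      · subst hu
        have hne : (1 : ℂ) + a * 0 ≠ 0 := by simp
        -- This is the coordinate `1/z` of the point `z = a + 1/u`; it is conformal at `u = 0`.
        have han : AnalyticAt ℂ (fun u : ℂ => u * (1 + a * u)⁻¹) 0 := by
          fun_prop (disch := assumption)
        have hk : AnalyticAt ℂ (fun u : ℂ => ((1 + a * u) ^ 4)⁻¹) 0 := by
          have : ((1 : ℂ) + a * 0) ^ 4 ≠ 0 := pow_ne_zero _ hne
          fun_prop (disch := assumption)
        have hd : HasDerivAt (fun u : ℂ => u * (1 + a * u)⁻¹) 1 0 := by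
          have h1 : HasDerivAt (fun u : ℂ => 1 + a * u) (a * 1) 0 :=
            ((hasDerivAt_id (0 : ℂ)).const_mul a).const_add 1
          have h2 := (hasDerivAt_id' (0 : ℂ)).fun_mul (h1.fun_inv hne)
          exact h2.congr_deriv (by simp)
        have hsim := SimpleAt.comp_mul (f := φ.coeffInfty) (g := fun u : ℂ => u * (1 + a * u)⁻¹)
          (k := fun u => ((1 + a * u) ^ 4)⁻¹) (z := 0) (by simpa using hi) han
          (by rw [hd.deriv]; exact one_ne_zero)
          hk (by simp)
        refine hsim.congr ?_
        have hev : ∀ᶠ u : ℂ in 𝓝 0, 1 + a * u ≠ 0 :=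
          ContinuousAt.eventually_ne (by fun_prop) hne
        filter_upwards [hev] with u hu
        by_cases h0 : u = 0
        · simp [h0]
        · rw [if_neg h0]
          have h2 : a + u⁻¹ = (u * (1 + a * u)⁻¹)⁻¹ := by field_simp; ring
          rw [h2, φ.coeff_inv (mul_ne_zero h0 (inv_ne_zero hu))]
          field_simp
      · have hz : (((a + u⁻¹ : ℂ)) : OnePoint ℂ) ≠ (a : OnePoint ℂ) := by
          simp [hu]
        have hd : HasDerivAt (fun u : ℂ => a + u⁻¹) (-(u ^ 2)⁻¹) u :=
          (hasDerivAt_inv hu).const_add a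
        have hk : AnalyticAt ℂ (fun u : ℂ => (u ^ 4)⁻¹) u := by
          have : u ^ 4 ≠ 0 := pow_ne_zero _ hu
          fun_prop (disch := assumption)
        have hg : AnalyticAt ℂ (fun u : ℂ => a + u⁻¹) u := by fun_prop (disch := assumption)
        have hsim := SimpleAt.comp_mul (f := φ.coeff) (g := fun u : ℂ => a + u⁻¹)
          (k := fun u => (u ^ 4)⁻¹) (z := u) (hs _ hz)
          hg (by rw [hd.deriv]; exact neg_ne_zero.2 (inv_ne_zero (pow_ne_zero _ hu))) hk
          (inv_ne_zero (pow_ne_zero _ hu))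
        refine hsim.congr ?_
        filter_upwards [isOpen_ne.mem_nhds hu] with v hv
        rw [if_neg hv]
    · have hu4 : u ^ 4 ≠ 0 := pow_ne_zero _ hu
      simp only [if_neg hu, localCoeff_coe]
      rw [inv_mul_cancel_right₀ hu4]

open Polynomial in
/-- A quadratic differential with simple zeros and a single pole, of order `n + 5`, is `Q(u) du²`
with a polynomial `Q` of degree `n + 1` with simple roots, where `u` is the global coordinate on
the complement of the pole. -/
theorem exists_polynomial {n : ℕ} {p : OnePoint ℂ} (h : φ.HasSimpleZerosAndPole n p) :
    ∃ Q : ℂ[X], Q.natDegree = n + 1 ∧ (∀ u, Q.eval u = 0 → (derivative Q).eval u ≠ 0) ∧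
      ∀ u ≠ 0, φ.localCoeff p u⁻¹ = Q.eval u * u ^ 4 := by
  obtain ⟨q, hq, hφ⟩ := exists_entire h
  obtain ⟨g, hg, hg0, hgw⟩ := (meromorphicOrderAt_eq_int_iff (φ.meromorphicAt_localCoeff p)).1 h.1
  -- With local coordinate `1/u`, order `-(n + 5)` reads `q(u) u⁴ = u ^ (n + 5) g(1/u)`, with `g`
  -- analytic and nonzero at `0`. Hence `q(u) / u ^ (n + 1)` tends to `g 0 ≠ 0`.
  have hev : ∀ᶠ u : ℂ in Bornology.cobounded ℂ, u ≠ 0 ∧ q u / u ^ (n + 1) = g u⁻¹ := by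
    have h1 := (Filter.tendsto_inv₀_cobounded' (α := ℂ)).eventually hgw
    have h2 := (Filter.tendsto_inv₀_cobounded' (α := ℂ)).eventually
      (self_mem_nhdsWithin : ({0}ᶜ : Set ℂ) ∈ 𝓝[≠] 0)
    filter_upwards [h1, h2] with u hu hu0
    have hu0 : u ≠ 0 := fun h => hu0 (by simp [h])
    refine ⟨hu0, ?_⟩
    rw [hφ u hu0, sub_zero, smul_eq_mul, inv_zpow', neg_neg] at hu
    have : u ^ ((n : ℤ) + 5) = u ^ (n + 1) * u ^ 4 := by
      rw [← pow_add, ← zpow_natCast]; congr 1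
    rw [this] at hu
    have hu4 : u ^ 4 ≠ 0 := pow_ne_zero _ hu0
    have hun : u ^ (n + 1) ≠ 0 := pow_ne_zero _ hu0
    rw [div_eq_iff hun]
    apply mul_right_cancel₀ hu4
    rw [hu]; ring
  have hlim : Tendsto (fun u : ℂ => q u / u ^ (n + 1)) (Bornology.cobounded ℂ) (𝓝 (g 0)) := by
    refine (hg.continuousAt.tendsto.comp tendsto_inv₀_cobounded).congr' ?_
    filter_upwards [hev] with u hu using hu.2.symm
  have hgrow : ∃ C R : ℝ, ∀ z, R ≤ ‖z‖ → ‖q z‖ ≤ C * ‖z‖ ^ (n + 1) := by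
    have hb : ∀ᶠ u : ℂ in Bornology.cobounded ℂ, ‖q u / u ^ (n + 1)‖ < ‖g 0‖ + 1 :=
      hlim.norm.eventually_lt_const (lt_add_one _)
    have hb' := hb.and hev
    rw [← comap_norm_atTop, Filter.eventually_comap, Filter.eventually_atTop] at hb'
    obtain ⟨R, hR⟩ := hb'
    refine ⟨‖g 0‖ + 1, R, fun z hz => ?_⟩
    obtain ⟨h1, h2, -⟩ := hR _ hz z rfl
    rw [norm_div, norm_pow, div_lt_iff₀ (by positivity)] at h1
    exact h1.le
  obtain ⟨C, R, hCR⟩ := hgrow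
  obtain ⟨Q, hQ, hQe⟩ := exists_polynomial_of_growth (n + 1)
    (fun u => (hq u).1.differentiableAt) hCR
  have hqQ : q = fun u => Q.eval u := funext hQe
  refine ⟨Q, (natDegree_eq_of_tendsto hQ hg0 (by simpa [hqQ] using hlim)).1, fun u hu => ?_,
    fun u hu => by rw [hφ u hu, hQe]⟩
  have := (hq u).2 (by rw [hQe]; exact hu)
  rwa [hqQ, Polynomial.deriv] at this

end QuadraticDifferential

/-! ### Directions of trajectories at the pole -/

/-- The velocity stays in the cone `|Im| ≤ δ Re`, so `δ Re y ± Im y` are nondecreasing. As `‖y‖`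
tends to infinity the initial value becomes negligible, and the limiting direction lies in the same
cone. -/
theorem abs_im_le_of_asymptotic {y y' : ℝ → ℂ} {ω : ℂ} {T δ : ℝ}
    (hd : ∀ t, T ≤ t → HasDerivAt y (y' t) t)
    (hy' : ∀ t, T ≤ t → |(y' t).im| ≤ δ * (y' t).re)
    (hy : Tendsto (fun t => ‖y t‖) atTop atTop)
    (hω : Tendsto (fun t => y t / (‖y t‖ : ℂ)) atTop (𝓝 ω)) : |ω.im| ≤ δ * ω.re := by
  have hre : ∀ t, T ≤ t → HasDerivAt (fun t => (y t).re) (y' t).re t := fun t ht =>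
    (Complex.reCLM.hasFDerivAt.comp_hasDerivAt t (hd t ht) : _)
  have him : ∀ t, T ≤ t → HasDerivAt (fun t => (y t).im) (y' t).im t := fun t ht =>
    (Complex.imCLM.hasFDerivAt.comp_hasDerivAt t (hd t ht) : _)
  have hmono : ∀ σ : ℝ, |σ| = 1 → σ * ω.im ≤ δ * ω.re := by
    intro σ hσ
    have hm : MonotoneOn (fun t => δ * (y t).re - σ * (y t).im) (Set.Ici T) := by
      have hder : ∀ t, T ≤ t → HasDerivAt (fun t => δ * (y t).re - σ * (y t).im)
          (δ * (y' t).re - σ * (y' t).im) t := fun t ht =>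
        ((hre t ht).const_mul δ).sub ((him t ht).const_mul σ)
      refine monotoneOn_of_deriv_nonneg (convex_Ici T)
        (fun t ht => (hder t ht).continuousAt.continuousWithinAt) ?_ ?_
      · intro t ht
        rw [interior_Ici] at ht
        exact (hder t (le_of_lt ht)).differentiableAt.differentiableWithinAt
      · intro t ht
        rw [interior_Ici] at ht
        rw [(hder t (le_of_lt ht)).deriv, sub_nonneg]
        calc σ * (y' t).im ≤ |σ * (y' t).im| := le_abs_self _
          _ = |(y' t).im| := by rw [abs_mul, hσ, one_mul]
          _ ≤ _ := hy' t (le_of_lt ht)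
    have hlim1 : Tendsto (fun t => (δ * (y t).re - σ * (y t).im) / ‖y t‖) atTop
        (𝓝 (δ * ω.re - σ * ω.im)) := by
      have h1 := ((Complex.continuous_re.tendsto ω).comp hω).const_mul δ
      have h2 := ((Complex.continuous_im.tendsto ω).comp hω).const_mul σ
      refine (h1.sub h2).congr fun t => ?_
      simp only [Function.comp_apply, Complex.div_ofReal_re, Complex.div_ofReal_im]
      ring
    have hlim2 : Tendsto (fun t => (δ * (y T).re - σ * (y T).im) / ‖y t‖) atTop (𝓝 0) :=
      hy.const_div_atTop _
    have := le_of_tendsto_of_tendsto hlim2 hlim1 (by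
      filter_upwards [eventually_ge_atTop T] with t ht
      exact div_le_div_of_nonneg_right (hm Set.self_mem_Ici ht ht) (norm_nonneg _))
    linarith
  rw [abs_le]
  have h1 := hmono 1 (by simp)
  have h2 := hmono (-1) (by simp)
  constructor <;> linarith

theorem im_eq_zero_of_asymptotic {y y' : ℝ → ℂ} {ω : ℂ}
    (hd : ∀ᶠ t in atTop, HasDerivAt y (y' t) t)
    (hne : ∀ᶠ t in atTop, (y' t).re ≠ 0)
    (hy' : ∀ δ > 0, ∀ᶠ t in atTop, |(y' t).im| ≤ δ * |(y' t).re|)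
    (hy : Tendsto (fun t => ‖y t‖) atTop atTop)
    (hω : Tendsto (fun t => y t / (‖y t‖ : ℂ)) atTop (𝓝 ω)) : ω.im = 0 := by
  have key : ∀ δ > 0, |ω.im| ≤ δ * |ω.re| := by
    intro δ hδ
    obtain ⟨T, hT⟩ := eventually_atTop.1 ((hd.and hne).and (hy' δ hδ))
    -- The velocity is not assumed continuous; Darboux's theorem for derivatives still gives its
    -- real part a constant sign.
    have hsign := hasDerivWithinAt_forall_lt_or_forall_gt_of_forall_ne (convex_Ici T)
      (f := fun t => (y t).re) (f' := fun t => (y' t).re) (m := 0)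
      (fun t ht => (Complex.reCLM.hasFDerivAt.comp_hasDerivAt t (hT t ht).1.1 :
        HasDerivAt (fun t => (y t).re) (y' t).re t).hasDerivWithinAt)
      (fun t ht => (hT t ht).1.2)
    rcases hsign with hs | hs
    · have := abs_im_le_of_asymptotic (y := fun t => -y t) (y' := fun t => -y' t) (ω := -ω)
        (T := T) (δ := δ) (fun t ht => (hT t ht).1.1.neg) (fun t ht => by
          have := (hT t ht).2
          rw [abs_of_neg (hs t ht)] at this
          simpa using this) (by simpa using hy) (by simpa [neg_div] using hω.neg)
      simp only [Complex.neg_im, abs_neg, Complex.neg_re] at this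
      exact this.trans (mul_le_mul_of_nonneg_left (neg_le_abs _) hδ.le)
    · have := abs_im_le_of_asymptotic (T := T) (δ := δ) (fun t ht => (hT t ht).1.1) (fun t ht => by
          have := (hT t ht).2
          rwa [abs_of_pos (hs t ht)] at this) hy hω
      exact this.trans (mul_le_mul_of_nonneg_left (le_abs_self _) hδ.le)
  have h0 : Tendsto (fun δ : ℝ => δ * |ω.re|) (𝓝[>] 0) (𝓝 0) := by
    have : Tendsto (fun δ : ℝ => δ * |ω.re|) (𝓝 0) (𝓝 (0 * |ω.re|)) :=
      (continuous_id.mul continuous_const).tendsto 0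
    rw [zero_mul] at this
    exact this.mono_left nhdsWithin_le_nhds
  have := ge_of_tendsto h0 (by
    filter_upwards [self_mem_nhdsWithin] with δ hδ using key δ hδ)
  exact abs_nonpos_iff.1 this

/-- Solve for the two squares from their difference `Re z²` and their sum `|z|²`. When `ρ` is close
to `1`, the imaginary part of `z` is small relative to its real part. -/
theorem sq_im_re {z ρ : ℂ} {S : ℝ} (hS : 0 < S) (h : z ^ 2 = S * ρ) :
    z.im ^ 2 = S * ((‖ρ‖ - ρ.re) / 2) ∧ z.re ^ 2 = S * ((‖ρ‖ + ρ.re) / 2) := by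
  have h1 : z.re ^ 2 - z.im ^ 2 = S * ρ.re := by
    have := congrArg Complex.re h
    simp only [pow_two, Complex.mul_re, Complex.ofReal_re, Complex.ofReal_im, zero_mul,
      sub_zero] at this
    linarith
  have h2 : z.re ^ 2 + z.im ^ 2 = S * ‖ρ‖ := by
    have := congrArg norm h
    rw [norm_pow, norm_mul, Complex.norm_real, Real.norm_of_nonneg hS.le, Complex.sq_norm,
      Complex.normSq_apply] at this
    linarith
  constructor <;> linarith

-- In the coordinate `y = κ (v/w) ^ ((n + 3)/2)`, which up to a constant is the leading part of `∫
-- √φ`, a horizontal trajectory has velocity whose square is asymptotically positive, so its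
-- limiting direction is real. If the trajectory is tangent to `v`, that direction is `κ / |κ|`.
-- Hence `κ` is real and `κ² = c v⁻⁽ⁿ⁺³⁾` is positive.
open Polynomial in
theorem QuadraticDifferential.pow_pos_of_mem_distinguishedDirections {φ : QuadraticDifferential}
    {p : OnePoint ℂ} {n : ℕ} {Q : ℂ[X]} (hQ : Q.natDegree = n + 1)
    (hφ : ∀ u ≠ 0, φ.localCoeff p u⁻¹ = Q.eval u * u ^ 4) {v : Circle}
    (hv : v ∈ φ.distinguishedDirections p) :
    ∃ r : ℝ, 0 < r ∧ Q.coeff (n + 1) * ((v : ℂ)⁻¹) ^ (n + 3) = r := by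
  obtain ⟨γ, ⟨hγ, hγ0⟩, hγv⟩ := hv
  choose! hne γ' hγ' s hs hφs using hγ
  set c := Q.coeff (n + 1) with hc
  have hc0 : c ≠ 0 := by
    rw [hc, ← hQ]
    exact leadingCoeff_ne_zero.2 (fun h => by simp [h] at hQ)
  have hv0 : (v : ℂ) ≠ 0 := Circle.coe_ne_zero v
  obtain ⟨κ, hκ⟩ := IsAlgClosed.exists_pow_nat_eq (c * ((v : ℂ)⁻¹) ^ (n + 3)) (n := 2) two_pos
  have hκ0 : κ ≠ 0 := by
    rintro rfl
    have : c * ((v : ℂ)⁻¹) ^ (n + 3) ≠ 0 := mul_ne_zero hc0 (pow_ne_zero _ (inv_ne_zero hv0))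
    exact this (by rw [← hκ]; ring)
  set h : ℝ := ((n : ℝ) + 3) / 2 with hh
  have hh0 : 0 < h := by positivity
  -- Dividing by `γ` after multiplying by `v` makes the curve asymptotic to the positive axis, so
  -- the principal logarithm is eventually smooth along it.
  set ψ : ℝ → ℂ := fun t => v / γ t with hψ
  set y : ℝ → ℂ := fun t => κ * Complex.exp (h * Complex.log (ψ t)) with hyd
  set y' : ℝ → ℂ := fun t => κ * (Complex.exp (h * Complex.log (ψ t)) *
    (h * (v * (-γ' t / γ t ^ 2) / ψ t))) with hyd'
  have hψ0 : ∀ t, 0 < t → ψ t ≠ 0 := fun t ht => div_ne_zero hv0 (hne t ht)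
  have hψn : ∀ t, ‖ψ t‖ = ‖γ t‖⁻¹ := fun t => by
    rw [hψ, norm_div, Circle.norm_coe, one_div]
  have hψdir : Tendsto (fun t => ψ t / (‖ψ t‖ : ℂ)) atTop (𝓝 1) := by
    have h1 : Tendsto (fun t => (v : ℂ) / (γ t / (‖γ t‖ : ℂ))) atTop (𝓝 ((v : ℂ) / v)) :=
      tendsto_const_nhds.div hγv hv0
    rw [div_self hv0] at h1
    refine h1.congr fun t => ?_
    rw [hψn, hψ]
    push_cast
    rw [div_inv_eq_mul, div_div_eq_mul_div]
    ring
  have harg : Tendsto (fun t => Complex.arg (ψ t)) atTop (𝓝 0) := by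
    have h1 : ContinuousAt Complex.arg 1 := Complex.continuousAt_arg (by simp)
    have h2 := h1.tendsto.comp hψdir
    rw [Complex.arg_one] at h2
    refine h2.congr' ?_
    filter_upwards [eventually_gt_atTop 0] with t ht
    have : 0 < ‖ψ t‖ := norm_pos_iff.2 (hψ0 t ht)
    have h3 : ψ t / (‖ψ t‖ : ℂ) = ((‖ψ t‖⁻¹ : ℝ) : ℂ) * ψ t := by push_cast; ring
    rw [Function.comp_apply, h3, Complex.arg_real_mul _ (by positivity)]
  have hslit : ∀ᶠ t in atTop, ψ t ∈ Complex.slitPlane := by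
    have h1 : ∀ᶠ t in atTop, Complex.arg (ψ t) < Real.pi :=
      harg.eventually_lt_const Real.pi_pos
    filter_upwards [h1, eventually_gt_atTop 0] with t ht ht0
    exact Complex.mem_slitPlane_iff_arg.2 ⟨ht.ne, hψ0 t ht0⟩
  have hnorm : Tendsto (fun t => ‖ψ t‖) atTop atTop := by
    simp only [hψn]
    refine tendsto_inv_nhdsGT_zero.comp (tendsto_nhdsWithin_iff.2 ⟨?_, ?_⟩)
    · simpa using hγ0.norm
    · filter_upwards [eventually_gt_atTop 0] with t ht
      exact norm_pos_iff.2 (hne t ht)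
  have hyn : ∀ t, ‖y t‖ = ‖κ‖ * Real.exp (h * Real.log ‖ψ t‖) := fun t => by
    simp [hyd, Complex.norm_exp, Complex.log_re]
  have hyinf : Tendsto (fun t => ‖y t‖) atTop atTop := by
    simp only [hyn]
    exact (Real.tendsto_exp_atTop.comp
      ((Real.tendsto_log_atTop.comp hnorm).const_mul_atTop hh0)).const_mul_atTop
      (norm_pos_iff.2 hκ0)
  have hydir : Tendsto (fun t => y t / (‖y t‖ : ℂ)) atTop (𝓝 (κ / ‖κ‖)) := by
    have h1 : Tendsto (fun t => κ / ‖κ‖ * Complex.exp (h * (Complex.arg (ψ t) : ℂ) * Complex.I))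
        atTop (𝓝 (κ / ‖κ‖ * Complex.exp (h * ((0 : ℝ) : ℂ) * Complex.I))) := by
      have hcont : Continuous fun a : ℝ => κ / ‖κ‖ * Complex.exp (h * (a : ℂ) * Complex.I) := by
        fun_prop
      exact (hcont.tendsto 0).comp harg
    simp only [Complex.ofReal_zero, mul_zero, zero_mul, Complex.exp_zero, mul_one] at h1
    refine h1.congr fun t => ?_
    rw [hyn, hyd]
    have h2 : Complex.exp (h * Complex.log (ψ t)) =
        (Real.exp (h * Real.log ‖ψ t‖) : ℂ) * Complex.exp (h * (Complex.arg (ψ t) : ℂ) * Complex.I) := by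
      rw [Complex.ofReal_exp, ← Complex.exp_add, Complex.log]
      congr 1; push_cast; ring
    have h3 : (Real.exp (h * Real.log ‖ψ t‖) : ℂ) ≠ 0 := by
      exact_mod_cast (Real.exp_pos _).ne'
    have h4 : (‖κ‖ : ℂ) ≠ 0 := by exact_mod_cast norm_ne_zero_iff.2 hκ0
    simp only [h2]
    push_cast at h3 ⊢
    field_simp
  have hder : ∀ᶠ t in atTop, HasDerivAt y (y' t) t := by
    filter_upwards [hslit, eventually_gt_atTop 0] with t ht ht0
    have h1 : HasDerivAt ψ (v * (-γ' t / γ t ^ 2)) t := by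
      have := ((hγ' t ht0).fun_inv (hne t ht0)).const_mul (v : ℂ)
      simpa [hψ, div_eq_mul_inv] using this
    exact (((h1.clog_real ht).const_mul (h : ℂ)).cexp).const_mul κ
  -- The ratio of the leading term of `Q` to `Q` measures how far `y` is from a true flat
  -- coordinate; it tends to `1`.
  set ρ : ℝ → ℂ := fun t => c * (γ t)⁻¹ ^ (n + 1) / Q.eval (γ t)⁻¹ with hρ
  have hcob : Tendsto (fun t => (γ t)⁻¹) atTop (Bornology.cobounded ℂ) := by
    refine tendsto_inv₀_nhdsNE_zero.comp (tendsto_nhdsWithin_iff.2 ⟨hγ0, ?_⟩)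
    filter_upwards [eventually_gt_atTop 0] with t ht using hne t ht
  have hρ1 : Tendsto ρ atTop (𝓝 1) := by
    have h1 := ((tendsto_eval_div_pow hQ.le).comp hcob)
    have h2 := (tendsto_const_nhds (x := c)).div h1 hc0
    rw [← hc, div_self hc0] at h2
    refine h2.congr fun t => ?_
    simp only [hρ, Pi.div_apply, Function.comp_apply, div_div_eq_mul_div]
  have hsq : ∀ t, 0 < t → (y' t) ^ 2 = ((h ^ 2 * s t : ℝ) : ℂ) * ρ t := by
    intro t ht
    have hg := hne t ht
    have hexp : Complex.exp (h * Complex.log (ψ t)) ^ 2 = ψ t ^ (n + 3) := by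
      rw [← Complex.exp_nat_mul, hh]
      have : ((2 : ℕ) : ℂ) * ((((n : ℝ) + 3) / 2 : ℝ) * Complex.log (ψ t)) =
          ((n + 3 : ℕ) : ℂ) * Complex.log (ψ t) := by push_cast; ring
      rw [this, Complex.exp_nat_mul, Complex.exp_log (hψ0 t ht)]
    have h1 := hφs t ht
    have h1' := hφ (γ t)⁻¹ (inv_ne_zero hg)
    rw [inv_inv] at h1'
    rw [h1'] at h1
    have hQ0 : Q.eval (γ t)⁻¹ ≠ 0 := by
      intro h0; rw [h0] at h1
      have : ((s t : ℝ) : ℂ) ≠ 0 := by exact_mod_cast (hs t ht).ne'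
      exact this (by rw [← h1]; ring)
    have h2 : (y' t) ^ 2 = κ ^ 2 * Complex.exp (h * Complex.log (ψ t)) ^ 2 *
        (h * (v * (-γ' t / γ t ^ 2) / ψ t)) ^ 2 := by rw [hyd']; ring
    rw [h2, hexp, hκ, hρ]
    push_cast
    rw [← h1, hψ]
    generalize Q.eval (γ t)⁻¹ = q at hQ0
    simp only [inv_pow, div_pow]
    field_simp
    ring
  have hκim := im_eq_zero_of_asymptotic (y := y) (y' := y') hder ?_ ?_ hyinf hydir
  · have hκr : κ.im = 0 := by
      rw [Complex.div_ofReal_im, div_eq_zero_iff] at hκim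
      exact hκim.resolve_right (norm_ne_zero_iff.2 hκ0)
    have hκe : κ = (κ.re : ℂ) := Complex.ext rfl (by simpa using hκr)
    refine ⟨κ.re ^ 2, ?_, ?_⟩
    · have : κ.re ≠ 0 := fun h => hκ0 (by rw [hκe, h]; simp)
      positivity
    · rw [← hκ, hκe]; push_cast; simp
  · have h1 : ∀ᶠ t in atTop, 0 < (‖ρ t‖ + (ρ t).re) / 2 := by
      have : Tendsto (fun t => (‖ρ t‖ + (ρ t).re) / 2) atTop (𝓝 ((‖(1:ℂ)‖ + (1:ℂ).re) / 2)) :=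
        ((hρ1.norm).add ((Complex.continuous_re.tendsto _).comp hρ1)).div_const 2
      exact this.eventually_const_lt (by norm_num)
    filter_upwards [h1, eventually_gt_atTop 0] with t ht ht0 h0
    have hS : 0 < h ^ 2 * s t := mul_pos (pow_pos hh0 2) (hs t ht0)
    have := (sq_im_re hS (hsq t ht0)).2
    rw [h0] at this
    have := mul_pos hS ht
    linarith
  · intro δ hδ
    have h1 : ∀ᶠ t in atTop, (‖ρ t‖ - (ρ t).re) / 2 < δ ^ 2 * ((‖ρ t‖ + (ρ t).re) / 2) := by
      have e1 : Tendsto (fun t => (‖ρ t‖ + (ρ t).re) / 2) atTop (𝓝 ((‖(1:ℂ)‖ + (1:ℂ).re) / 2)) :=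
        ((hρ1.norm).add ((Complex.continuous_re.tendsto _).comp hρ1)).div_const 2
      have e2 : Tendsto (fun t => (‖ρ t‖ - (ρ t).re) / 2) atTop (𝓝 ((‖(1:ℂ)‖ - (1:ℂ).re) / 2)) :=
        ((hρ1.norm).sub ((Complex.continuous_re.tendsto _).comp hρ1)).div_const 2
      refine e2.eventually_lt (e1.const_mul _) ?_
      norm_num
      positivity
    filter_upwards [h1, eventually_gt_atTop 0] with t ht ht0
    have hS : 0 < h ^ 2 * s t := mul_pos (pow_pos hh0 2) (hs t ht0)
    obtain ⟨h2, h3⟩ := sq_im_re hS (hsq t ht0)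
    refine abs_le_of_sq_le_sq' ?_ (by positivity) |> abs_le.2
    rw [mul_pow, sq_abs, h2, h3]
    nlinarith

/-! ### Existence of trajectories -/

theorem exists_solution_Ioo {G : ℂ → ℂ} {K : NNReal} (hG : LipschitzWith K G) {L : NNReal}
    (hL : ∀ x, ‖G x‖ ≤ L) (x₀ : ℂ) (T : ℝ) (hT : 0 < T) :
    ∃ x : ℝ → ℂ, x 0 = x₀ ∧ ∀ t ∈ Set.Ioo (-T) T, HasDerivAt x (G (x t)) t := by
  have h0 : (0 : ℝ) ∈ Set.Icc (-T) T := ⟨by linarith, hT.le⟩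
  have hpl : IsPicardLindelof (fun _ => G) (tmin := -T) (tmax := T) ⟨0, h0⟩ x₀
      (L * T.toNNReal) 0 L K :=
    IsPicardLindelof.of_time_independent (fun x _ => hL x) hG.lipschitzOnWith (by
      simp [hT.le])
  obtain ⟨x, hx0, hx⟩ := hpl.exists_eq_forall_mem_Icc_hasDerivWithinAt₀
  exact ⟨x, hx0, fun t ht => (hx t (Set.Ioo_subset_Icc_self ht)).hasDerivAt
    (Icc_mem_nhds ht.1 ht.2)⟩

/-- A bounded field cannot blow up, so Picard–Lindelöf applies on every interval `(-T, T)`; the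
Lipschitz condition makes the solutions agree on overlaps. -/
theorem exists_solution {G : ℂ → ℂ} {K : NNReal} (hG : LipschitzWith K G) {L : NNReal}
    (hL : ∀ x, ‖G x‖ ≤ L) (x₀ : ℂ) :
    ∃ x : ℝ → ℂ, x 0 = x₀ ∧ ∀ t, HasDerivAt x (G (x t)) t := by
  choose! y hy0 hy using exists_solution_Ioo hG hL x₀
  have huniq : ∀ S T, 0 < S → S ≤ T → ∀ t ∈ Set.Ioo (-S) S, y S t = y T t := by
    intro S T hS hST t ht
    have hsub : Set.Ioo (-S) S ⊆ Set.Ioo (-T) T := Set.Ioo_subset_Ioo (by linarith) hST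
    exact ODE_solution_unique_of_mem_Ioo (v := fun _ => G) (s := fun _ => Set.univ) (K := K)
      (t₀ := 0) (fun _ _ => hG.lipschitzOnWith) ⟨by linarith, hS⟩
      (fun t ht => ⟨hy S hS t ht, trivial⟩)
      (fun t ht => ⟨hy T (hS.trans_le hST) t (hsub ht), trivial⟩)
      ((hy0 S hS).trans (hy0 T (hS.trans_le hST)).symm) ht
  -- The interval is allowed to depend on `t`; near a given time, all these solutions coincide with
  -- the one on a single slightly longer interval.
  refine ⟨fun t => y (|t| + 1) t, by simpa using hy0 _ (by positivity), fun t => ?_⟩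
  have hT : (0 : ℝ) < |t| + 2 := by positivity
  have hmem : t ∈ Set.Ioo (-(|t| + 2)) (|t| + 2) :=
    ⟨by linarith [neg_abs_le t], by linarith [le_abs_self t]⟩
  have hlt : ∀ᶠ s in 𝓝 t, |s| < |t| + 1 :=
    continuous_abs.continuousAt.eventually_lt continuousAt_const (lt_add_one _)
  have hev : (fun s => y (|s| + 1) s) =ᶠ[𝓝 t] y (|t| + 2) := by
    filter_upwards [hlt] with s hs
    exact huniq _ _ (by positivity) (by linarith) s
      ⟨by linarith [neg_abs_le s], by linarith [le_abs_self s]⟩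
  have := (hy _ hT t hmem).congr_of_eventuallyEq hev
  rwa [← hev.eq_of_nhds] at this

/-- An averaging statement: past some time the derivative of `x t - c t` is at most `ε / 2` in norm,
and the mean value inequality bounds its growth. -/
theorem tendsto_div_of_deriv {x x' : ℝ → ℂ} (hx : ∀ t, HasDerivAt x (x' t) t) {c : ℂ}
    (h : Tendsto x' atTop (𝓝 c)) : Tendsto (fun t : ℝ => x t / t) atTop (𝓝 c) := by
  rw [Metric.tendsto_atTop]
  intro ε hε
  obtain ⟨T, hT⟩ := Metric.tendsto_atTop.1 h (ε / 2) (by positivity)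
  set B := ‖x T - c * T‖ + ε / 2 * |T| with hB
  refine ⟨max (max T 1) (2 * (B + 1) / ε), fun t ht => ?_⟩
  have htT : T ≤ t := ((le_max_left _ _).trans (le_max_left _ _)).trans ht
  have ht1 : 1 ≤ t := ((le_max_right _ _).trans (le_max_left _ _)).trans ht
  have ht2 : 2 * (B + 1) / ε ≤ t := (le_max_right _ _).trans ht
  have ht0 : 0 < t := by linarith
  have hmv := Convex.norm_image_sub_le_of_norm_hasDerivWithin_le
    (f := fun t : ℝ => x t - c * t) (f' := fun t => x' t - c * 1) (s := Set.Ici T) (C := ε / 2)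
    (fun s _ => ((hx s).sub ((hasDerivAt_id s).ofReal_comp.const_mul c)).hasDerivWithinAt)
    (fun s hs => by simpa [dist_eq_norm] using (hT s hs).le) (convex_Ici T)
    Set.self_mem_Ici (Set.mem_Ici.2 htT)
  have hb : ‖x t - c * t‖ ≤ B + ε / 2 * t := by
    calc ‖x t - c * t‖ ≤ ‖x t - c * t - (x T - c * T)‖ + ‖x T - c * T‖ := by
          have := norm_add_le (x t - c * t - (x T - c * T)) (x T - c * T)
          simpa using this
      _ ≤ ε / 2 * ‖t - T‖ + ‖x T - c * T‖ := by gcongr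
      _ ≤ ε / 2 * (|t| + |T|) + ‖x T - c * T‖ := by
          gcongr; rw [Real.norm_eq_abs]; exact abs_sub _ _
      _ = _ := by rw [abs_of_pos ht0, hB]; ring
  have : x t / t - c = (x t - c * t) / t := by
    have : (t : ℂ) ≠ 0 := by exact_mod_cast ht0.ne'
    field_simp
  rw [dist_eq_norm, this, norm_div, Complex.norm_real, Real.norm_of_nonneg ht0.le,
    div_lt_iff₀ ht0]
  rw [div_le_iff₀ hε] at ht2
  linarith

/-- Composition with this projection extends a Lipschitz field on the half plane `Re ≥ R` to a
Lipschitz field on the whole plane. -/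
theorem lipschitzWith_halfPlaneProj (R : ℝ) :
    LipschitzWith 1 (fun x : ℂ => (⟨max x.re R, x.im⟩ : ℂ)) := by
  refine LipschitzWith.of_dist_le_mul fun x y => ?_
  rw [NNReal.coe_one, one_mul, Complex.dist_eq_re_im, Complex.dist_eq_re_im]
  apply Real.sqrt_le_sqrt
  have : |max x.re R - max y.re R| ≤ |x.re - y.re| := abs_max_sub_max_le_abs _ _ _
  have h2 := sq_le_sq.2 (by simpa using this)
  simp only
  linarith

/-- The inverse square root of the reversed polynomial near `0`. -/
theorem exists_invSqrt {n : ℕ} (a : Fin n → ℂ) :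
    ∃ (m : ℂ → ℂ) (ε : ℝ) (K : NNReal), 0 < ε ∧ m 0 = 1 ∧ ContinuousAt m 0 ∧
      LipschitzOnWith K m (Metric.ball 0 ε) ∧
      ∀ w ∈ Metric.ball (0 : ℂ) ε, ‖m w - 1‖ ≤ 1 / 2 ∧
        (w ≠ 0 → m w ^ 2 * (w ^ (n + 1) * (centredPoly a).eval w⁻¹) = 1) := by
  -- The reversed polynomial `w ^ (n + 1) P(1/w)`; since `i < n`, the subtraction does not truncate
  -- and every exponent is positive, so `T 0 = 1` and the principal square root is available near
  -- `0`.
  set T : ℂ → ℂ := fun w => 1 + ∑ i : Fin n, a i * w ^ (n + 1 - i) with hT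
  have hT0 : T 0 = 1 := by
    rw [hT]
    simp only [add_eq_left]
    refine Finset.sum_eq_zero fun i _ => ?_
    rw [zero_pow (by have := i.2; omega), mul_zero]
  have hTP : ∀ w ≠ 0, T w = w ^ (n + 1) * (centredPoly a).eval w⁻¹ := by
    intro w hw
    rw [eval_centredPoly, mul_add, Finset.mul_sum, hT]
    simp only
    congr 1
    · rw [← mul_pow, mul_inv_cancel₀ hw, one_pow]
    · refine Finset.sum_congr rfl fun i _ => ?_
      have : w ^ (n + 1) = w ^ (n + 1 - i) * w ^ (i : ℕ) := by
        rw [← pow_add]; congr 1; have := i.2; omega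
      rw [this, inv_pow]
      field_simp
  have hTd : ContDiff ℂ 1 T := by rw [hT]; fun_prop
  set m : ℂ → ℂ := fun w => Complex.exp (-(1 / 2) * Complex.log (T w)) with hm
  have hmd : ContDiffAt ℂ 1 m 0 := by
    have h1 : ContDiffAt ℂ 1 (fun w => Complex.log (T w)) 0 :=
      (Complex.contDiffAt_log (by rw [hT0]; exact Complex.one_mem_slitPlane)).comp 0 hTd.contDiffAt
    exact (contDiffAt_const.mul h1).cexp
  have hm0 : m 0 = 1 := by simp [hm, hT0]
  obtain ⟨K, s, hs, hK⟩ := hmd.exists_lipschitzOnWith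
  have h1 : ∀ᶠ w in 𝓝 (0 : ℂ), ‖m w - 1‖ < 1 / 2 := by
    have := (hmd.continuousAt.sub (continuousAt_const (y := (1 : ℂ)))).norm
    exact this.eventually_lt continuousAt_const (by simp [hm0])
  have h2 : ∀ᶠ w in 𝓝 (0 : ℂ), T w ≠ 0 :=
    hTd.continuous.continuousAt.eventually_ne (by rw [hT0]; exact one_ne_zero)
  obtain ⟨ε, hε, hball⟩ := Metric.mem_nhds_iff.1 (Filter.inter_mem hs (h1.and h2))
  refine ⟨m, ε, K, hε, hm0, hmd.continuousAt, hK.mono fun w hw => (hball hw).1,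
    fun w hw => ⟨(hball hw).2.1.le, fun hw0 => ?_⟩⟩
  rw [← hTP w hw0, hm]
  simp only
  rw [← Complex.exp_nat_mul]
  have : ((2 : ℕ) : ℂ) * (-(1 / 2) * Complex.log (T w)) = -Complex.log (T w) := by
    push_cast; ring
  rw [this, Complex.exp_neg, Complex.exp_log (hball hw).2.2, inv_mul_cancel₀ (hball hw).2.2]

/-- Substituting `w = v x⁻ʰ` with `h = 2/(n + 3)` and `vⁿ⁺³ = 1` turns the differential into `h²
T(w) dx²`, where `T` is the reversed polynomial. Horizontal trajectories are then obtained from `x'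
= T(w)^(-1/2)`. The right side tends to `1` as `x` goes to infinity, so a solution started far to
the right escapes with argument tending to `0`, and `w` becomes tangent to `v`. -/
theorem QuadraticDifferential.mem_distinguishedDirections {φ : QuadraticDifferential}
    {p : OnePoint ℂ} {n : ℕ} {a : Fin n → ℂ}
    (hφ : ∀ u ≠ 0, φ.localCoeff p u⁻¹ = (centredPoly a).eval u * u ^ 4) {v : Circle}
    (hv : (v : ℂ) ^ (n + 3) = 1) : v ∈ φ.distinguishedDirections p := by
  obtain ⟨m, ε, K, hε, hm0, hmc, hmK, hm⟩ := exists_invSqrt a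
  have hv0 : (v : ℂ) ≠ 0 := Circle.coe_ne_zero v
  set h : ℝ := 2 / ((n : ℝ) + 3) with hh
  have hh0 : 0 < h := by positivity
  have hh1 : h ≤ 1 := by
    rw [hh, div_le_one (by positivity)]; have : (0 : ℝ) ≤ n := Nat.cast_nonneg n; linarith
  set W : ℂ → ℂ := fun x => v * Complex.exp (-(h : ℂ) * Complex.log x) with hW
  have hWn : ∀ x, ‖W x‖ = Real.exp (-h * Real.log ‖x‖) := fun x => by
    rw [hW, norm_mul, Circle.norm_coe, one_mul, Complex.norm_exp]
    simp [Complex.log_re]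
  have hlim : Tendsto (fun r : ℝ => Real.exp (-h * Real.log r)) atTop (𝓝 0) := by
    refine Real.tendsto_exp_atBot.comp ?_
    exact Real.tendsto_log_atTop.const_mul_atTop_of_neg (neg_lt_zero.2 hh0)
  -- For `Re x ≥ R`, the point `w` lies in the ball where the inverse square root is defined, and
  -- `‖w‖ ≤ 1 ≤ ‖x‖` bounds the derivative of `W`.
  obtain ⟨R, hR⟩ := eventually_atTop.1 ((hlim.eventually_lt_const (lt_min hε one_pos)).and
    (eventually_ge_atTop 1))
  have hR1 : 1 ≤ R := (hR R le_rfl).2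
  have hxR : ∀ x : ℂ, R ≤ x.re → W x ∈ Metric.ball (0 : ℂ) ε ∧ ‖W x‖ ≤ 1 ∧ 1 ≤ ‖x‖ := by
    intro x hx
    have h1 : R ≤ ‖x‖ := hx.trans (Complex.re_le_norm x)
    have h2 := (hR _ h1).1
    rw [← hWn] at h2
    exact ⟨by simpa using h2.trans_le (min_le_left _ _), (h2.trans_le (min_le_right _ _)).le,
      hR1.trans h1⟩
  have hWd : ∀ x : ℂ, R ≤ x.re → HasDerivAt W (-h * W x / x) x := by
    intro x hx
    have hs : x ∈ Complex.slitPlane := Or.inl (by linarith)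
    have := (((Complex.hasDerivAt_log hs).const_mul (-(h : ℂ))).cexp).const_mul (v : ℂ)
    refine this.congr_deriv ?_
    rw [hW]; ring
  have hWL : LipschitzOnWith 1 W {x : ℂ | R ≤ x.re} := by
    refine Convex.lipschitzOnWith_of_nnnorm_hasDerivWithin_le (convex_halfSpace_re_ge R)
      (fun x hx => (hWd x hx).hasDerivWithinAt) fun x hx => ?_
    obtain ⟨-, h1, h2⟩ := hxR x hx
    rw [← NNReal.coe_le_coe, coe_nnnorm, norm_div, norm_mul, norm_neg, Complex.norm_real,
      Real.norm_of_nonneg hh0.le, NNReal.coe_one]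
    rw [div_le_one (by linarith)]
    nlinarith [norm_nonneg (W x)]
  set P : ℂ → ℂ := fun x => ⟨max x.re R, x.im⟩ with hP
  have hPR : ∀ x, R ≤ (P x).re := fun x => le_max_right _ _
  have hPe : ∀ x : ℂ, R ≤ x.re → P x = x := fun x hx => by
    apply Complex.ext <;> simp [hP, hx]
  set G : ℂ → ℂ := fun x => m (W (P x)) with hG
  have hGL : LipschitzWith (K * (1 * 1)) G := by
    rw [← lipschitzOnWith_univ]
    refine hmK.comp (hWL.comp (lipschitzWith_halfPlaneProj R).lipschitzOnWith ?_) ?_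
    · exact fun x _ => hPR x
    · exact fun x _ => (hxR _ (hPR x)).1
  have hG1 : ∀ x, ‖G x - 1‖ ≤ 1 / 2 := fun x => (hm _ (hxR _ (hPR x)).1).1
  have hGb : ∀ x, ‖G x‖ ≤ (2 : NNReal) := fun x => by
    have h1 := norm_add_le (G x - 1) 1
    rw [sub_add_cancel, norm_one] at h1
    have := hG1 x
    simp only [NNReal.coe_ofNat]
    linarith
  obtain ⟨x, hx0, hx⟩ := exists_solution hGL hGb (R : ℂ)
  -- The field is within `1/2` of `1`, so the solution moves right with speed at least `1/2` and
  -- never meets the region where the field was modified.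
  have hre : ∀ t, 0 ≤ t → R + t / 2 ≤ (x t).re := by
    intro t ht
    have hd : ∀ t, HasDerivAt (fun t => (x t).re - t / 2) ((G (x t)).re - 1 / 2) t := fun t =>
      (Complex.reCLM.hasFDerivAt.comp_hasDerivAt t (hx t) :
        HasDerivAt (fun t => (x t).re) (G (x t)).re t).sub ((hasDerivAt_id t).div_const 2)
    have hmono : Monotone fun t => (x t).re - t / 2 :=
      monotone_of_deriv_nonneg (fun t => (hd t).differentiableAt) fun t => by
        rw [(hd t).deriv]
        have h1 := (abs_le.1 ((Complex.abs_re_le_norm _).trans (hG1 (x t)))).1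
        rw [Complex.sub_re, Complex.one_re] at h1
        linarith
    have := hmono ht
    simp only [hx0, Complex.ofReal_re] at this
    linarith
  have hreR : ∀ t, 0 ≤ t → R ≤ (x t).re := fun t ht => by linarith [hre t ht]
  have hxinf : Tendsto (fun t => ‖x t‖) atTop atTop := by
    refine tendsto_atTop_mono' atTop ?_ (tendsto_id.atTop_div_const (two_pos : (0 : ℝ) < 2))
    filter_upwards [eventually_ge_atTop 0] with t ht
    have := hre t ht
    have := Complex.re_le_norm (x t)
    simp only [id]; linarith
  have hγ0 : Tendsto (fun t => W (x t)) atTop (𝓝 0) := by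
    rw [tendsto_zero_iff_norm_tendsto_zero]
    simp only [hWn]
    exact hlim.comp hxinf
  have hx' : Tendsto (fun t => G (x t)) atTop (𝓝 1) := by
    have := hmc.tendsto.comp hγ0
    rw [hm0] at this
    refine this.congr' ?_
    filter_upwards [eventually_ge_atTop 0] with t ht
    simp only [hG, Function.comp_apply, hPe _ (hreR t ht)]
  have harg : Tendsto (fun t => Complex.arg (x t)) atTop (𝓝 0) := by
    have h1 : ContinuousAt Complex.arg 1 := Complex.continuousAt_arg (by simp)
    have h2 := h1.tendsto.comp (tendsto_div_of_deriv hx hx')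
    rw [Complex.arg_one] at h2
    refine h2.congr' ?_
    filter_upwards [eventually_gt_atTop 0] with t ht
    have h3 : x t / (t : ℂ) = ((t⁻¹ : ℝ) : ℂ) * x t := by push_cast; ring
    rw [Function.comp_apply, h3, Complex.arg_real_mul _ (by positivity)]
  refine ⟨fun t => W (x t), ⟨fun t ht => ?_, hγ0⟩, ?_⟩
  · have hR' := hreR t ht.le
    have hx0 : x t ≠ 0 := fun h0 => by
      have := (hxR _ hR').2.2
      rw [h0, norm_zero] at this; linarith
    have hW0 : W (x t) ≠ 0 := mul_ne_zero hv0 (Complex.exp_ne_zero _)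
    refine ⟨hW0, _, (hWd _ hR').comp t (hx t), h ^ 2, by positivity, ?_⟩
    have h1 := hφ _ (inv_ne_zero hW0)
    rw [inv_inv] at h1
    have h2 := (hm _ (hxR _ hR').1).2 hW0
    have hWN : W (x t) ^ (n + 3) * x t ^ 2 = 1 := by
      rw [hW]
      simp only [mul_pow, hv, one_mul]
      rw [← Complex.exp_nat_mul]
      have : ((n + 3 : ℕ) : ℂ) * (-(h : ℂ) * Complex.log (x t)) =
          -(((2 : ℕ) : ℂ) * Complex.log (x t)) := by
        have h3 : ((n : ℂ) + 3) ≠ 0 := by exact_mod_cast (by omega : n + 3 ≠ 0)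
        rw [hh]; push_cast; field_simp
      rw [this, Complex.exp_neg, Complex.exp_nat_mul, Complex.exp_log hx0,
        inv_mul_cancel₀ (pow_ne_zero _ hx0)]
    rw [h1]
    simp only [hG, hPe _ hR']
    push_cast
    generalize W (x t) = w at *
    generalize m w = μ at *
    generalize (centredPoly a).eval w⁻¹ = q at *
    have h4 : q * w⁻¹ ^ 4 * (-↑h * w / x t * μ) ^ 2 =
        h ^ 2 * ((μ ^ 2 * (w ^ (n + 1) * q)) / (w ^ (n + 3) * x t ^ 2)) := by
      field_simp
      ring
    rw [h4, h2, hWN]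
    simp
  · have h1 : Tendsto (fun t => (v : ℂ) * Complex.exp (-h * (Complex.arg (x t) : ℂ) * Complex.I))
        atTop (𝓝 (v * Complex.exp (-h * ((0 : ℝ) : ℂ) * Complex.I))) := by
      have hcont : Continuous fun a : ℝ => (v : ℂ) * Complex.exp (-h * (a : ℂ) * Complex.I) := by
        fun_prop
      exact (hcont.tendsto 0).comp harg
    simp only [Complex.ofReal_zero, mul_zero, zero_mul, Complex.exp_zero, mul_one] at h1
    refine h1.congr fun t => ?_
    rw [hWn, hW]
    have h2 : Complex.exp (-(h : ℂ) * Complex.log (x t)) =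
        (Real.exp (-h * Real.log ‖x t‖) : ℂ) *
          Complex.exp (-h * (Complex.arg (x t) : ℂ) * Complex.I) := by
      rw [Complex.ofReal_exp, ← Complex.exp_add, Complex.log]
      congr 1; push_cast; ring
    have h3 : (Real.exp (-h * Real.log ‖x t‖) : ℂ) ≠ 0 := by
      exact_mod_cast (Real.exp_pos _).ne'
    simp only [h2]
    field_simp

/-! ### Smooth interpolation by circle diffeomorphisms -/

/-- A smooth staircase of period and height one, rising on `[k / N, (k + 1) / N]`. -/
def staircase (N k : ℕ) (y : ℝ) : ℝ := ⌊y⌋ + Real.smoothTransition (N * Int.fract y - k)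

/-- Smoothness is in doubt only at integers. Around the period of `y₀` the function is a sum of two
genuine smooth steps: to the right of `⌊y₀⌋` the first is already `1`, to the left the second is
still `0`. -/
theorem staircase_eventuallyEq {N k : ℕ} (hk : k < N) (y₀ : ℝ) :
    staircase N k =ᶠ[𝓝 y₀] fun y => (⌊y₀⌋ : ℝ) - 1 +
      (Real.smoothTransition (N * (y - ⌊y₀⌋ + 1) - k) +
        Real.smoothTransition (N * (y - ⌊y₀⌋) - k)) := by
  have hN : (k : ℝ) + 1 ≤ N := by exact_mod_cast hk
  have hk0 : (0 : ℝ) ≤ k := Nat.cast_nonneg k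
  set m := ⌊y₀⌋ with hm
  have h1 : (m : ℝ) ≤ y₀ := Int.floor_le y₀
  have h2 : y₀ < m + 1 := Int.lt_floor_add_one y₀
  filter_upwards [Ioo_mem_nhds (by linarith : (m : ℝ) - 1 < y₀) h2] with y hy
  rcases le_or_gt (m : ℝ) y with h | h
  · have hfl : ⌊y⌋ = m := Int.floor_eq_iff.2 ⟨h, hy.2⟩
    have hfr : Int.fract y = y - m := by rw [Int.fract, hfl]
    rw [staircase, hfl, hfr, Real.smoothTransition.one_of_one_le (x := N * (y - m + 1) - k) (by
      nlinarith)]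
    ring
  · have hfl : ⌊y⌋ = m - 1 := Int.floor_eq_iff.2 ⟨by push_cast; exact hy.1.le, by push_cast; linarith⟩
    have hfr : Int.fract y = y - m + 1 := by rw [Int.fract, hfl]; push_cast; ring
    rw [staircase, hfl, hfr, Real.smoothTransition.zero_of_nonpos (x := N * (y - m) - k) (by
      nlinarith)]
    push_cast; ring

theorem contDiff_staircase {N k : ℕ} (hk : k < N) : ContDiff ℝ (⊤ : ℕ∞) (staircase N k) := by
  rw [contDiff_iff_contDiffAt]
  intro y
  refine ContDiffAt.congr_of_eventuallyEq ?_ (staircase_eventuallyEq hk y)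
  have := Real.smoothTransition.contDiff (n := (⊤ : ℕ∞))
  exact (contDiff_const.add ((this.comp (by fun_prop)).add (this.comp (by fun_prop)))).contDiffAt

theorem deriv_staircase_nonneg {N k : ℕ} (hk : k < N) (y : ℝ) : 0 ≤ deriv (staircase N k) y := by
  rw [(staircase_eventuallyEq hk y).deriv_eq]
  refine Monotone.deriv_nonneg ?_
  intro a b hab
  have h : ∀ c : ℝ, Real.smoothTransition (N * (a - ⌊y⌋ + c) - k) ≤
      Real.smoothTransition (N * (b - ⌊y⌋ + c) - k) := fun c =>
    Real.smoothTransition.monotone (by gcongr)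
  have h0 := h 0
  simp only [add_zero] at h0
  exact add_le_add le_rfl (add_le_add (h 1) h0)

theorem staircase_add_one (N k : ℕ) (y : ℝ) : staircase N k (y + 1) = staircase N k y + 1 := by
  rw [staircase, staircase, Int.floor_add_one, Int.fract_add_one]; push_cast; ring

theorem staircase_div {N k j : ℕ} (hj : j < N) :
    staircase N k (j / N) = if k < j then 1 else 0 := by
  have hN : (0 : ℝ) < N := by exact_mod_cast (by omega : 0 < N)
  have hfl : ⌊(j / N : ℝ)⌋ = 0 := by
    rw [Int.floor_eq_zero_iff]
    exact ⟨by positivity, by rw [div_lt_one hN]; exact_mod_cast hj⟩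
  rw [staircase, Int.fract, hfl]
  simp only [Int.cast_zero, sub_zero, zero_add]
  rw [mul_div_cancel₀ _ hN.ne']
  split_ifs with h
  · exact Real.smoothTransition.one_of_one_le (by
      have : (k : ℝ) + 1 ≤ j := by exact_mod_cast h
      linarith)
  · exact Real.smoothTransition.zero_of_nonpos (by
      have : (j : ℝ) ≤ k := by exact_mod_cast not_lt.1 h
      linarith)

/-- Lifts of orientation preserving circle diffeomorphisms interpolate finitely many points given
in cyclic order. -/
theorem exists_circle_diffeo {N : ℕ} (hN : 0 < N) {t : Fin N → ℝ} (ht : StrictMono t)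
    (ht2 : ∀ i j, t j < t i + 2 * Real.pi) :
    ∃ h : ℝ → ℝ, ContDiff ℝ (⊤ : ℕ∞) h ∧ (∀ θ, 0 < deriv h θ) ∧
      (∀ θ, h (θ + 2 * Real.pi) = h θ + 2 * Real.pi) ∧
      ∀ k : Fin N, h (2 * Real.pi * k / N) = t k := by
  have hNR : (0 : ℝ) < N := by exact_mod_cast hN
  have hpi := Real.pi_pos
  -- The `N`th value is the first one a full turn later, so the last gap closes up the circle.
  set τ : ℕ → ℝ := fun k => if h : k < N then t ⟨k, h⟩ else t ⟨0, hN⟩ + 2 * Real.pi with hτ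
  have hτlt : ∀ k ∈ Finset.range N, 0 < τ (k + 1) - τ k := by
    intro k hk
    rw [Finset.mem_range] at hk
    rw [sub_pos, hτ]
    simp only [hk, dif_pos]
    split_ifs with h
    · exact ht (by simp [Fin.lt_def])
    · exact ht2 _ _
  -- A linear function climbs the smallest gap `d` on every subinterval and keeps the derivative
  -- positive; the staircases supply the nonnegative remainders `c k`.
  obtain ⟨k₀, hk₀, hmin⟩ := Finset.exists_min_image (Finset.range N) (fun k => τ (k + 1) - τ k)
    ⟨0, by simpa using hN⟩
  set d := τ (k₀ + 1) - τ k₀ with hd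
  have hd0 : 0 < d := hτlt k₀ hk₀
  set c : ℕ → ℝ := fun k => τ (k + 1) - τ k - d with hc
  have hc0 : ∀ k ∈ Finset.range N, 0 ≤ c k := fun k hk => sub_nonneg.2 (hmin k hk)
  have hcsum : ∀ j, ∑ k ∈ Finset.range j, c k = τ j - τ 0 - j * d := by
    intro j
    rw [hc, Finset.sum_sub_distrib, Finset.sum_range_sub, Finset.sum_const, Finset.card_range,
      nsmul_eq_mul]
  have hder : ∀ θ, HasDerivAt (fun θ => t ⟨0, hN⟩ + d * N / (2 * Real.pi) * θ +
      ∑ k ∈ Finset.range N, c k * staircase N k (θ / (2 * Real.pi)))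
      (d * N / (2 * Real.pi) * 1 + ∑ k ∈ Finset.range N,
        c k * (deriv (staircase N k) (θ / (2 * Real.pi)) * (1 / (2 * Real.pi)))) θ := by
    intro θ
    refine (((hasDerivAt_id' θ).const_mul _).const_add _).add ?_
    refine HasDerivAt.fun_sum fun k hk => HasDerivAt.const_mul _ ?_
    have h1 := ((contDiff_staircase (Finset.mem_range.1 hk)).differentiable (by simp)
      (θ / (2 * Real.pi))).hasDerivAt
    exact h1.comp θ ((hasDerivAt_id' θ).div_const _)
  refine ⟨fun θ => t ⟨0, hN⟩ + d * N / (2 * Real.pi) * θ +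
    ∑ k ∈ Finset.range N, c k * staircase N k (θ / (2 * Real.pi)), ?_, ?_, ?_, ?_⟩
  · refine ContDiff.add (by fun_prop) (ContDiff.sum fun k hk => ?_)
    exact contDiff_const.mul ((contDiff_staircase (Finset.mem_range.1 hk)).comp (by fun_prop))
  · intro θ
    rw [(hder θ).deriv]
    have h1 : 0 < d * N / (2 * Real.pi) * 1 := by positivity
    refine add_pos_of_pos_of_nonneg h1 (Finset.sum_nonneg fun k hk => ?_)
    exact mul_nonneg (hc0 k hk) (mul_nonneg
      (deriv_staircase_nonneg (Finset.mem_range.1 hk) _) (by positivity))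
  · intro θ
    have h1 : (θ + 2 * Real.pi) / (2 * Real.pi) = θ / (2 * Real.pi) + 1 := by field_simp
    have h2 : τ N - τ 0 = 2 * Real.pi := by simp [hτ, hN]
    have h3 := hcsum N
    rw [h2] at h3
    simp only [h1, staircase_add_one, mul_add, mul_one, Finset.sum_add_distrib, h3]
    field_simp
    ring
  · intro k
    have h1 : 2 * Real.pi * k / N / (2 * Real.pi) = (k : ℕ) / N := by field_simp
    have h2 : ∀ j ∈ Finset.range N, c j * staircase N j (2 * Real.pi * k / N / (2 * Real.pi)) =
        if j < (k : ℕ) then c j else 0 := fun j _ => by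
      rw [h1, staircase_div k.2]; split_ifs <;> simp
    have h3 : (Finset.range N).filter (fun j => j < (k : ℕ)) = Finset.range k := by
      ext j; simp only [Finset.mem_filter, Finset.mem_range]; have := k.2; omega
    simp only []
    rw [Finset.sum_congr rfl h2, ← Finset.sum_filter, h3, hcsum]
    simp only [hτ, k.2, dif_pos, hN]
    field_simp
    ring

/-! ### The standard framing -/

theorem det₂_mul (w a b : ℂ) : det₂ (w * a) (w * b) = Complex.normSq w * det₂ a b := by
  simp only [det₂, Complex.mul_re, Complex.mul_im, Complex.normSq_apply]; ring

/-- Multiplication by `c` has real determinant `|c|²`; holomorphic changes of coordinate therefore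
do not affect the sign of a Jacobian. -/
theorem det₂_linear (L : ℂ →L[ℝ] ℂ) (c : ℂ) :
    det₂ (L c) (L (c * Complex.I)) = Complex.normSq c * det₂ (L 1) (L Complex.I) := by
  have h1 : L c = (c.re : ℂ) * L 1 + (c.im : ℂ) * L Complex.I := by
    have : c = c.re • (1 : ℂ) + c.im • Complex.I := by
      apply Complex.ext <;> simp
    conv_lhs => rw [this, map_add, map_smul, map_smul]
    simp
  have h2 : L (c * Complex.I) = (c.re : ℂ) * L Complex.I - (c.im : ℂ) * L 1 := by
    have : c * Complex.I = c.re • Complex.I - c.im • (1 : ℂ) := by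
      apply Complex.ext <;> simp
    rw [this, map_sub, map_smul, map_smul]
    simp
  rw [h1, h2]
  simp only [det₂, Complex.normSq_apply, Complex.add_re, Complex.add_im, Complex.sub_re,
    Complex.sub_im, Complex.mul_re, Complex.mul_im, Complex.ofReal_re, Complex.ofReal_im]
  ring

/-- The radial coordinate of the standard framing. -/
def radius (r : ℝ) : ℝ := √(1 + r ^ 2) - r

theorem sqrt_pos_aux (r : ℝ) : 0 < √(1 + r ^ 2) := Real.sqrt_pos.2 (by positivity)

theorem abs_lt_sqrt (r : ℝ) : |r| < √(1 + r ^ 2) := by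
  rw [← Real.sqrt_sq_eq_abs]
  exact Real.sqrt_lt_sqrt (sq_nonneg r) (by linarith)

theorem radius_pos (r : ℝ) : 0 < radius r := sub_pos.2 ((le_abs_self r).trans_lt (abs_lt_sqrt r))

theorem contDiff_radius : ContDiff ℝ (⊤ : ℕ∞) radius := by
  refine ContDiff.sub ?_ contDiff_id
  exact (contDiff_const.add (contDiff_id.pow 2)).sqrt fun r => by
    have : 0 < 1 + r ^ 2 := by positivity
    exact this.ne'

theorem hasDerivAt_radius (r : ℝ) : HasDerivAt radius (r / √(1 + r ^ 2) - 1) r := by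
  have h : (1 + r ^ 2) ≠ 0 := by positivity
  have := (((hasDerivAt_pow 2 r).const_add 1).sqrt h).sub (hasDerivAt_id r)
  refine this.congr_deriv ?_
  have := (sqrt_pos_aux r).ne'
  simp only [Nat.cast_ofNat, Nat.add_one_sub_one, pow_one]
  field_simp

theorem deriv_radius_neg (r : ℝ) : r / √(1 + r ^ 2) - 1 < 0 := by
  rw [sub_neg, div_lt_one (sqrt_pos_aux r)]
  exact (le_abs_self r).trans_lt (abs_lt_sqrt r)

theorem radius_strictAnti : StrictAnti radius :=
  strictAnti_of_deriv_neg fun r => by rw [(hasDerivAt_radius r).deriv]; exact deriv_radius_neg r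

theorem radius_zero : radius 0 = 1 := by simp [radius]

theorem exists_radius_eq {ρ : ℝ} (h0 : 0 < ρ) (h1 : ρ ≤ 1) : ∃ r, 0 ≤ r ∧ radius r = ρ := by
  -- Obtained by squaring `√(1 + r²) = ρ + r`.
  refine ⟨(1 - ρ ^ 2) / (2 * ρ), div_nonneg (by nlinarith) (by positivity), ?_⟩
  have : 1 + ((1 - ρ ^ 2) / (2 * ρ)) ^ 2 = ((1 + ρ ^ 2) / (2 * ρ)) ^ 2 := by field_simp; ring
  rw [radius, this, Real.sqrt_sq (by positivity)]
  field_simp; ring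

/-! ### The standard framing in polar, logarithmic and affine coordinates -/

section
variable (h : ℝ → ℝ)

/-- The angular coordinate of the standard framing with boundary values `h`. -/
def angle (y : ℝ × ℝ) : ℝ :=
  -y.2 + Real.smoothTransition (2 - y.1 ^ 2) * (h (-y.2) + y.2)

/-- The standard framing in polar coordinates at the pole. -/
def polarFraming (y : ℝ × ℝ) : ℂ := radius y.1 * Complex.exp (angle h y * Complex.I)

variable {h}

theorem norm_polarFraming (y : ℝ × ℝ) : ‖polarFraming h y‖ = radius y.1 := by
  rw [polarFraming, norm_mul, Complex.norm_exp_ofReal_mul_I, mul_one, Complex.norm_real,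
    Real.norm_of_nonneg (radius_pos _).le]

theorem contDiff_angle (hh : ContDiff ℝ (⊤ : ℕ∞) h) : ContDiff ℝ (⊤ : ℕ∞) (angle h) := by
  have := Real.smoothTransition.contDiff (n := (⊤ : ℕ∞))
  exact (by fun_prop : ContDiff ℝ (⊤ : ℕ∞) fun y : ℝ × ℝ => -y.2).add
    ((this.comp (by fun_prop)).mul ((hh.comp (by fun_prop)).add (by fun_prop)))

theorem contDiff_polarFraming (hh : ContDiff ℝ (⊤ : ℕ∞) h) :
    ContDiff ℝ (⊤ : ℕ∞) (polarFraming h) := by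
  have h1 : ContDiff ℝ (⊤ : ℕ∞) fun y : ℝ × ℝ => ((radius y.1 : ℝ) : ℂ) :=
    Complex.ofRealCLM.contDiff.comp (contDiff_radius.comp contDiff_fst)
  have h2 : ContDiff ℝ (⊤ : ℕ∞) fun y : ℝ × ℝ => ((angle h y : ℝ) : ℂ) :=
    Complex.ofRealCLM.contDiff.comp (contDiff_angle hh)
  exact h1.mul (h2.mul contDiff_const).cexp

theorem hasDerivAt_angle (hh : ContDiff ℝ (⊤ : ℕ∞) h) (r θ : ℝ) :
    HasDerivAt (fun θ => angle h (r, θ))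
      (-((1 - Real.smoothTransition (2 - r ^ 2)) +
        Real.smoothTransition (2 - r ^ 2) * deriv h (-θ))) θ := by
  have h1 : HasDerivAt h (deriv h (-θ)) (-θ) := (hh.differentiable (by simp) _).hasDerivAt
  have h2 := (h1.comp θ (hasDerivAt_neg θ)).add (hasDerivAt_id θ)
  have h3 := (hasDerivAt_neg θ).add (h2.const_mul (Real.smoothTransition (2 - r ^ 2)))
  refine h3.congr_deriv ?_
  ring

/-- The derivative is minus a convex combination of `1` and `h'(-θ)`, so the interpolation stays
monotone. The cutoff is `1` for `0 ≤ r ≤ 1`, near the pole, and `0` once `r² ≥ 2`; the signs come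
from `arg z = -θ` in the coordinate `1/z`. -/
theorem deriv_angle_neg (hh' : ∀ θ, 0 < deriv h θ) (r θ : ℝ) :
    -((1 - Real.smoothTransition (2 - r ^ 2)) +
        Real.smoothTransition (2 - r ^ 2) * deriv h (-θ)) < 0 := by
  have h0 := Real.smoothTransition.nonneg (2 - r ^ 2)
  have h1 := Real.smoothTransition.le_one (2 - r ^ 2)
  have h2 := hh' (-θ)
  rcases eq_or_lt_of_le h0 with h3 | h3
  · rw [← h3]; norm_num
  · have := mul_pos h3 h2
    linarith

theorem angle_strictAnti (hh : ContDiff ℝ (⊤ : ℕ∞) h) (hh' : ∀ θ, 0 < deriv h θ) (r : ℝ) :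
    StrictAnti fun θ => angle h (r, θ) :=
  strictAnti_of_deriv_neg fun θ => by
    rw [(hasDerivAt_angle hh r θ).deriv]; exact deriv_angle_neg hh' r θ

/-- The modulus depends on `r` only, so the Jacobian is triangular in the moving frame; its two
diagonal entries, the derivatives of the modulus in `r` and of the angle in `θ`, are both negative.
-/
theorem det₂_polarFraming (hh : ContDiff ℝ (⊤ : ℕ∞) h) (hh' : ∀ θ, 0 < deriv h θ) (y : ℝ × ℝ) :
    0 < det₂ (fderiv ℝ (polarFraming h) y (1, 0)) (fderiv ℝ (polarFraming h) y (0, 1)) := by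
  obtain ⟨r, θ⟩ := y
  have hd : HasFDerivAt (polarFraming h) (fderiv ℝ (polarFraming h) (r, θ)) (r, θ) :=
    ((contDiff_polarFraming hh).differentiable (by simp) _).hasFDerivAt
  have hang : DifferentiableAt ℝ (angle h) (r, θ) :=
    (contDiff_angle hh).differentiable (by simp) _
  have e1 : fderiv ℝ (polarFraming h) (r, θ) (1, 0) =
      Complex.exp (angle h (r, θ) * Complex.I) * ((r / √(1 + r ^ 2) - 1 : ℝ) +
        radius r * (fderiv ℝ (angle h) (r, θ) (1, 0) : ℝ) * Complex.I) := by
    have hc : HasDerivAt (fun s : ℝ => (s, θ)) ((1 : ℝ), (0 : ℝ)) r :=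
      (hasDerivAt_id r).prodMk (hasDerivAt_const r θ)
    have h1 := hd.comp_hasDerivAt r hc
    have h2 := (hasDerivAt_radius r).ofReal_comp.mul
      (((hang.hasFDerivAt.comp_hasDerivAt r hc).ofReal_comp.mul_const Complex.I).cexp)
    rw [h1.unique h2]
    simp only [Function.comp_apply]
    ring
  have e2 : fderiv ℝ (polarFraming h) (r, θ) (0, 1) =
      Complex.exp (angle h (r, θ) * Complex.I) * (radius r *
        (-((1 - Real.smoothTransition (2 - r ^ 2)) +
        Real.smoothTransition (2 - r ^ 2) * deriv h (-θ)) : ℝ) * Complex.I) := by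
    have hc : HasDerivAt (fun s : ℝ => (r, s)) ((0 : ℝ), (1 : ℝ)) θ :=
      (hasDerivAt_const θ r).prodMk (hasDerivAt_id θ)
    have h1 := hd.comp_hasDerivAt θ hc
    have h2 := ((((hasDerivAt_angle hh r θ).ofReal_comp.mul_const Complex.I).cexp)).const_mul
      (radius r : ℂ)
    rw [h1.unique h2]
    ring
  rw [e1, e2, det₂_mul]
  refine mul_pos (Complex.normSq_pos.2 (Complex.exp_ne_zero _)) ?_
  have h3 := mul_pos_of_neg_of_neg (deriv_radius_neg r)
    (mul_neg_of_pos_of_neg (radius_pos r) (deriv_angle_neg hh' r θ))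
  simp only [det₂, Complex.add_re, Complex.add_im, Complex.mul_re, Complex.mul_im,
    Complex.ofReal_re, Complex.ofReal_im, Complex.I_re, Complex.I_im]
  linarith

theorem angle_add_two_pi (hper : ∀ θ, h (θ + 2 * Real.pi) = h θ + 2 * Real.pi) (r θ : ℝ) :
    angle h (r, θ + 2 * Real.pi) = angle h (r, θ) - 2 * Real.pi := by
  have := hper (-(θ + 2 * Real.pi))
  rw [neg_add_rev, neg_add_cancel_comm] at this
  simp only [angle, neg_add_rev]
  rw [this]; ring

theorem angle_add_int (hper : ∀ θ, h (θ + 2 * Real.pi) = h θ + 2 * Real.pi) (r θ : ℝ) (m : ℤ) :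
    angle h (r, θ + m * (2 * Real.pi)) = angle h (r, θ) - m * (2 * Real.pi) := by
  have hp : Function.Periodic (fun θ => angle h (r, θ) + θ) (2 * Real.pi) := fun θ => by
    simp only [angle_add_two_pi hper]; ring
  have := hp.int_mul m θ
  linarith

theorem polarFraming_add_int (hper : ∀ θ, h (θ + 2 * Real.pi) = h θ + 2 * Real.pi)
    (r θ : ℝ) (m : ℤ) : polarFraming h (r, θ + m * (2 * Real.pi)) = polarFraming h (r, θ) := by
  rw [polarFraming, polarFraming, angle_add_int hper, Complex.ofReal_sub, sub_mul,
    Complex.exp_sub]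
  have : Complex.exp (((m * (2 * Real.pi) : ℝ) : ℂ) * Complex.I) = 1 := by
    rw [Complex.exp_eq_one_iff]; exact ⟨m, by push_cast; ring⟩
  rw [this, div_one]

variable (h) in
/-- The standard framing in logarithmic coordinates. -/
def logFraming (ζ : ℂ) : ℂ := polarFraming h (Real.exp (-ζ.re), -ζ.im)

theorem logFraming_congr (hper : ∀ θ, h (θ + 2 * Real.pi) = h θ + 2 * Real.pi) {ζ ζ' : ℂ}
    (he : Complex.exp ζ = Complex.exp ζ') : logFraming h ζ = logFraming h ζ' := by
  obtain ⟨m, rfl⟩ := Complex.exp_eq_exp_iff_exists_int.1 he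
  have := polarFraming_add_int hper (Real.exp (-ζ'.re)) (-ζ'.im) (-m)
  rw [logFraming, logFraming, ← this]
  simp
  ring_nf

theorem contDiff_logFraming (hh : ContDiff ℝ (⊤ : ℕ∞) h) :
    ContDiff ℝ (⊤ : ℕ∞) (logFraming h) := by
  refine (contDiff_polarFraming hh).comp (ContDiff.prodMk ?_ ?_)
  · exact (Complex.reCLM.contDiff.neg).exp
  · exact Complex.imCLM.contDiff.neg

/-- Passing from `ζ = log z` to `(r, θ)` reverses both coordinates, and so preserves orientation. -/
theorem det₂_logFraming (hh : ContDiff ℝ (⊤ : ℕ∞) h) (hh' : ∀ θ, 0 < deriv h θ) (ζ : ℂ) :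
    0 < det₂ (fderiv ℝ (logFraming h) ζ 1) (fderiv ℝ (logFraming h) ζ Complex.I) := by
  set y : ℝ × ℝ := (Real.exp (-ζ.re), -ζ.im) with hy
  have hd : HasFDerivAt (polarFraming h) (fderiv ℝ (polarFraming h) y) y :=
    ((contDiff_polarFraming hh).differentiable (by simp) _).hasFDerivAt
  have hl : HasFDerivAt (logFraming h) (fderiv ℝ (logFraming h) ζ) ζ :=
    ((contDiff_logFraming hh).differentiable (by simp) _).hasFDerivAt
  have e1 : fderiv ℝ (logFraming h) ζ 1 =
      (-Real.exp (-ζ.re)) • fderiv ℝ (polarFraming h) y (1, 0) := by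
    have hc : HasDerivAt (fun s : ℝ => ζ + s • (1 : ℂ)) 1 0 := by
      simpa using ((hasDerivAt_id (0 : ℝ)).smul_const (1 : ℂ)).const_add ζ
    have h1 := HasFDerivAt.comp_hasDerivAt_of_eq 0 hl hc (by simp)
    have hc2 : HasDerivAt (fun s : ℝ => (Real.exp (-(ζ.re + s)), -ζ.im))
        (-Real.exp (-ζ.re), (0 : ℝ)) 0 := by
      have : HasDerivAt (fun s : ℝ => Real.exp (-(ζ.re + s))) (-Real.exp (-ζ.re)) 0 := by
        have := (((hasDerivAt_id (0 : ℝ)).const_add ζ.re).neg).exp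
        simpa using this
      exact this.prodMk (hasDerivAt_const _ _)
    have h2 := HasFDerivAt.comp_hasDerivAt_of_eq 0 hd hc2 (by simp [hy])
    have h3 : (logFraming h ∘ fun s : ℝ => ζ + s • (1 : ℂ)) =
        polarFraming h ∘ fun s : ℝ => (Real.exp (-(ζ.re + s)), -ζ.im) := by
      ext s; simp [logFraming]
    rw [h3] at h1
    rw [h1.unique h2, ← map_smul]
    simp
  have e2 : fderiv ℝ (logFraming h) ζ Complex.I =
      (-1 : ℝ) • fderiv ℝ (polarFraming h) y (0, 1) := by
    have hc : HasDerivAt (fun s : ℝ => ζ + s • Complex.I) Complex.I 0 := by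
      simpa using ((hasDerivAt_id (0 : ℝ)).smul_const Complex.I).const_add ζ
    have h1 := HasFDerivAt.comp_hasDerivAt_of_eq 0 hl hc (by simp)
    have hc2 : HasDerivAt (fun s : ℝ => (Real.exp (-ζ.re), -(ζ.im + s)))
        ((0 : ℝ), (-1 : ℝ)) 0 :=
      (hasDerivAt_const _ _).prodMk (((hasDerivAt_id (0 : ℝ)).const_add ζ.im).neg)
    have h2 := HasFDerivAt.comp_hasDerivAt_of_eq 0 hd hc2 (by simp [hy])
    have h3 : (logFraming h ∘ fun s : ℝ => ζ + s • Complex.I) =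
        polarFraming h ∘ fun s : ℝ => (Real.exp (-ζ.re), -(ζ.im + s)) := by
      ext s; simp [logFraming]
    rw [h3] at h1
    rw [h1.unique h2, ← map_smul]
    simp
  have h4 := mul_pos (Real.exp_pos (-ζ.re)) (det₂_polarFraming hh hh' y)
  rw [e1, e2]
  simp only [det₂, Complex.real_smul, Complex.mul_re, Complex.mul_im, Complex.ofReal_re,
    Complex.ofReal_im] at h4 ⊢
  linarith

variable (h) in
/-- The standard framing in the affine coordinate. -/
def affineFraming (z : ℂ) : ℂ := if z = 0 then 0 else logFraming h (Complex.log z)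

theorem affineFraming_exp (hper : ∀ θ, h (θ + 2 * Real.pi) = h θ + 2 * Real.pi) (ζ : ℂ) :
    affineFraming h (Complex.exp ζ) = logFraming h ζ := by
  rw [affineFraming, if_neg (Complex.exp_ne_zero _)]
  exact logFraming_congr hper (Complex.exp_log (Complex.exp_ne_zero _))

/-- The cut of the principal logarithm is only apparent: by periodicity the logarithm may be
recentred at `z₀`, where it is smooth. -/
theorem affineFraming_eventuallyEq (hper : ∀ θ, h (θ + 2 * Real.pi) = h θ + 2 * Real.pi) {z₀ : ℂ}
    (hz : z₀ ≠ 0) : affineFraming h =ᶠ[𝓝 z₀]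
      fun z => logFraming h (Complex.log z₀ + Complex.log (z / z₀)) := by
  filter_upwards [isOpen_ne.mem_nhds hz] with z hz'
  rw [← affineFraming_exp hper, Complex.exp_add, Complex.exp_log hz,
    Complex.exp_log (div_ne_zero hz' hz), mul_div_cancel₀ _ hz]

/-- At the centre of the disk polar coordinates break down. There the cutoff vanishes and the
framing is a rescaling of `z` by a smooth function of `‖z‖²`. -/
theorem affineFraming_eq_of_small {z : ℂ} (hz : ‖z‖ < 1 / 2) :
    affineFraming h z = z * ((1 + √(1 + ‖z‖ ^ 2))⁻¹ : ℝ) := by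
  by_cases h0 : z = 0
  · simp [affineFraming, h0]
  · have hn : 0 < ‖z‖ := norm_pos_iff.2 h0
    rw [affineFraming, if_neg h0, logFraming, polarFraming, angle, Complex.log_re, Complex.log_im,
      Real.exp_neg, Real.exp_log hn]
    have h1 : Real.smoothTransition (2 - ‖z‖⁻¹ ^ 2) = 0 := by
      apply Real.smoothTransition.zero_of_nonpos
      have : 2 ≤ ‖z‖⁻¹ := by
        rw [le_inv_comm₀ two_pos hn]; linarith
      nlinarith
    simp only [h1, neg_neg, zero_mul, add_zero]
    have h2 : radius ‖z‖⁻¹ = ‖z‖ * (1 + √(1 + ‖z‖ ^ 2))⁻¹ := by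
      have e : 1 + ‖z‖⁻¹ ^ 2 = (1 + ‖z‖ ^ 2) / ‖z‖ ^ 2 := by field_simp; ring
      have hs : √(1 + ‖z‖ ^ 2) ^ 2 = 1 + ‖z‖ ^ 2 := Real.sq_sqrt (by positivity)
      have hp := Real.sqrt_nonneg (1 + ‖z‖ ^ 2)
      have hp' : 1 + √(1 + ‖z‖ ^ 2) ≠ 0 := by positivity
      rw [radius, e, Real.sqrt_div (by positivity), Real.sqrt_sq hn.le, eq_mul_inv_iff_mul_eq₀ hp']
      field_simp
      linarith
    rw [h2]
    conv_rhs => rw [← Complex.norm_mul_exp_arg_mul_I z]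
    simp only [norm_mul, Complex.norm_exp_ofReal_mul_I, mul_one, norm_norm, Complex.norm_real]
    push_cast
    ring

theorem contDiff_affineFraming (hh : ContDiff ℝ (⊤ : ℕ∞) h)
    (hper : ∀ θ, h (θ + 2 * Real.pi) = h θ + 2 * Real.pi) :
    ContDiff ℝ (⊤ : ℕ∞) (affineFraming h) := by
  rw [contDiff_iff_contDiffAt]
  intro z₀
  by_cases hz : z₀ = 0
  · subst hz
    have hev : affineFraming h =ᶠ[𝓝 0] fun z => z * ((1 + √(1 + ‖z‖ ^ 2))⁻¹ : ℝ) := by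
      filter_upwards [Metric.ball_mem_nhds (0 : ℂ) (by norm_num : (0 : ℝ) < 1 / 2)] with z hz
      exact affineFraming_eq_of_small (by simpa using hz)
    refine ContDiffAt.congr_of_eventuallyEq ?_ hev
    refine ContDiff.contDiffAt (contDiff_id.mul (Complex.ofRealCLM.contDiff.comp ?_))
    refine ContDiff.inv (contDiff_const.add (ContDiff.sqrt (contDiff_const.add ?_) ?_)) ?_
    · exact contDiff_norm_sq ℝ
    · intro z
      have : 0 < 1 + ‖z‖ ^ 2 := by positivity
      exact this.ne'
    · intro z
      have := Real.sqrt_nonneg (1 + ‖z‖ ^ 2)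
      positivity
  · refine ContDiffAt.congr_of_eventuallyEq ?_ (affineFraming_eventuallyEq hper hz)
    refine (contDiff_logFraming hh).contDiffAt.comp z₀ (contDiffAt_const.add ?_)
    have h1 : ContDiffAt ℂ (⊤ : ℕ∞) (fun z => Complex.log (z / z₀)) z₀ :=
      (Complex.contDiffAt_log (by rw [div_self hz]; exact Complex.one_mem_slitPlane)).comp z₀
        (contDiffAt_id.div_const z₀)
    exact h1.restrict_scalars ℝ

theorem det₂_affineFraming (hh : ContDiff ℝ (⊤ : ℕ∞) h) (hh' : ∀ θ, 0 < deriv h θ)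
    (hper : ∀ θ, h (θ + 2 * Real.pi) = h θ + 2 * Real.pi) (z₀ : ℂ) :
    0 < det₂ (fderiv ℝ (affineFraming h) z₀ 1) (fderiv ℝ (affineFraming h) z₀ Complex.I) := by
  by_cases hz : z₀ = 0
  · subst hz
    have hd : HasFDerivAt (affineFraming h) (fderiv ℝ (affineFraming h) 0) 0 :=
      ((contDiff_affineFraming hh hper).differentiable (by simp) _).hasFDerivAt
    -- The derivative at the centre is read off along each line through `0`, where the rescaling
    -- factor tends to `1/2`.
    have key : ∀ v : ℂ, fderiv ℝ (affineFraming h) 0 v = v * (1 / 2 : ℝ) := by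
      intro v
      have hc : HasDerivAt (fun s : ℝ => s • v) v 0 := by
        simpa using (hasDerivAt_id (0 : ℝ)).smul_const v
      have h1 := HasFDerivAt.comp_hasDerivAt_of_eq 0 hd hc (by simp)
      have h2 := h1.tendsto_slope_zero
      have h3 : Tendsto (fun s : ℝ => v * ((1 + √(1 + ‖s • v‖ ^ 2))⁻¹ : ℝ)) (𝓝[≠] 0)
          (𝓝 (v * (1 / 2 : ℝ))) := by
        have hc : ContinuousAt (fun s : ℝ => v * ((1 + √(1 + ‖s • v‖ ^ 2))⁻¹ : ℝ)) 0 := by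
          refine continuousAt_const.mul (Complex.continuous_ofReal.continuousAt.comp ?_)
          refine ContinuousAt.inv₀ (by fun_prop) (by positivity)
        have := hc.tendsto.mono_left (nhdsWithin_le_nhds (s := {0}ᶜ))
        simpa [one_add_one_eq_two] using this
      refine tendsto_nhds_unique h2 (h3.congr' ?_)
      have hsm : ∀ᶠ s : ℝ in 𝓝 0, ‖s • v‖ < 1 / 2 := by
        have : Continuous fun s : ℝ => ‖s • v‖ := by fun_prop
        exact this.continuousAt.eventually_lt continuousAt_const (by simp)
      filter_upwards [nhdsWithin_le_nhds hsm, self_mem_nhdsWithin] with s hs hs0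
      have hs0 : (s : ℂ) ≠ 0 := by exact_mod_cast hs0
      simp only [Function.comp_apply, zero_add, zero_smul]
      rw [affineFraming_eq_of_small hs, affineFraming, if_pos rfl, sub_zero]
      simp only [Complex.real_smul, Complex.ofReal_inv]
      field_simp
    rw [key, key]
    simp [det₂]
  · have hd := ((contDiff_logFraming hh).differentiable (by simp)
      (Complex.log z₀ + Complex.log (z₀ / z₀))).hasFDerivAt
    have h1 : HasDerivAt (fun z => Complex.log z₀ + Complex.log (z / z₀)) z₀⁻¹ z₀ := by
      have := (((hasDerivAt_id z₀).div_const z₀).clog (by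
        simp only [id]; rw [div_self hz]; exact Complex.one_mem_slitPlane)).const_add (Complex.log z₀)
      refine this.congr_deriv ?_
      simp only [id, div_self hz, div_one, one_div]
    have h2 := hd.comp z₀ (h1.hasFDerivAt.restrictScalars ℝ)
    have h3 := h2.congr_of_eventuallyEq (affineFraming_eventuallyEq hper hz)
    rw [h3.fderiv]
    have e1 : z₀⁻¹ ≠ 0 := inv_ne_zero hz
    have := mul_pos (Complex.normSq_pos.2 e1)
      (det₂_logFraming hh hh' (Complex.log z₀ + Complex.log (z₀ / z₀)))
    rw [← det₂_linear] at this
    simpa [mul_comm] using this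
end

/-- The affine coordinate of a point of the sphere (with junk value `0` at `∞`). -/
def affineCoord : OnePoint ℂ → ℂ
  | OnePoint.infty => 0
  | OnePoint.some z => z

theorem norm_affineFraming_lt {h : ℝ → ℝ} (z : ℂ) : ‖affineFraming h z‖ < 1 := by
  by_cases h0 : z = 0
  · simp [affineFraming, h0]
  · rw [affineFraming, if_neg h0, logFraming, norm_polarFraming, ← radius_zero]
    exact radius_strictAnti (Real.exp_pos _)

/-- The standard framing of the blowup at `∞` whose boundary values are given by `h`. -/
def standardFraming (h : ℝ → ℝ) : RealBlowup OnePoint.infty → Disk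
  | RealBlowup.point x _ => ⟨affineFraming h (affineCoord x),
      mem_closedBall_zero_iff.2 (norm_affineFraming_lt _).le⟩
  | RealBlowup.dir v => ⟨polarFraming h (0, Complex.arg v),
      mem_closedBall_zero_iff.2 (by rw [norm_polarFraming, radius_zero])⟩

theorem ofPoint_of_ne {p x : OnePoint ℂ} (hx : x ≠ p) :
    RealBlowup.ofPoint p x = RealBlowup.point x hx := by
  rw [RealBlowup.ofPoint, dif_neg hx]

section
variable {h : ℝ → ℝ}

theorem standardFraming_coe (z : ℂ) :
    (standardFraming h (RealBlowup.ofPoint OnePoint.infty (z : OnePoint ℂ)) : ℂ) =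
      affineFraming h z := by
  rw [ofPoint_of_ne (OnePoint.coe_ne_infty z)]; rfl

theorem standardFraming_dir_exp (hper : ∀ θ, h (θ + 2 * Real.pi) = h θ + 2 * Real.pi) (θ : ℝ) :
    (standardFraming h (RealBlowup.dir (Circle.exp θ)) : ℂ) = polarFraming h (0, θ) := by
  obtain ⟨m, hm⟩ := Circle.exp_eq_exp.1 (Circle.exp_arg (Circle.exp θ))
  change polarFraming h (0, Complex.arg (Circle.exp θ)) = _
  rw [hm, polarFraming_add_int hper]

theorem standardFraming_polar (hper : ∀ θ, h (θ + 2 * Real.pi) = h θ + 2 * Real.pi) {r : ℝ}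
    (hr : 0 ≤ r) (θ : ℝ) :
    (standardFraming h (polar OnePoint.infty r θ) : ℂ) = polarFraming h (r, θ) := by
  rcases hr.eq_or_lt with rfl | hr
  · rw [polar, if_pos le_rfl, standardFraming_dir_exp hper]
  · have hne : (r : ℂ) * (Circle.exp θ : ℂ) ≠ 0 :=
      mul_ne_zero (by exact_mod_cast hr.ne') (Circle.coe_ne_zero _)
    have h1 : ((r : ℂ) * (Circle.exp θ : ℂ))⁻¹ = Complex.exp (-(Real.log r) - θ * Complex.I) := by
      rw [Circle.coe_exp, sub_eq_add_neg, ← neg_add, Complex.exp_neg, Complex.exp_add,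
        ← Complex.ofReal_exp, Real.exp_log hr]
    rw [polar, if_neg (not_le.2 hr)]
    have h2 : locPt OnePoint.infty ((r : ℂ) * (Circle.exp θ : ℂ)) =
        (((r : ℂ) * (Circle.exp θ : ℂ))⁻¹ : ℂ) := by simp only [locPt, if_neg hne]
    rw [h2, standardFraming_coe, h1, affineFraming_exp hper, logFraming]
    simp [Real.exp_log hr]

theorem polarFraming_eq_iff (hh : ContDiff ℝ (⊤ : ℕ∞) h) (hh' : ∀ θ, 0 < deriv h θ)
    (hper : ∀ θ, h (θ + 2 * Real.pi) = h θ + 2 * Real.pi) {r r' θ θ' : ℝ}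
    (he : polarFraming h (r, θ) = polarFraming h (r', θ')) :
    r = r' ∧ ∃ m : ℤ, θ = θ' + m * (2 * Real.pi) := by
  have hr : r = r' := by
    have := congrArg norm he
    rw [norm_polarFraming, norm_polarFraming] at this
    exact radius_strictAnti.injective this
  subst hr
  refine ⟨rfl, ?_⟩
  have hne : (radius r : ℂ) ≠ 0 := by exact_mod_cast (radius_pos r).ne'
  obtain ⟨m, hm⟩ := Complex.exp_eq_exp_iff_exists_int.1 (mul_left_cancel₀ hne he)
  have hm' : angle h (r, θ) = angle h (r, θ') + m * (2 * Real.pi) := by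
    have h1 : ((angle h (r, θ) : ℝ) : ℂ) = ((angle h (r, θ') + m * (2 * Real.pi) : ℝ) : ℂ) := by
      apply mul_right_cancel₀ Complex.I_ne_zero
      rw [hm]; push_cast; ring
    exact_mod_cast h1
  refine ⟨-m, (angle_strictAnti hh hh' r).injective ?_⟩
  simp only [angle_add_int hper]
  rw [hm']; push_cast; ring

theorem exists_polarFraming_eq (hh : ContDiff ℝ (⊤ : ℕ∞) h)
    (hper : ∀ θ, h (θ + 2 * Real.pi) = h θ + 2 * Real.pi) {d : ℂ} (h0 : d ≠ 0) (h1 : ‖d‖ ≤ 1) :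
    ∃ r θ, 0 ≤ r ∧ polarFraming h (r, θ) = d := by
  obtain ⟨r, hr, hrd⟩ := exists_radius_eq (norm_pos_iff.2 h0) h1
  have hcont : Continuous fun θ => angle h (r, θ) :=
    (contDiff_angle hh).continuous.comp (by fun_prop)
  have hsurj : ∃ θ, angle h (r, θ) = Complex.arg d := by
    -- Moving by `m` turns in either direction brackets the target, so the intermediate value
    -- theorem applies.
    obtain ⟨m, hm⟩ := exists_nat_gt (|angle h (r, 0) - Complex.arg d| / (2 * Real.pi))
    rw [div_lt_iff₀ (by positivity)] at hm
    have hup := angle_add_int hper r 0 (-(m : ℤ))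
    have hlo := angle_add_int hper r 0 (m : ℤ)
    obtain ⟨ha, hb⟩ := abs_lt.1 hm
    have := mem_range_of_exists_le_of_exists_ge hcont (c := Complex.arg d)
      ⟨_, by rw [hlo]; push_cast; linarith⟩ ⟨_, by rw [hup]; push_cast; linarith⟩
    exact this
  obtain ⟨θ, hθ⟩ := hsurj
  exact ⟨r, θ, hr, by rw [polarFraming, hθ]; simp only [hrd]; exact Complex.norm_mul_exp_arg_mul_I d⟩

theorem polar_add_int (p : OnePoint ℂ) (r θ : ℝ) (m : ℤ) :
    polar p r (θ + m * (2 * Real.pi)) = polar p r θ := by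
  have : Circle.exp (θ + m * (2 * Real.pi)) = Circle.exp θ := Circle.exp_eq_exp.2 ⟨m, rfl⟩
  rw [polar, polar, this]

theorem exists_polar_or_zero (x : RealBlowup OnePoint.infty) :
    x = RealBlowup.ofPoint OnePoint.infty ((0 : ℂ) : OnePoint ℂ) ∨
      ∃ r θ, 0 ≤ r ∧ x = polar OnePoint.infty r θ := by
  cases x with
  | dir v => exact Or.inr ⟨0, Complex.arg v, le_rfl, by rw [polar, if_pos le_rfl, Circle.exp_arg]⟩
  | point x hx =>
    induction x using OnePoint.rec with
    | infty => exact absurd rfl hx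
    | coe z =>
      by_cases hz : z = 0
      · left; subst hz; rw [ofPoint_of_ne hx]
      · right
        have hn : 0 < ‖z⁻¹‖ := norm_pos_iff.2 (inv_ne_zero hz)
        refine ⟨‖z⁻¹‖, Complex.arg z⁻¹, hn.le, ?_⟩
        rw [polar, if_neg (not_le.2 hn), Circle.coe_exp, Complex.norm_mul_exp_arg_mul_I,
          ← affPt_inv (inv_ne_zero hz), inv_inv, ofPoint_of_ne (affPt_ne _ _)]
        rfl

/-- Polar coordinates at the pole reach everything except the point `z = 0`, which alone goes to the
centre. Bijectivity thus reduces to monotonicity of radius and angle, with the angle taken modulo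
full turns. -/
theorem isOrientedDiffeo_standardFraming (hh : ContDiff ℝ (⊤ : ℕ∞) h) (hh' : ∀ θ, 0 < deriv h θ)
    (hper : ∀ θ, h (θ + 2 * Real.pi) = h θ + 2 * Real.pi) :
    IsOrientedDiffeo OnePoint.infty (standardFraming h) := by
  have hint : (fun u : ℂ => (standardFraming h (RealBlowup.ofPoint OnePoint.infty
      (affPt OnePoint.infty u)) : ℂ)) = affineFraming h := funext fun u => standardFraming_coe u
  have hpol : Set.EqOn (fun y : ℝ × ℝ => (standardFraming h (polar OnePoint.infty y.1 y.2) : ℂ))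
      (polarFraming h) {y | 0 ≤ y.1} := fun y hy => standardFraming_polar hper hy y.2
  have h0 : (standardFraming h (RealBlowup.ofPoint OnePoint.infty ((0 : ℂ) : OnePoint ℂ)) : ℂ) = 0 := by
    rw [standardFraming_coe, affineFraming, if_pos rfl]
  have hne : ∀ y, polarFraming h y ≠ 0 := fun y h0 => by
    have := norm_polarFraming (h := h) y
    rw [h0, norm_zero] at this
    exact (radius_pos y.1).ne this
  constructor
  · constructor
    · intro x x' hxx
      have hxx := congrArg (Subtype.val) hxx
      rcases exists_polar_or_zero x with rfl | ⟨r, θ, hr, rfl⟩ <;>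
        rcases exists_polar_or_zero x' with rfl | ⟨r', θ', hr', rfl⟩
      · rfl
      · rw [h0, standardFraming_polar hper hr'] at hxx
        exact absurd hxx.symm (hne _)
      · rw [h0, standardFraming_polar hper hr] at hxx
        exact absurd hxx (hne _)
      · rw [standardFraming_polar hper hr, standardFraming_polar hper hr'] at hxx
        obtain ⟨rfl, m, rfl⟩ := polarFraming_eq_iff hh hh' hper hxx
        exact polar_add_int _ _ _ _
    · intro d
      by_cases hd : (d : ℂ) = 0
      · exact ⟨_, Subtype.ext (h0.trans hd.symm)⟩
      · obtain ⟨r, θ, hr, he⟩ := exists_polarFraming_eq hh hper hd (mem_closedBall_zero_iff.1 d.2)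
        exact ⟨polar OnePoint.infty r θ, Subtype.ext ((standardFraming_polar hper hr θ).trans he)⟩
  · intro v
    change ‖polarFraming h (0, Complex.arg v)‖ = 1
    rw [norm_polarFraming, radius_zero]
  · rw [hint]; exact contDiff_affineFraming hh hper
  · intro u; rw [hint]; exact det₂_affineFraming hh hh' hper u
  · exact (contDiff_polarFraming hh).contDiffOn.congr hpol
  · intro y hy
    have huniq : UniqueDiffWithinAt ℝ {y : ℝ × ℝ | 0 ≤ y.1} y := by
      have hs : {y : ℝ × ℝ | 0 ≤ y.1} = Set.Ici 0 ×ˢ Set.univ := by ext; simp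
      rw [hs]
      exact ((uniqueDiffOn_Ici (0 : ℝ)).prod uniqueDiffOn_univ) y ⟨hy, trivial⟩
    rw [fderivWithin_congr hpol (hpol hy), fderivWithin_eq_fderiv huniq
      ((contDiff_polarFraming hh).differentiable (by simp) y)]
    exact det₂_polarFraming hh hh' y
end

/-! ### The quadratic differential of a polynomial -/

/-- At `∞` the coefficient is an analytic unit times `w ^ (-(n + 5))`; this factorization gives both
the normal form and the order of the pole. -/
theorem meromorphicNFAt_infty {n : ℕ} (a : Fin n → ℂ) :
    AnalyticAt ℂ (fun w : ℂ => 1 + ∑ i : Fin n, a i * w ^ (n + 1 - i)) 0 ∧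
    (1 + ∑ i : Fin n, a i * (0 : ℂ) ^ (n + 1 - i)) = 1 ∧
    ∀ w : ℂ, w ≠ 0 → (centredPoly a).eval w⁻¹ * (w⁻¹) ^ 4 =
      (1 + ∑ i : Fin n, a i * w ^ (n + 1 - i)) * w ^ (-((n : ℤ) + 5)) := by
  refine ⟨by fun_prop, ?_, fun w hw => ?_⟩
  · rw [add_eq_left]
    refine Finset.sum_eq_zero fun i _ => ?_
    rw [zero_pow (by have := i.2; omega), mul_zero]
  · have h1 : 1 + ∑ i : Fin n, a i * w ^ (n + 1 - i) = w ^ (n + 1) * (centredPoly a).eval w⁻¹ := by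
      rw [eval_centredPoly, mul_add, Finset.mul_sum]
      congr 1
      · rw [← mul_pow, mul_inv_cancel₀ hw, one_pow]
      · refine Finset.sum_congr rfl fun i _ => ?_
        have : w ^ (n + 1) = w ^ (n + 1 - i) * w ^ (i : ℕ) := by
          rw [← pow_add]; congr 1; have := i.2; omega
        rw [this, inv_pow]
        field_simp
    have h2 : w ^ (-((n : ℤ) + 5)) = (w ^ (n + 1))⁻¹ * (w⁻¹) ^ 4 := by
      rw [zpow_neg, inv_pow, ← mul_inv, ← pow_add, ← zpow_natCast]; congr 2
    rw [h1, h2]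
    have := pow_ne_zero (n + 1) hw
    field_simp

/-- The quadratic differential `P_a(z) dz²`. -/
def polyDifferential {n : ℕ} (a : Fin n → ℂ) : QuadraticDifferential where
  coeff z := (centredPoly a).eval z
  coeffInfty w := (centredPoly a).eval w⁻¹ * (w⁻¹) ^ 4
  meromorphic_coeff := AnalyticOnNhd.meromorphicNFOn fun z _ => by
    simp only [eval_centredPoly]; fun_prop
  meromorphic_coeffInfty := by
    obtain ⟨h1, h2, h3⟩ := meromorphicNFAt_infty a
    intro w _
    by_cases hw : w = 0
    · subst hw
      refine Or.inr ⟨-((n : ℤ) + 5), _, h1, by rw [h2]; exact one_ne_zero, ?_⟩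
      refine Filter.Eventually.of_forall fun w => ?_
      by_cases hw : w = 0
      · subst hw
        -- Normal form requires equality at the pole itself, where both sides are `0` by the
        -- conventions for inverses and negative powers of `0`.
        have : ((0 : ℂ) - 0) ^ (-((n : ℤ) + 5)) = 0 := by
          rw [sub_zero, zero_zpow]; omega
        simp only [Pi.smul_apply', Pi.pow_apply, this, zero_smul, inv_zero]
        simp
      · simp only [h3 w hw, Pi.smul_apply', Pi.pow_apply, sub_zero, smul_eq_mul]
        ring
    · refine AnalyticAt.meromorphicNFAt ?_
      simp only [eval_centredPoly]
      fun_prop (disch := assumption)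
  transform z hz := by rw [inv_inv]; field_simp

theorem localCoeff_polyDifferential {n : ℕ} (a : Fin n → ℂ) (u : ℂ) :
    (polyDifferential a).localCoeff OnePoint.infty u⁻¹ = (centredPoly a).eval u * u ^ 4 := by
  rw [QuadraticDifferential.localCoeff_infty]
  simp [polyDifferential]

theorem hasSimpleZerosAndPole_polyDifferential {n : ℕ} {a : Fin n → ℂ}
    (ha : a ∉ discriminantLocus n) :
    (polyDifferential a).HasSimpleZerosAndPole n OnePoint.infty := by
  constructor
  · obtain ⟨h1, h2, h3⟩ := meromorphicNFAt_infty a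
    rw [QuadraticDifferential.orderAt,
      meromorphicOrderAt_eq_int_iff (QuadraticDifferential.meromorphicAt_localCoeff _ _)]
    refine ⟨_, h1, by rw [h2]; exact one_ne_zero, ?_⟩
    filter_upwards [self_mem_nhdsWithin] with w hw
    rw [QuadraticDifferential.localCoeff_infty, polyDifferential]
    simp only
    rw [h3 w hw, sub_zero, smul_eq_mul, mul_comm]
  · intro q hq
    induction q using OnePoint.rec with
    | infty => exact absurd rfl hq
    | coe z =>
      rw [QuadraticDifferential.orderAt_coe]
      refine SimpleAt.order ⟨?_, fun h0 => ?_⟩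
      · simp only [polyDifferential, eval_centredPoly]; fun_prop
      · simp only [polyDifferential] at h0 ⊢
        rw [Polynomial.deriv]
        exact fun h1 => ha (mem_discriminantLocus_iff.2 ⟨z, h0, h1⟩)

/-- The exponents are negative because in the coordinate `1/z` the direction at `∞` of the ray
through `ζ` is `ζ⁻¹`. -/
theorem exists_eq_exp_of_pow_eq_one {N : ℕ} (hN : N ≠ 0) {v : Circle} (hv : (v : ℂ) ^ N = 1) :
    ∃ k : Fin N, v = Circle.exp (-(2 * Real.pi * (k : ℝ) / N)) := by
  have hp := Complex.isPrimitiveRoot_exp N hN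
  have : NeZero N := ⟨hN⟩
  obtain ⟨k, hk, he⟩ := hp.eq_pow_of_pow_eq_one (ξ := (v : ℂ)⁻¹) (by rw [inv_pow, hv, inv_one])
  refine ⟨⟨k, hk⟩, Circle.ext ?_⟩
  rw [Circle.coe_exp, ← inv_inv (v : ℂ), ← he, ← Complex.exp_nat_mul, ← Complex.exp_neg]
  congr 1
  push_cast
  ring

theorem exp_pow_eq_one {N : ℕ} (hN : N ≠ 0) (k : ℕ) :
    (Circle.exp (-(2 * Real.pi * (k : ℝ) / N)) : ℂ) ^ N = 1 := by
  have hN' : (N : ℂ) ≠ 0 := by exact_mod_cast hN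
  rw [Circle.coe_exp, ← Complex.exp_nat_mul, Complex.exp_eq_one_iff]
  refine ⟨-k, ?_⟩
  push_cast
  field_simp

theorem distinguishedDirections_polyDifferential {n : ℕ} (a : Fin n → ℂ) :
    (polyDifferential a).distinguishedDirections OnePoint.infty =
      {v : Circle | (v : ℂ) ^ (n + 3) = 1} := by
  ext v
  constructor
  · intro hv
    obtain ⟨r, hr, he⟩ := QuadraticDifferential.pow_pos_of_mem_distinguishedDirections
      (natDegree_centredPoly a) (fun u _ => localCoeff_polyDifferential a u) hv
    rw [coeff_centredPoly_succ, one_mul, inv_pow] at he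
    have hn := congrArg norm he
    rw [norm_inv, norm_pow, Circle.norm_coe, one_pow, inv_one, Complex.norm_real,
      Real.norm_of_nonneg hr.le] at hn
    rw [← hn, Complex.ofReal_one, inv_eq_one] at he
    exact he
  · intro hv
    exact QuadraticDifferential.mem_distinguishedDirections
      (fun u _ => localCoeff_polyDifferential a u) hv

/-- The distinguished directions at `∞` of `P_a(z) dz²` do not depend on `a`, so a single framing
serves every centred polynomial. Its boundary values come from a circle diffeomorphism interpolating
the labelling. -/
theorem exists_framing {n : ℕ} {M : Finset Circle} {f₀ : Fin (n + 3) → Circle}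
    (hf₀ : IsCyclicLabelling M f₀) :
    ∃ f : RealBlowup OnePoint.infty → Disk, IsOrientedDiffeo OnePoint.infty f ∧
      (∀ k : Fin (n + 3), f (RealBlowup.dir (Circle.exp (-(2 * Real.pi * (k : ℝ) / ((n : ℝ) + 3))))) =
        bdry (f₀ k)) ∧
      ∀ a : Fin n → ℂ, Set.BijOn (fun v => f (RealBlowup.dir v))
        ((polyDifferential a).distinguishedDirections OnePoint.infty) (bdry '' (M : Set Circle)) := by
  obtain ⟨⟨t, ht, ht2, hft⟩, hrange⟩ := hf₀
  obtain ⟨h, hh, hh', hper, hval⟩ := exists_circle_diffeo (Nat.succ_pos (n + 2)) ht ht2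
  have hdiff := isOrientedDiffeo_standardFraming hh hh' hper
  have hk : ∀ k : Fin (n + 3), standardFraming h
      (RealBlowup.dir (Circle.exp (-(2 * Real.pi * (k : ℝ) / ((n : ℝ) + 3))))) = bdry (f₀ k) := by
    intro k
    apply Subtype.ext
    rw [standardFraming_dir_exp hper, polarFraming, radius_zero, hft]
    have h1 : Real.smoothTransition (2 - 0 ^ 2) = 1 :=
      Real.smoothTransition.one_of_one_le (by norm_num)
    have h2 := hval k
    push_cast at h2
    have h3 : angle h (0, -(2 * Real.pi * (k : ℝ) / ((n : ℝ) + 3))) = t k := by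
      rw [angle, ← h2]
      simp only [h1, neg_neg]
      ring_nf
    rw [h3, Complex.ofReal_one, one_mul, bdry, Circle.coe_exp]
  refine ⟨standardFraming h, hdiff, hk, fun a => ?_⟩
  rw [distinguishedDirections_polyDifferential]
  have hcast : ((n + 3 : ℕ) : ℝ) = (n : ℝ) + 3 := by push_cast; ring
  refine ⟨?_, ?_, ?_⟩
  · intro v hv
    obtain ⟨k, rfl⟩ := exists_eq_exp_of_pow_eq_one (by omega) hv
    simp only [hcast, hk]
    exact ⟨f₀ k, by rw [← hrange]; exact ⟨k, rfl⟩, rfl⟩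
  · intro v _ v' _ he
    have := hdiff.bijective.1 he
    injection this
  · rintro _ ⟨m, hm, rfl⟩
    rw [← hrange] at hm
    obtain ⟨k, rfl⟩ := hm
    refine ⟨_, ?_, hk k⟩
    have := exp_pow_eq_one (N := n + 3) (by omega) k
    rwa [hcast] at this

/-- The framed differential `P_a(z) dz²` with a given framing of the blowup at `∞`. -/
def polyFramed {n : ℕ} {M : Finset Circle} (f : RealBlowup OnePoint.infty → Disk)
    (hf : IsOrientedDiffeo OnePoint.infty f)
    (hM : ∀ a : Fin n → ℂ, Set.BijOn (fun v => f (RealBlowup.dir v))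
      ((polyDifferential a).distinguishedDirections OnePoint.infty) (bdry '' (M : Set Circle)))
    (a : Fin n → ℂ) (ha : a ∉ discriminantLocus n) : FramedDifferential n M where
  diff := polyDifferential a
  pole := OnePoint.infty
  simple := hasSimpleZerosAndPole_polyDifferential ha
  framing := f
  diffeo := hf
  marked := hM a

/-! ### Directions -/

theorem coe_direction {c : ℂ} (hc : c ≠ 0) : (direction c : ℂ) = c / ‖c‖ := by
  have : (‖c‖ : ℂ) ≠ 0 := by exact_mod_cast norm_ne_zero_iff.2 hc
  rw [direction, Circle.coe_exp, eq_div_iff this, mul_comm, Complex.norm_mul_exp_arg_mul_I]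

theorem norm_mul_direction (c : ℂ) : (‖c‖ : ℂ) * direction c = c := by
  rw [direction, Circle.coe_exp, Complex.norm_mul_exp_arg_mul_I]

theorem direction_coe (v : Circle) : direction v = v := Circle.exp_arg v

theorem direction_ofReal_mul {r : ℝ} (hr : 0 < r) (c : ℂ) : direction (r * c) = direction c := by
  rw [direction, Complex.arg_real_mul _ hr, direction]

theorem direction_mul {a b : ℂ} (ha : a ≠ 0) (hb : b ≠ 0) :
    direction (a * b) = direction a * direction b := by
  apply Circle.ext
  rw [Circle.coe_mul, coe_direction ha, coe_direction hb, coe_direction (mul_ne_zero ha hb),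
    norm_mul]
  push_cast; field_simp

theorem direction_inv {a : ℂ} (ha : a ≠ 0) : direction a⁻¹ = (direction a)⁻¹ := by
  rw [eq_inv_iff_mul_eq_one, ← direction_mul (inv_ne_zero ha) ha, inv_mul_cancel₀ ha]
  exact direction_coe 1

theorem continuousAt_direction {c : ℂ} (hc : c ≠ 0) : ContinuousAt direction c := by
  have hind : Topology.IsInducing (fun v : Circle => (v : ℂ)) := ⟨rfl⟩
  rw [hind.continuousAt_iff]
  have h1 : ContinuousAt (fun c : ℂ => c / (‖c‖ : ℂ)) c := by
    refine continuousAt_id.div (by fun_prop) ?_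
    exact_mod_cast norm_ne_zero_iff.2 hc
  refine h1.congr ?_
  filter_upwards [isOpen_ne.mem_nhds hc] with z hz
  rw [Function.comp_apply, coe_direction hz]

/-! ### Isotopies of the disk -/

/-- A continuous strictly increasing map commuting with the translation by `2π` induces a
bijection of the circle. -/
theorem bijective_circle_of_lift {g : Circle → Circle} {ℓ : ℝ → ℝ} (hc : Continuous ℓ)
    (hm : StrictMono ℓ) (hper : ∀ θ, ℓ (θ + 2 * Real.pi) = ℓ θ + 2 * Real.pi)
    (hg : ∀ θ, g (Circle.exp θ) = Circle.exp (ℓ θ)) : Function.Bijective g := by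
  have hint : ∀ θ (m : ℤ), ℓ (θ + m * (2 * Real.pi)) = ℓ θ + m * (2 * Real.pi) := by
    intro θ m
    have hp : Function.Periodic (fun θ => ℓ θ - θ) (2 * Real.pi) := fun θ => by
      simp only [hper]; ring
    have := hp.int_mul m θ
    linarith
  constructor
  · intro y y' hy
    rw [← Circle.exp_arg y, ← Circle.exp_arg y', hg, hg] at hy
    obtain ⟨m, he⟩ := Circle.exp_eq_exp.1 hy
    rw [← hint] at he
    rw [← Circle.exp_arg y, ← Circle.exp_arg y']
    exact Circle.exp_eq_exp.2 ⟨m, hm.injective he⟩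
  · intro y
    obtain ⟨m, hm'⟩ := exists_nat_gt (|ℓ 0 - Complex.arg y| / (2 * Real.pi))
    rw [div_lt_iff₀ (by positivity)] at hm'
    obtain ⟨ha, hb⟩ := abs_lt.1 hm'
    have h1 := hint 0 (m : ℤ)
    have h2 := hint 0 (-(m : ℤ))
    obtain ⟨θ, hθ⟩ := mem_range_of_exists_le_of_exists_ge hc (c := Complex.arg y)
      ⟨_, by rw [h2]; push_cast; linarith⟩ ⟨_, by rw [h1]; push_cast; linarith⟩
    exact ⟨Circle.exp θ, by rw [hg, hθ, Circle.exp_arg]⟩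

/-- A lift is `θ + s k`, a convex combination of the increasing functions `θ` and `θ + k`. -/
theorem bijective_circle_interpolation {k : Circle → ℝ} (hk : Continuous k)
    (hm : StrictMono fun θ : ℝ => θ + k (Circle.exp θ)) {s : ℝ} (h0 : 0 ≤ s) (h1 : s ≤ 1) :
    Function.Bijective fun y : Circle => y * Circle.exp (s * k y) := by
  refine bijective_circle_of_lift (ℓ := fun θ => θ + s * k (Circle.exp θ)) (by fun_prop) ?_ ?_ ?_
  · intro a b hab
    have := hm hab
    simp only at this ⊢
    rcases h0.eq_or_lt with rfl | h0
    · simpa using hab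
    · nlinarith [mul_lt_mul_of_pos_left this h0]
  · intro θ
    have : Circle.exp (θ + 2 * Real.pi) = Circle.exp θ := Circle.exp_eq_exp.2 ⟨1, by simp⟩
    rw [this]; ring
  · intro θ
    rw [Circle.exp_add]

/-- The radial retraction of the plane onto the disk. -/
def diskRetraction (z : ℂ) : Disk :=
  ⟨((max 1 ‖z‖)⁻¹ : ℝ) * z, mem_closedBall_zero_iff.2 (by
    have h1 : 0 < max 1 ‖z‖ := lt_max_of_lt_left one_pos
    rw [norm_mul, Complex.norm_real, Real.norm_of_nonneg (by positivity), inv_mul_le_one₀ h1]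
    exact le_max_right _ _)⟩

theorem continuous_diskRetraction : Continuous diskRetraction := by
  refine Continuous.subtype_mk ?_ _
  refine (Complex.continuous_ofReal.comp ?_).mul continuous_id
  refine Continuous.inv₀ (by fun_prop) fun z => ?_
  exact (lt_max_of_lt_left one_pos).ne'

theorem diskRetraction_of_le {z : ℂ} (hz : ‖z‖ ≤ 1) : (diskRetraction z : ℂ) = z := by
  simp [diskRetraction, hz]

/-! ### The Alexander trick with a moving boundary -/

section
variable (K : Disk → Disk) (k : Circle → ℝ)

/-- The inner part of the isotopy (the Alexander trick). -/
def innerIsotopy (y : ℝ × ℂ) : ℂ := y.1 * (K (diskRetraction (y.2 / y.1)) : ℂ)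

/-- The outer part of the isotopy. -/
def outerIsotopy (y : ℝ × ℂ) : ℂ :=
  y.2 * Complex.exp ((y.1 / ‖y.2‖ * k (direction y.2) : ℝ) * Complex.I)

variable {K k}

theorem norm_innerIsotopy_le (y : ℝ × ℂ) : ‖innerIsotopy K y‖ ≤ |y.1| := by
  rw [innerIsotopy, norm_mul, Complex.norm_real, Real.norm_eq_abs]
  exact mul_le_of_le_one_right (abs_nonneg _) (mem_closedBall_zero_iff.1 (K _).2)

theorem norm_outerIsotopy (y : ℝ × ℂ) : ‖outerIsotopy k y‖ = ‖y.2‖ := by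
  rw [outerIsotopy, norm_mul, Complex.norm_exp_ofReal_mul_I, mul_one]

/-- At time `0` the rescaled argument has no limit, but the factor `y.1` bounds the norm and forces
continuity. -/
theorem continuous_innerIsotopy (hK : Continuous K) : Continuous (innerIsotopy K) := by
  rw [continuous_iff_continuousAt]
  intro y
  by_cases hy : y.1 = 0
  · have h0 : innerIsotopy K y = 0 := by simp [innerIsotopy, hy]
    rw [ContinuousAt, h0]
    refine squeeze_zero_norm norm_innerIsotopy_le ?_
    have : Continuous fun y : ℝ × ℂ => |y.1| := by fun_prop
    simpa [hy] using this.tendsto y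
  · have h1 : ContinuousAt (fun y : ℝ × ℂ => y.2 / (y.1 : ℂ)) y :=
      continuousAt_snd.div (by fun_prop) (by exact_mod_cast hy)
    have h2 : Continuous fun z => (K (diskRetraction z) : ℂ) :=
      continuous_subtype_val.comp (hK.comp continuous_diskRetraction)
    exact (Complex.continuous_ofReal.continuousAt.comp continuousAt_fst).mul
      (h2.continuousAt.comp h1)

/-- At the origin the direction and the quotient take default values; continuity survives because
the map preserves norms. -/
theorem continuous_outerIsotopy (hk : Continuous k) : Continuous (outerIsotopy k) := by
  rw [continuous_iff_continuousAt]
  intro y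
  by_cases hy : y.2 = 0
  · have h0 : outerIsotopy k y = 0 := by simp [outerIsotopy, hy]
    rw [ContinuousAt, h0]
    refine squeeze_zero_norm (fun y => (norm_outerIsotopy y).le) ?_
    have : Continuous fun y : ℝ × ℂ => ‖y.2‖ := by fun_prop
    simpa [hy] using this.tendsto y
  · have h1 : ContinuousAt (fun y : ℝ × ℂ => k (direction y.2)) y :=
      hk.continuousAt.comp ((continuousAt_direction hy).comp continuousAt_snd)
    have h2 : ContinuousAt (fun y : ℝ × ℂ => y.1 / ‖y.2‖) y :=
      continuousAt_fst.div (by fun_prop) (norm_ne_zero_iff.2 hy)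
    exact continuousAt_snd.mul (Complex.continuous_exp.continuousAt.comp
      ((Complex.continuous_ofReal.continuousAt.comp (h2.mul h1)).mul continuousAt_const))

theorem outerIsotopy_eq (t : ℝ) (x : ℂ) :
    outerIsotopy k (t, x) =
      ‖x‖ * ((direction x * Circle.exp (t / ‖x‖ * k (direction x)) : Circle) : ℂ) := by
  rw [outerIsotopy, Circle.coe_mul, ← mul_assoc, norm_mul_direction, Circle.coe_exp]

/-- The circle of radius `t` is the rescaled boundary circle of the inner copy of `K`, and there the
outer rotation has factor `t / ‖x‖ = 1`. -/
theorem innerIsotopy_eq_outerIsotopy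
    (hK : ∀ y : Circle, K (bdry y) = bdry (y * Circle.exp (k y))) {t : ℝ} {x : ℂ} (h : ‖x‖ = t) :
    innerIsotopy K (t, x) = outerIsotopy k (t, x) := by
  by_cases hx : x = 0
  · subst hx
    have : t = 0 := by rw [← h, norm_zero]
    simp [innerIsotopy, outerIsotopy, this]
  · have ht : t ≠ 0 := by rw [← h]; exact norm_ne_zero_iff.2 hx
    have h1 : diskRetraction (x / t) = bdry (direction x) := by
      apply Subtype.ext
      rw [diskRetraction_of_le, bdry, coe_direction hx, h]
      rw [norm_div, h, Complex.norm_real, Real.norm_eq_abs, ← h, abs_norm]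
      exact div_self_le_one _
    rw [outerIsotopy_eq, innerIsotopy, h1, hK, h, div_self ht, one_mul]
    rfl

variable (K k) in
open Classical in
/-- The isotopy from the identity to `K`. -/
def diskIsotopy (y : ℝ × ℂ) : ℂ := if ‖y.2‖ ≤ y.1 then innerIsotopy K y else outerIsotopy k y

theorem continuous_diskIsotopy (hKc : Continuous K) (hk : Continuous k)
    (hK : ∀ y : Circle, K (bdry y) = bdry (y * Circle.exp (k y))) :
    Continuous (diskIsotopy K k) := by
  have := continuous_if_le (f := fun y : ℝ × ℂ => ‖y.2‖) (g := fun y : ℝ × ℂ => y.1)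
    (by fun_prop) (by fun_prop) (continuous_innerIsotopy hKc).continuousOn
    (continuous_outerIsotopy hk).continuousOn (fun y hy => innerIsotopy_eq_outerIsotopy hK hy)
  refine this.congr fun y => ?_
  rw [diskIsotopy]

theorem norm_diskIsotopy_le {t : ℝ} (ht : t ∈ unitInterval) {x : ℂ} (hx : ‖x‖ ≤ 1) :
    ‖diskIsotopy K k (t, x)‖ ≤ 1 := by
  rw [diskIsotopy]
  split_ifs with h
  · exact (norm_innerIsotopy_le _).trans (by rw [abs_of_nonneg ht.1]; exact ht.2)
  · rw [norm_outerIsotopy]; exact hx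

theorem innerIsotopy_eq {t : ℝ} (ht : 0 < t) {x : ℂ} (hx : ‖x‖ ≤ t) (z : Disk)
    (hz : x / t = z) : innerIsotopy K (t, x) = t * K z := by
  have : diskRetraction (x / t) = z := by
    apply Subtype.ext
    rw [diskRetraction_of_le, hz]
    rw [norm_div, Complex.norm_real, Real.norm_of_nonneg ht.le, div_le_one ht]
    exact hx
  rw [innerIsotopy, this]

theorem div_mem_disk {t : ℝ} (ht : 0 < t) {x : ℂ} (hx : ‖x‖ ≤ t) :
    x / t ∈ Metric.closedBall (0 : ℂ) 1 := by
  rw [mem_closedBall_zero_iff, norm_div, Complex.norm_real, Real.norm_of_nonneg ht.le,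
    div_le_one ht]
  exact hx

/-- The disk of radius `t` carries a scaled copy of `K`, and each larger circle is mapped to itself
with displacement `(t / ‖x‖) k`. Both families preserve norm ranges, so bijectivity can be checked
on each; for `t = 0` the inner disk is a point. -/
theorem bijective_diskIsotopy (hKb : Function.Bijective K) (hk : Continuous k)
    (hm : StrictMono fun θ : ℝ => θ + k (Circle.exp θ)) (t : unitInterval) :
    Function.Bijective fun x : Disk => (⟨diskIsotopy K k (t, x), mem_closedBall_zero_iff.2
      (norm_diskIsotopy_le t.2 (mem_closedBall_zero_iff.1 x.2))⟩ : Disk) := by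
  have ht0 : 0 ≤ (t : ℝ) := t.2.1
  have hin : ∀ x : ℂ, ‖x‖ ≤ t → ‖diskIsotopy K k (t, x)‖ ≤ t := fun x hx => by
    rw [diskIsotopy, if_pos hx]
    exact (norm_innerIsotopy_le _).trans (by rw [abs_of_nonneg ht0])
  have hout : ∀ x : ℂ, (t : ℝ) < ‖x‖ → ‖diskIsotopy K k (t, x)‖ = ‖x‖ := fun x hx => by
    rw [diskIsotopy, if_neg (not_le.2 hx), norm_outerIsotopy]
  have hs : ∀ x : ℂ, (t : ℝ) < ‖x‖ → 0 ≤ (t : ℝ) / ‖x‖ ∧ (t : ℝ) / ‖x‖ ≤ 1 := fun x hx =>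
    ⟨div_nonneg ht0 (norm_nonneg _), div_le_one_of_le₀ hx.le (norm_nonneg _)⟩
  constructor
  · intro x x' he
    have he : diskIsotopy K k (t, x) = diskIsotopy K k (t, x') := congrArg Subtype.val he
    apply Subtype.ext
    rcases le_or_gt ‖(x : ℂ)‖ t with hx | hx <;> rcases le_or_gt ‖(x' : ℂ)‖ t with hx' | hx'
    · rcases ht0.eq_or_lt with h0 | h0
      · rw [← h0] at hx hx'
        rw [norm_le_zero_iff.1 hx, norm_le_zero_iff.1 hx']
      · have htc : ((t : ℝ) : ℂ) ≠ 0 := by exact_mod_cast h0.ne'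
        rw [diskIsotopy, diskIsotopy, if_pos hx, if_pos hx',
          innerIsotopy_eq h0 hx ⟨_, div_mem_disk h0 hx⟩ rfl,
          innerIsotopy_eq h0 hx' ⟨_, div_mem_disk h0 hx'⟩ rfl] at he
        have := hKb.1 (Subtype.ext (mul_left_cancel₀ htc he))
        have := congrArg Subtype.val this
        simpa [div_left_inj' htc] using this
    · have := hin _ hx; rw [he, hout _ hx'] at this; exact absurd this (not_le.2 hx')
    · have := hin _ hx'; rw [← he, hout _ hx] at this; exact absurd this (not_le.2 hx)
    · have hn : ‖(x : ℂ)‖ = ‖(x' : ℂ)‖ := by rw [← hout _ hx, he, hout _ hx']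
      have hx0 : (x : ℂ) ≠ 0 := norm_pos_iff.1 (ht0.trans_lt hx)
      have hx0' : (x' : ℂ) ≠ 0 := norm_pos_iff.1 (ht0.trans_lt hx')
      have hnc : (‖(x' : ℂ)‖ : ℂ) ≠ 0 := by exact_mod_cast norm_ne_zero_iff.2 hx0'
      rw [diskIsotopy, diskIsotopy, if_neg (not_le.2 hx), if_neg (not_le.2 hx'),
        outerIsotopy_eq, outerIsotopy_eq, hn] at he
      have h1 := Circle.ext (mul_left_cancel₀ hnc he)
      have h2 := (bijective_circle_interpolation hk hm (hs _ hx').1 (hs _ hx').2).1 h1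
      rw [← norm_mul_direction (x : ℂ), h2, hn, norm_mul_direction]
  · intro d
    rcases le_or_gt ‖(d : ℂ)‖ t with hd | hd
    · rcases ht0.eq_or_lt with h0 | h0
      · refine ⟨d, Subtype.ext ?_⟩
        have hd0 : (d : ℂ) = 0 := norm_le_zero_iff.1 (by rw [h0]; exact hd)
        simp [diskIsotopy, hd0, ← h0, innerIsotopy]
      · have htc : ((t : ℝ) : ℂ) ≠ 0 := by exact_mod_cast h0.ne'
        obtain ⟨z, hz⟩ := hKb.2 ⟨_, div_mem_disk h0 hd⟩
        have hz1 := mem_closedBall_zero_iff.1 z.2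
        have hn : ‖((t : ℝ) : ℂ) * (z : ℂ)‖ ≤ t := by
          rw [norm_mul, Complex.norm_real, Real.norm_of_nonneg ht0]
          exact mul_le_of_le_one_right ht0 hz1
        refine ⟨⟨t * z, mem_closedBall_zero_iff.2 (hn.trans t.2.2)⟩, Subtype.ext ?_⟩
        simp only
        rw [diskIsotopy, if_pos hn, innerIsotopy_eq h0 hn z (by field_simp), hz]
        simp only
        field_simp
    · have hd0 : (d : ℂ) ≠ 0 := norm_pos_iff.1 (ht0.trans_lt hd)
      obtain ⟨y, hy⟩ := (bijective_circle_interpolation hk hm (hs _ hd).1 (hs _ hd).2).2 (direction d)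
      have hn : ‖(‖(d : ℂ)‖ : ℂ) * (y : ℂ)‖ = ‖(d : ℂ)‖ := by
        rw [norm_mul, Circle.norm_coe, mul_one, Complex.norm_real, norm_norm]
      have hne : (‖(d : ℂ)‖ : ℂ) * (y : ℂ) ≠ 0 := norm_ne_zero_iff.1 (by
        rw [hn]; exact norm_ne_zero_iff.2 hd0)
      refine ⟨⟨‖(d : ℂ)‖ * y, mem_closedBall_zero_iff.2 (by
        rw [hn]; exact mem_closedBall_zero_iff.1 d.2)⟩, Subtype.ext ?_⟩
      simp only
      rw [diskIsotopy, if_neg (not_le.2 (by rw [hn]; exact hd)), outerIsotopy_eq, hn,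
        direction_ofReal_mul (norm_pos_iff.2 hd0), direction_coe]
      simp only at hy
      rw [hy, norm_mul_direction]

/-- A homeomorphism of the disk which preserves the orientation of the boundary and fixes marked
points (in the sense of the lift `k`) is isotopic to the identity relative to the marked points. -/
theorem exists_isotopy (M : Finset Circle) (hKc : Continuous K) (hKb : Function.Bijective K)
    (hk : Continuous k) (hK : ∀ y : Circle, K (bdry y) = bdry (y * Circle.exp (k y)))
    (hm : StrictMono fun θ : ℝ => θ + k (Circle.exp θ)) (hM : ∀ m ∈ M, k m = 0) :
    ∃ H : unitInterval → (Disk ≃ₜ Disk),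
      Continuous (fun y : unitInterval × Disk => H y.1 y.2) ∧ (∀ x, H 0 x = x) ∧
      (∀ t, ∀ m ∈ M, H t (bdry m) = bdry m) ∧ ∀ x, H 1 x = K x := by
  have hcont : Continuous fun y : unitInterval × Disk =>
      (⟨diskIsotopy K k (y.1, y.2), mem_closedBall_zero_iff.2
      (norm_diskIsotopy_le y.1.2 (mem_closedBall_zero_iff.1 y.2.2))⟩ : Disk) :=
    Continuous.subtype_mk ((continuous_diskIsotopy hKc hk hK).comp (by fun_prop)) _
  have : CompactSpace Disk := isCompact_iff_compactSpace.1 (isCompact_closedBall _ _)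
  have hct : ∀ t : unitInterval, Continuous (Equiv.ofBijective _
      (bijective_diskIsotopy hKb hk hm t)) := fun t =>
    hcont.comp (Continuous.prodMk continuous_const continuous_id)
  refine ⟨fun t => (hct t).homeoOfEquivCompactToT2, hcont, ?_, ?_, ?_⟩
  · intro x
    apply Subtype.ext
    change diskIsotopy K k ((0 : ℝ), (x : ℂ)) = x
    rw [diskIsotopy]
    split_ifs with h
    · have : (x : ℂ) = 0 := norm_le_zero_iff.1 h
      simp [innerIsotopy, this]
    · simp [outerIsotopy]
  · intro t m hm'
    apply Subtype.ext
    change diskIsotopy K k ((t : ℝ), (m : ℂ)) = m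
    -- Zero displacement at marked points makes the outer formula fix them; the inner formula
    -- concerns the boundary only at `t = 1`, where the two agree.
    have h1 : outerIsotopy k ((t : ℝ), (m : ℂ)) = m := by
      simp [outerIsotopy, direction_coe, hM m hm']
    rw [diskIsotopy]
    split_ifs with h
    · rw [innerIsotopy_eq_outerIsotopy hK, h1]
      exact le_antisymm h (by rw [Circle.norm_coe]; exact t.2.2)
    · exact h1
  · intro x
    apply Subtype.ext
    change diskIsotopy K k ((1 : ℝ), (x : ℂ)) = K x
    have hx := mem_closedBall_zero_iff.1 x.2
    rw [diskIsotopy, if_pos hx, innerIsotopy_eq one_pos hx x (by simp)]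
    simp
end

/-! ### Boundary values of framings -/

theorem nonpos_of_hasDerivWithinAt_Ici {φ : ℝ → ℝ} {d : ℝ} (h : HasDerivWithinAt φ d (Set.Ici 0) 0)
    (hle : ∀ r, 0 ≤ r → φ r ≤ φ 0) : d ≤ 0 := by
  rw [hasDerivWithinAt_iff_tendsto_slope, show Set.Ici (0 : ℝ) \ {0} = Set.Ioi 0 by simp] at h
  refine le_of_tendsto h ?_
  filter_upwards [self_mem_nhdsWithin] with r hr
  have hr : 0 < r := hr
  rw [slope_def_field, sub_zero]
  exact div_nonpos_of_nonpos_of_nonneg (sub_nonpos.2 (hle r hr.le)) hr.le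

theorem polar_zero (p : OnePoint ℂ) (θ : ℝ) : polar p 0 θ = RealBlowup.dir (Circle.exp θ) := by
  rw [polar, if_pos le_rfl]

section
variable {p : OnePoint ℂ} {f : RealBlowup p → Disk}

/-- Since `f` takes values in the disk and the boundary goes to the unit circle, the `θ`-derivative
is tangent and the `r`-derivative does not point outwards. A positive Jacobian then forces the
tangential speed to be negative: the circle of directions at the pole, counterclockwise in the local
coordinate, is clockwise as a boundary. -/
theorem IsOrientedDiffeo.boundary_deriv (hf : IsOrientedDiffeo p f) :
    ∃ B : ℝ → ℂ, (∀ θ, B θ = f (RealBlowup.dir (Circle.exp θ))) ∧ ContDiff ℝ (⊤ : ℕ∞) B ∧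
      ∀ θ, (deriv B θ * (starRingEnd ℂ) (B θ)).re = 0 ∧
        (deriv B θ * (starRingEnd ℂ) (B θ)).im < 0 := by
  set g : ℝ × ℝ → ℂ := fun y => (f (polar p y.1 y.2) : ℂ) with hg
  set S : Set (ℝ × ℝ) := {y | 0 ≤ y.1} with hS
  set B : ℝ → ℂ := fun θ => g (0, θ) with hB
  have hBf : ∀ θ, B θ = f (RealBlowup.dir (Circle.exp θ)) := fun θ => by
    rw [hB, hg]; simp only [polar_zero]
  have hBn : ∀ θ, ‖B θ‖ = 1 := fun θ => by rw [hBf]; exact hf.boundary _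
  have hmaps : ∀ θ : ℝ, ((0 : ℝ), θ) ∈ S := fun θ => le_refl (0 : ℝ)
  have hBd : ContDiff ℝ (⊤ : ℕ∞) B := by
    rw [← contDiffOn_univ]
    exact hf.smooth_boundary.comp (t := S) (contDiff_const.prodMk contDiff_id).contDiffOn
      (fun θ _ => hmaps θ)
  refine ⟨B, hBf, hBd, fun θ => ?_⟩
  have hgd : HasFDerivWithinAt g (fderivWithin ℝ g S (0, θ)) S (0, θ) :=
    (hf.smooth_boundary.differentiableOn (by simp) _ (hmaps θ)).hasFDerivWithinAt
  have hBder : HasDerivAt B (deriv B θ) θ := (hBd.differentiable (by simp) θ).hasDerivAt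
  have e2 : fderivWithin ℝ g S (0, θ) (0, 1) = deriv B θ := by
    have hc : HasDerivWithinAt (fun s : ℝ => ((0 : ℝ), s)) ((0 : ℝ), (1 : ℝ)) Set.univ θ :=
      ((hasDerivAt_const θ (0 : ℝ)).prodMk (hasDerivAt_id θ)).hasDerivWithinAt
    have := hgd.comp_hasDerivWithinAt θ hc (fun s _ => hmaps s)
    rw [hasDerivWithinAt_univ] at this
    exact this.unique hBder
  have e1 : HasDerivWithinAt (fun r => g (r, θ)) (fderivWithin ℝ g S (0, θ) (1, 0)) (Set.Ici 0) 0 := by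
    have hc : HasDerivWithinAt (fun s : ℝ => (s, θ)) ((1 : ℝ), (0 : ℝ)) (Set.Ici 0) 0 :=
      ((hasDerivAt_id (0 : ℝ)).prodMk (hasDerivAt_const (0 : ℝ) θ)).hasDerivWithinAt
    exact hgd.comp_hasDerivWithinAt (0 : ℝ) hc (fun s hs => hs)
  have hjac := hf.jacobian_boundary (0, θ) le_rfl
  change 0 < det₂ (fderivWithin ℝ g S (0, θ) (1, 0)) (fderivWithin ℝ g S (0, θ) (0, 1)) at hjac
  rw [e2] at hjac
  set a := fderivWithin ℝ g S (0, θ) (1, 0) with ha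
  set b := deriv B θ with hb
  have hre : (b * (starRingEnd ℂ) (B θ)).re = 0 := by
    have h1 : HasDerivAt (fun θ => (B θ).re ^ 2 + (B θ).im ^ 2)
        (2 * (B θ).re ^ (2 - 1) * b.re + 2 * (B θ).im ^ (2 - 1) * b.im) θ :=
      HasDerivAt.add
        ((Complex.reCLM.hasFDerivAt.comp_hasDerivAt θ hBder :
          HasDerivAt (fun t => (B t).re) b.re θ).pow 2)
        ((Complex.imCLM.hasFDerivAt.comp_hasDerivAt θ hBder :
          HasDerivAt (fun t => (B t).im) b.im θ).pow 2)
    have h2 : (fun θ => (B θ).re ^ 2 + (B θ).im ^ 2) = fun _ => 1 := by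
      funext θ
      have h3 := Complex.sq_norm (B θ)
      rw [hBn, Complex.normSq_apply] at h3
      linarith
    rw [h2] at h1
    have h4 := h1.unique (hasDerivAt_const θ (1 : ℝ))
    simp only [Complex.mul_re, Complex.conj_re, Complex.conj_im]
    norm_num at h4
    linarith
  refine ⟨hre, ?_⟩
  have hle : (a * (starRingEnd ℂ) (B θ)).re ≤ 0 := by
    have h1 : HasDerivWithinAt (fun r => (g (r, θ) * (starRingEnd ℂ) (B θ)).re)
        (a * (starRingEnd ℂ) (B θ)).re (Set.Ici 0) 0 :=
      Complex.reCLM.hasFDerivAt.comp_hasDerivWithinAt 0 (e1.mul_const _)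
    refine nonpos_of_hasDerivWithinAt_Ici h1 fun r _ => ?_
    have h2 : (g (0, θ) * (starRingEnd ℂ) (B θ)).re = 1 := by
      change (B θ * _).re = 1
      rw [Complex.mul_conj, Complex.normSq_eq_norm_sq, hBn]; simp
    rw [h2]
    refine (Complex.re_le_norm _).trans ?_
    rw [norm_mul, Complex.norm_conj, hBn, mul_one]
    exact mem_closedBall_zero_iff.1 (f _).2
  have hB1 : (B θ).re * (B θ).re + (B θ).im * (B θ).im = 1 := by
    have h3 := Complex.sq_norm (B θ)
    rw [hBn, Complex.normSq_apply] at h3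
    linarith
  simp only [Complex.mul_re, Complex.mul_im, Complex.conj_re, Complex.conj_im, det₂] at *
  -- With `b = i l B`, the determinant becomes `l` times the real part of `a` times the conjugate of
  -- `B`, and that real part is at most `0`.
  set l := b.re * -(B θ).im + b.im * (B θ).re with hl
  have hb1 : b.re = -l * (B θ).im := by
    have : b.re = b.re * ((B θ).re * (B θ).re + (B θ).im * (B θ).im) := by rw [hB1, mul_one]
    rw [this, hl]
    linear_combination (B θ).re * hre
  have hb2 : b.im = l * (B θ).re := by
    have : b.im = b.im * ((B θ).re * (B θ).re + (B θ).im * (B θ).im) := by rw [hB1, mul_one]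
    rw [this, hl]
    linear_combination (B θ).im * hre
  rw [hb1, hb2] at hjac
  by_contra hge
  push Not at hge
  nlinarith

/-- Integrating the tangential speed gives a continuous angle function. It is monotone, and
injectivity of the framing forces winding number exactly one. The sign of `θ` is reversed to make
the lift increasing. -/
theorem IsOrientedDiffeo.exists_boundary_lift (hf : IsOrientedDiffeo p f) :
    ∃ ℓ : ℝ → ℝ, Continuous ℓ ∧ StrictMono ℓ ∧ (∀ θ, ℓ (θ + 2 * Real.pi) = ℓ θ + 2 * Real.pi) ∧
      ∀ θ, f (RealBlowup.dir (Circle.exp (-θ))) = bdry (Circle.exp (ℓ θ)) := by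
  obtain ⟨B, hBf, hBd, hder⟩ := hf.boundary_deriv
  have hBn : ∀ θ, ‖B θ‖ = 1 := fun θ => by rw [hBf]; exact hf.boundary _
  set l : ℝ → ℝ := fun θ => (deriv B θ * (starRingEnd ℂ) (B θ)).im with hl
  have hlc : Continuous l := Complex.continuous_im.comp
    ((hBd.continuous_deriv (by simp)).mul (Complex.continuous_conj.comp hBd.continuous))
  set ℓ₀ : ℝ → ℝ := fun θ => Complex.arg (B 0) + ∫ s in (0 : ℝ)..θ, l s with hℓ₀
  have hℓd : ∀ θ, HasDerivAt ℓ₀ (l θ) θ := fun θ =>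
    (hlc.integral_hasStrictDerivAt 0 θ).hasDerivAt.const_add _
  have hBder : ∀ θ, HasDerivAt B (Complex.I * l θ * B θ) θ := fun θ => by
    refine ((hBd.differentiable (by simp) θ).hasDerivAt).congr_deriv ?_
    have h1 : deriv B θ * (starRingEnd ℂ) (B θ) = Complex.I * l θ := by
      apply Complex.ext
      · simp [(hder θ).1]
      · simp [hl]
    rw [← h1, mul_assoc, mul_comm ((starRingEnd ℂ) (B θ)), Complex.mul_conj,
      Complex.normSq_eq_norm_sq, hBn]
    simp
  have hconst : ∀ θ, B θ * Complex.exp (-(ℓ₀ θ * Complex.I)) = 1 := by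
    have hd : ∀ θ, HasDerivAt (fun θ => B θ * Complex.exp (-(ℓ₀ θ * Complex.I))) 0 θ := fun θ => by
      refine ((hBder θ).mul (((hℓd θ).ofReal_comp.mul_const Complex.I).neg.cexp)).congr_deriv ?_
      ring
    intro θ
    rw [is_const_of_deriv_eq_zero (fun θ => (hd θ).differentiableAt) (fun θ => (hd θ).deriv) θ 0]
    have h0 : ℓ₀ 0 = Complex.arg (B 0) := by simp [hℓ₀]
    rw [h0]
    have := Complex.norm_mul_exp_arg_mul_I (B 0)
    rw [hBn, Complex.ofReal_one, one_mul] at this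
    nth_rewrite 1 [← this]
    rw [← Complex.exp_add, add_neg_cancel, Complex.exp_zero]
  have hexp : ∀ θ, f (RealBlowup.dir (Circle.exp θ)) = bdry (Circle.exp (ℓ₀ θ)) := fun θ => by
    apply Subtype.ext
    rw [← hBf, bdry, Circle.coe_exp]
    have := hconst θ
    rw [Complex.exp_neg] at this
    exact eq_of_mul_inv_eq_one this
  have hanti : StrictAnti ℓ₀ := strictAnti_of_deriv_neg fun θ => by
    rw [(hℓd θ).deriv]; exact (hder θ).2
  have hcont : Continuous ℓ₀ := continuous_iff_continuousAt.2 fun θ => (hℓd θ).continuousAt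
  have hmono : StrictMono fun θ => ℓ₀ (-θ) := fun a b hab => hanti (neg_lt_neg hab)
  have hc' : Continuous fun θ => ℓ₀ (-θ) := hcont.comp continuous_neg
  refine ⟨fun θ => ℓ₀ (-θ), hc', hmono, fun θ => ?_, fun θ => hexp _⟩
  have hpi := Real.pi_pos
  have hinj : ∀ a b, Circle.exp (ℓ₀ (-a)) = Circle.exp (ℓ₀ (-b)) →
      Circle.exp (-a) = Circle.exp (-b) := fun a b hab => by
    have := hf.bijective.1 (((hexp (-a)).trans (by rw [hab])).trans (hexp (-b)).symm)
    injection this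
  have h1 : Circle.exp (ℓ₀ (-(θ + 2 * Real.pi))) = Circle.exp (ℓ₀ (-θ)) := by
    have h2 : Circle.exp (-(θ + 2 * Real.pi)) = Circle.exp (-θ) :=
      Circle.exp_eq_exp.2 ⟨-1, by push_cast; ring⟩
    have h3 : bdry (Circle.exp (ℓ₀ (-(θ + 2 * Real.pi)))) = bdry (Circle.exp (ℓ₀ (-θ))) := by
      rw [← hexp, ← hexp, h2]
    exact Circle.ext (congrArg (fun x : Disk => (x : ℂ)) h3)
  obtain ⟨m, hm⟩ := Circle.exp_eq_exp.1 h1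
  have hlt := hmono (lt_add_of_pos_right θ (by positivity : (0 : ℝ) < 2 * Real.pi))
  simp only at hlt
  have hm1 : 1 ≤ m := by
    by_contra! hlt'
    have : (m : ℝ) ≤ 0 := by exact_mod_cast (by omega : m ≤ 0)
    nlinarith
  -- If the lift gained two or more turns over a period, it would gain exactly one turn strictly
  -- inside it, and two distinct directions would have the same image.
  rcases hm1.eq_or_lt with rfl | hm2
  · simpa using hm
  · exfalso
    have hm2' : (2 : ℝ) ≤ m := by exact_mod_cast hm2
    have hmem : ℓ₀ (-θ) + 2 * Real.pi ∈ Set.Icc (ℓ₀ (-θ)) (ℓ₀ (-(θ + 2 * Real.pi))) :=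
      ⟨by linarith, by rw [hm]; nlinarith⟩
    obtain ⟨θ', hθ', he⟩ := intermediate_value_Icc (by linarith : θ ≤ θ + 2 * Real.pi)
      hc'.continuousOn hmem
    simp only at he
    have h4 := hinj θ' θ (Circle.exp_eq_exp.2 ⟨1, by rw [he]; simp⟩)
    obtain ⟨j, hj⟩ := Circle.exp_eq_exp.1 h4
    have hne1 : θ ≠ θ' := fun h => by rw [← h] at he; linarith
    have hne2 : θ' ≠ θ + 2 * Real.pi := fun h => by
      rw [h, hm] at he; nlinarith
    have h5 : θ < θ' := lt_of_le_of_ne hθ'.1 hne1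
    have h6 : θ' < θ + 2 * Real.pi := lt_of_le_of_ne hθ'.2 hne2
    have h7 : θ' - θ = (-j : ℤ) * (2 * Real.pi) := by push_cast; linarith
    have h8 : (0 : ℝ) < (-j : ℤ) := by
      by_contra! h; nlinarith
    have h9 : ((-j : ℤ) : ℝ) < 1 := by
      by_contra! h; nlinarith
    have h8' : 0 < -j := by exact_mod_cast h8
    have h9' : -j < 1 := by exact_mod_cast h9
    omega
end

/-! ### Cyclic labellings -/

theorem exp_injOn {x y c : ℝ} (h : Circle.exp x = Circle.exp y) (hx : x ∈ Set.Ico c (c + 2 * Real.pi))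
    (hy : y ∈ Set.Ico c (c + 2 * Real.pi)) : x = y := by
  obtain ⟨m, hm⟩ := Circle.exp_eq_exp.1 h
  have hpi := Real.pi_pos
  have h1 : (m : ℝ) < 1 := by
    by_contra! h1; have := hx.2; have := hy.1; nlinarith
  have h2 : (-1 : ℝ) < m := by
    by_contra! h1; have := hx.1; have := hy.2; nlinarith
  have h1' : m < 1 := by exact_mod_cast h1
  have h2' : -1 < m := by exact_mod_cast h2
  have : m = 0 := by omega
  rw [hm, this]; simp

theorem exists_cyclicLabelling {n : ℕ} {M : Finset Circle} (hM : M.card = n + 3) :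
    ∃ f₀ : Fin (n + 3) → Circle, IsCyclicLabelling M f₀ := by
  have hinj : Function.Injective fun v : Circle => Complex.arg v := Circle.injective_arg
  have hcard : (M.image fun v : Circle => Complex.arg v).card = n + 3 := by
    rw [Finset.card_image_of_injective _ hinj, hM]
  set e := (M.image fun v : Circle => Complex.arg v).orderEmbOfFin hcard
  have hmem : ∀ k, ∃ v ∈ M, Complex.arg (v : Circle) = e k := fun k => by
    have := Finset.orderEmbOfFin_mem _ hcard k
    rwa [Finset.mem_image] at this
  refine ⟨fun k => Circle.exp (e k), ⟨e, e.strictMono, fun i j => ?_, fun k => rfl⟩, ?_⟩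
  · obtain ⟨v, -, hv⟩ := hmem i
    obtain ⟨v', -, hv'⟩ := hmem j
    rw [← hv, ← hv']
    have h1 := Complex.neg_pi_lt_arg (v : ℂ)
    have h2 := Complex.arg_le_pi (v' : ℂ)
    linarith
  · ext v
    constructor
    · rintro ⟨k, rfl⟩
      obtain ⟨v, hv, he⟩ := hmem k
      simp only
      rw [← he, Circle.exp_arg]; exact hv
    · intro hv
      have : Complex.arg (v : ℂ) ∈ Set.range e := by
        rw [Finset.range_orderEmbOfFin]
        exact Finset.mem_coe.2 (Finset.mem_image_of_mem _ hv)
      obtain ⟨k, hk⟩ := this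
      exact ⟨k, by simp only; rw [hk, Circle.exp_arg]⟩

/-- After removing full turns, the angles from the lift and the angles of the labelling are
increasing sequences in one half-open period starting at the same point. Both enumerate the same set
of `n + 3` numbers, and a finite set has only one increasing enumeration. -/
theorem lift_eq_labelling {n : ℕ} {M : Finset Circle} {f₀ : Fin (n + 3) → Circle}
    (hf₀ : IsCyclicLabelling M f₀) {ℓ : ℝ → ℝ} (hm : StrictMono ℓ)
    (hper : ∀ θ, ℓ (θ + 2 * Real.pi) = ℓ θ + 2 * Real.pi) {θ₁ : ℝ}
    (h0 : Circle.exp (ℓ θ₁) = f₀ 0)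
    (hmem : ∀ k : Fin (n + 3), Circle.exp (ℓ (θ₁ + 2 * Real.pi * k / ((n : ℝ) + 3))) ∈ M)
    (k : Fin (n + 3)) : Circle.exp (ℓ (θ₁ + 2 * Real.pi * k / ((n : ℝ) + 3))) = f₀ k := by
  obtain ⟨⟨t, ht, ht2, hft⟩, hrange⟩ := hf₀
  have hpi := Real.pi_pos
  have hN : (0 : ℝ) < (n : ℝ) + 3 := by positivity
  rw [hft] at h0
  obtain ⟨m, hm0⟩ := Circle.exp_eq_exp.1 h0
  set s : Fin (n + 3) → ℝ := fun k => ℓ (θ₁ + 2 * Real.pi * k / ((n : ℝ) + 3)) - m * (2 * Real.pi)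
    with hs
  have hθmono : StrictMono fun k : Fin (n + 3) => θ₁ + 2 * Real.pi * (k : ℕ) / ((n : ℝ) + 3) := by
    intro i j hij
    have : ((i : ℕ) : ℝ) < (j : ℕ) := by exact_mod_cast hij
    simp only
    gcongr
  have hsm : StrictMono s := fun i j hij => sub_lt_sub_right (hm (hθmono hij)) _
  have hs0 : s 0 = t 0 := by simp [hs, hm0]
  have hsico : ∀ k, s k ∈ Set.Ico (t 0) (t 0 + 2 * Real.pi) := by
    intro k
    refine ⟨by rw [← hs0]; exact hsm.monotone (Fin.zero_le k), ?_⟩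
    have h1 : θ₁ + 2 * Real.pi * (k : ℕ) / ((n : ℝ) + 3) < θ₁ + 2 * Real.pi := by
      have h2 : ((k : ℕ) : ℝ) < (n : ℝ) + 3 := by exact_mod_cast k.2
      have h3 : 2 * Real.pi * (k : ℕ) / ((n : ℝ) + 3) < 2 * Real.pi := by
        rw [div_lt_iff₀ hN]; gcongr
      linarith
    have h4 := hm h1
    rw [hper] at h4
    simp only [hs]
    linarith
  have htico : ∀ k, t k ∈ Set.Ico (t 0) (t 0 + 2 * Real.pi) := fun k =>
    ⟨ht.monotone (Fin.zero_le k), ht2 0 k⟩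
  have hexp : ∀ k, Circle.exp (s k) = Circle.exp (ℓ (θ₁ + 2 * Real.pi * k / ((n : ℝ) + 3))) :=
    fun k => Circle.exp_eq_exp.2 ⟨-m, by simp only [hs]; push_cast; ring⟩
  have hst : ∀ k, s k ∈ Finset.univ.image t := by
    intro k
    have h1 : Circle.exp (s k) ∈ Set.range f₀ := by rw [hrange, hexp]; exact hmem k
    obtain ⟨i, hi⟩ := h1
    rw [hft] at hi
    rw [exp_injOn hi.symm (hsico k) (htico i)]
    exact Finset.mem_image_of_mem _ (Finset.mem_univ i)
  have hcard : (Finset.univ.image t).card = n + 3 := by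
    rw [Finset.card_image_of_injective _ ht.injective, Finset.card_fin]
  have e1 := Finset.orderEmbOfFin_unique hcard hst hsm
  have e2 := Finset.orderEmbOfFin_unique hcard
    (fun k => Finset.mem_image_of_mem t (Finset.mem_univ k)) ht
  rw [← hexp, hft, e1, ← e2]

/-! ### Comparison of two framings -/

theorem surjective_of_lift {ℓ : ℝ → ℝ} (hc : Continuous ℓ)
    (hper : ∀ θ, ℓ (θ + 2 * Real.pi) = ℓ θ + 2 * Real.pi) : Function.Surjective ℓ := by
  intro c
  have hint : ∀ m : ℤ, ℓ (0 + m * (2 * Real.pi)) = ℓ 0 + m * (2 * Real.pi) := by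
    intro m
    have hp : Function.Periodic (fun θ => ℓ θ - θ) (2 * Real.pi) := fun θ => by
      simp only [hper]; ring
    have := hp.int_mul m 0
    linarith
  obtain ⟨m, hm'⟩ := exists_nat_gt (|ℓ 0 - c| / (2 * Real.pi))
  rw [div_lt_iff₀ (by positivity)] at hm'
  obtain ⟨ha, hb⟩ := abs_lt.1 hm'
  have h1 := hint (m : ℤ)
  have h2 := hint (-(m : ℤ))
  exact mem_range_of_exists_le_of_exists_ge hc
    ⟨_, by rw [h2]; push_cast; linarith⟩ ⟨_, by rw [h1]; push_cast; linarith⟩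

/-- The function `ℓ₂ ∘ ℓ₁⁻¹ - id` is `2π`-periodic and descends to the circle; it is the
displacement of the boundary map from the first framing to the second. -/
theorem exists_circle_displacement {ℓ₁ ℓ₂ : ℝ → ℝ} (hc₁ : Continuous ℓ₁) (hm₁ : StrictMono ℓ₁)
    (hper₁ : ∀ θ, ℓ₁ (θ + 2 * Real.pi) = ℓ₁ θ + 2 * Real.pi) (hc₂ : Continuous ℓ₂)
    (hm₂ : StrictMono ℓ₂) (hper₂ : ∀ θ, ℓ₂ (θ + 2 * Real.pi) = ℓ₂ θ + 2 * Real.pi) :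
    ∃ k : Circle → ℝ, Continuous k ∧ (∀ θ, k (Circle.exp (ℓ₁ θ)) = ℓ₂ θ - ℓ₁ θ) ∧
      StrictMono fun θ : ℝ => θ + k (Circle.exp θ) := by
  set e := hm₁.orderIsoOfSurjective ℓ₁ (surjective_of_lift hc₁ hper₁) with he
  have hel : ∀ θ, e.symm (ℓ₁ θ) = θ := fun θ => e.symm_apply_apply θ
  set κ : ℝ → ℝ := fun x => ℓ₂ (e.symm x) - x with hκ
  have hκc : Continuous κ := (hc₂.comp e.symm.continuous).sub continuous_id
  have hκp : Function.Periodic κ (2 * Real.pi) := by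
    intro x
    obtain ⟨θ, rfl⟩ := surjective_of_lift hc₁ hper₁ x
    simp only [hκ]
    rw [← hper₁, hel, hel, hper₂, hper₁]
    ring
  have hk : ∀ x, κ (Complex.arg (Circle.exp x : ℂ)) = κ x := by
    intro x
    obtain ⟨m, hm⟩ := Circle.exp_eq_exp.1 (Circle.exp_arg (Circle.exp x))
    rw [hm]
    exact hκp.int_mul m x
  refine ⟨fun y => κ (Complex.arg (y : ℂ)), ?_, fun θ => ?_, ?_⟩
  · have hq : Topology.IsQuotientMap (fun x : ℝ => Circle.exp x) :=
      isLocalHomeomorph_circleExp.isOpenMap.isQuotientMap Circle.exp.continuous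
        fun y => ⟨Complex.arg y, Circle.exp_arg y⟩
    rw [hq.continuous_iff]
    exact hκc.congr fun x => (hk x).symm
  · refine (hk _).trans ?_
    simp only [hκ, hel]
  · intro a b hab
    simp only [hk]
    have := hm₂ (e.symm.strictMono hab)
    simp only [hκ]
    linarith

/-- Two homeomorphic parametrizations of the disk which agree at marked boundary points, and
preserve the orientation of the boundary, are isotopic. -/
theorem exists_isotopy_of_lifts {n : ℕ} {M : Finset Circle} {f₀ : Fin (n + 3) → Circle}
    (hf₀ : Set.range f₀ = (M : Set Circle)) {F₁ F₂ : Disk → Disk} (hF₁ : Continuous F₁)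
    (hb₁ : Function.Bijective F₁) (hF₂ : Continuous F₂) (hb₂ : Function.Bijective F₂)
    {ℓ₁ ℓ₂ : ℝ → ℝ} (hc₁ : Continuous ℓ₁) (hm₁ : StrictMono ℓ₁)
    (hper₁ : ∀ θ, ℓ₁ (θ + 2 * Real.pi) = ℓ₁ θ + 2 * Real.pi) (hc₂ : Continuous ℓ₂)
    (hm₂ : StrictMono ℓ₂) (hper₂ : ∀ θ, ℓ₂ (θ + 2 * Real.pi) = ℓ₂ θ + 2 * Real.pi)
    (h₁ : ∀ θ, F₁ (bdry (Circle.exp θ)) = bdry (Circle.exp (ℓ₁ θ)))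
    (h₂ : ∀ θ, F₂ (bdry (Circle.exp θ)) = bdry (Circle.exp (ℓ₂ θ)))
    (hmark₁ : ∀ k : Fin (n + 3), Circle.exp (ℓ₁ (2 * Real.pi * k / ((n : ℝ) + 3))) = f₀ k)
    (hmark₂ : ∀ k : Fin (n + 3), Circle.exp (ℓ₂ (2 * Real.pi * k / ((n : ℝ) + 3))) = f₀ k) :
    ∃ H : unitInterval → (Disk ≃ₜ Disk),
      Continuous (fun y : unitInterval × Disk => H y.1 y.2) ∧ (∀ x, H 0 x = x) ∧
      (∀ t, ∀ m ∈ M, H t (bdry m) = bdry m) ∧ ∀ x, F₂ x = H 1 (F₁ x) := by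
  have hpi := Real.pi_pos
  have hN : (0 : ℝ) < (n : ℝ) + 3 := by positivity
  obtain ⟨m, hm0⟩ := Circle.exp_eq_exp.1 ((hmark₁ 0).trans (hmark₂ 0).symm)
  simp only [Fin.val_zero, Nat.cast_zero, mul_zero, zero_div] at hm0
  -- Adjusting one lift by full turns makes them equal at `0`; confined to a common period, they
  -- then agree at every marked angle exactly, so the displacement vanishes there.
  set ℓ₃ : ℝ → ℝ := fun θ => ℓ₂ θ + m * (2 * Real.pi) with hℓ₃
  have hexp₃ : ∀ θ, Circle.exp (ℓ₃ θ) = Circle.exp (ℓ₂ θ) := fun θ => Circle.exp_eq_exp.2 ⟨m, rfl⟩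
  have hm₃ : StrictMono ℓ₃ := fun a b hab => add_lt_add_left (hm₂ hab) _
  have hper₃ : ∀ θ, ℓ₃ (θ + 2 * Real.pi) = ℓ₃ θ + 2 * Real.pi := fun θ => by
    simp only [hℓ₃, hper₂]; ring
  have hico : ∀ (ℓ : ℝ → ℝ), StrictMono ℓ → (∀ θ, ℓ (θ + 2 * Real.pi) = ℓ θ + 2 * Real.pi) →
      ∀ k : Fin (n + 3), ℓ (2 * Real.pi * k / ((n : ℝ) + 3)) ∈ Set.Ico (ℓ 0) (ℓ 0 + 2 * Real.pi) := by
    intro ℓ hm hper k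
    have h2 : ((k : ℕ) : ℝ) < (n : ℝ) + 3 := by exact_mod_cast k.2
    refine ⟨hm.monotone (by positivity), ?_⟩
    rw [← hper]
    refine hm ?_
    rw [zero_add, div_lt_iff₀ hN]
    gcongr
  have hagree : ∀ k : Fin (n + 3), ℓ₃ (2 * Real.pi * k / ((n : ℝ) + 3)) =
      ℓ₁ (2 * Real.pi * k / ((n : ℝ) + 3)) := by
    intro k
    have h0 : ℓ₃ 0 = ℓ₁ 0 := hm0.symm
    refine exp_injOn (c := ℓ₁ 0) ?_ ?_ (hico ℓ₁ hm₁ hper₁ k)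
    · rw [hexp₃, hmark₁, hmark₂]
    · rw [← h0]; exact hico ℓ₃ hm₃ hper₃ k
  obtain ⟨κ, hκc, hκ, hκm⟩ := exists_circle_displacement (ℓ₂ := ℓ₃) hc₁ hm₁ hper₁
    (hc₂.add continuous_const : Continuous ℓ₃) hm₃ hper₃
  have : CompactSpace Disk := isCompact_iff_compactSpace.1 (isCompact_closedBall _ _)
  set E₁ : Disk ≃ₜ Disk := Continuous.homeoOfEquivCompactToT2 (f := Equiv.ofBijective F₁ hb₁) hF₁
  have hE₁ : ∀ x, E₁.symm (F₁ x) = x := fun x => E₁.symm_apply_apply x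
  obtain ⟨H, hH, hH0, hHM, hH1⟩ := exists_isotopy (K := fun x => F₂ (E₁.symm x)) (k := κ) M
    (hF₂.comp E₁.symm.continuous) (hb₂.comp E₁.symm.bijective) hκc (fun y => by
      obtain ⟨θ, hθ⟩ := surjective_of_lift hc₁ hper₁ (Complex.arg y)
      have hy : y = Circle.exp (ℓ₁ θ) := by rw [hθ, Circle.exp_arg]
      rw [hy, ← h₁, hE₁, h₂, hκ, ← Circle.exp_add, ← hexp₃]
      congr 2; ring) hκm (fun v hv => by
      have : v ∈ Set.range f₀ := by rw [hf₀]; exact hv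
      obtain ⟨k, rfl⟩ := this
      rw [← hmark₁, hκ, hagree, sub_self])
  exact ⟨H, hH, hH0, hHM, fun x => by rw [hH1]; simp only [hE₁]⟩

/-! ### A parametrization of the blowup by the disk -/

open Classical in
/-- The parametrization of the blowup at `p` by the closed disk whose restriction to the interior is
`A z + B` in the affine coordinate, with `z = 2 u / (1 - |u|²)`. -/
def affChart (p : OnePoint ℂ) (A B : ℂ) (u : Disk) : RealBlowup p :=
  if ‖(u : ℂ)‖ = 1 then RealBlowup.dir (direction (A⁻¹ * (starRingEnd ℂ) (u : ℂ)))
  else RealBlowup.ofPoint p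
    (affPt p (A * (2 * (u : ℂ) / ((1 - ‖(u : ℂ)‖ ^ 2 : ℝ) : ℂ)) + B))

theorem ofPoint_affPt (p : OnePoint ℂ) (u : ℂ) :
    RealBlowup.ofPoint p (affPt p u) = RealBlowup.point (affPt p u) (affPt_ne p u) :=
  ofPoint_of_ne _

theorem ofPoint_affPt_injective (p : OnePoint ℂ) :
    Function.Injective fun u => RealBlowup.ofPoint p (affPt p u) := by
  intro u u' h
  simp only [ofPoint_affPt] at h
  injection h with h
  exact affPt_injective p h

theorem ofPoint_ne_dir {p x : OnePoint ℂ} (hx : x ≠ p) (v : Circle) :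
    RealBlowup.ofPoint p x ≠ RealBlowup.dir v := by
  rw [ofPoint_of_ne hx]; exact fun h => by injection h

theorem affChart_boundary {p : OnePoint ℂ} {A B : ℂ} {u : Disk} (hu : ‖(u : ℂ)‖ = 1) :
    affChart p A B u = RealBlowup.dir (direction (A⁻¹ * (starRingEnd ℂ) (u : ℂ))) := by
  rw [affChart, if_pos hu]

theorem affChart_interior {p : OnePoint ℂ} {A B : ℂ} {u : Disk} (hu : ‖(u : ℂ)‖ ≠ 1) :
    affChart p A B u = RealBlowup.ofPoint p
      (affPt p (A * (2 * (u : ℂ) / ((1 - ‖(u : ℂ)‖ ^ 2 : ℝ) : ℂ)) + B)) := by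
  rw [affChart, if_neg hu]

theorem affChart_bdry_exp {p : OnePoint ℂ} {A B : ℂ} (hA : A ≠ 0) {τ : ℝ}
    (hτ : Circle.exp τ = direction A⁻¹) (θ : ℝ) :
    affChart p A B (bdry (Circle.exp θ)) = RealBlowup.dir (Circle.exp (-(θ - τ))) := by
  have hc : (starRingEnd ℂ) (Circle.exp θ : ℂ) = (Circle.exp (-θ) : Circle) := by
    rw [Circle.exp_neg, Circle.coe_inv_eq_conj]
  rw [affChart_boundary (Circle.norm_coe _)]
  change RealBlowup.dir (direction (A⁻¹ * (starRingEnd ℂ) (Circle.exp θ : ℂ))) = _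
  rw [hc, direction_mul (inv_ne_zero hA) (Circle.coe_ne_zero _), direction_coe, ← hτ,
    ← Circle.exp_add]
  congr 2; ring

theorem exists_disk_eq (z : ℂ) :
    ∃ u : Disk, ‖(u : ℂ)‖ ≠ 1 ∧ 2 * (u : ℂ) / ((1 - ‖(u : ℂ)‖ ^ 2 : ℝ) : ℂ) = z := by
  -- The preimage is `z / (1 + t)`, from the quadratic equation for the radius.
  set t := Real.sqrt (1 + ‖z‖ ^ 2) with ht
  have ht2 : t ^ 2 = 1 + ‖z‖ ^ 2 := Real.sq_sqrt (by positivity)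
  have ht1 : 1 ≤ t := Real.one_le_sqrt.2 (by nlinarith [norm_nonneg z])
  have hnorm : ‖z / ((1 + t : ℝ) : ℂ)‖ = ‖z‖ / (1 + t) := by
    rw [norm_div, Complex.norm_real, Real.norm_of_nonneg (by linarith)]
  have hlt : ‖z / ((1 + t : ℝ) : ℂ)‖ < 1 := by
    rw [hnorm, div_lt_one (by linarith)]
    nlinarith [norm_nonneg z]
  refine ⟨⟨z / ((1 + t : ℝ) : ℂ), mem_closedBall_zero_iff.2 hlt.le⟩, hlt.ne, ?_⟩
  have hz2 : ‖z‖ ^ 2 = (t - 1) * (t + 1) := by linarith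
  have h1 : 1 - ‖z / ((1 + t : ℝ) : ℂ)‖ ^ 2 = 2 / (1 + t) := by
    rw [hnorm, div_pow, hz2]; field_simp; ring
  rw [h1]
  have h2 : ((1 + t : ℝ) : ℂ) ≠ 0 := by exact_mod_cast (by linarith : (1 + t) ≠ 0)
  rw [Complex.ofReal_div]
  field_simp
  simp [mul_comm]

theorem disk_eq_of_eq {u u' : Disk} (hu : ‖(u : ℂ)‖ ≠ 1) (hu' : ‖(u' : ℂ)‖ ≠ 1)
    (h : 2 * (u : ℂ) / ((1 - ‖(u : ℂ)‖ ^ 2 : ℝ) : ℂ) =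
      2 * (u' : ℂ) / ((1 - ‖(u' : ℂ)‖ ^ 2 : ℝ) : ℂ)) : u = u' := by
  have hlt : ‖(u : ℂ)‖ < 1 := lt_of_le_of_ne (mem_closedBall_zero_iff.1 u.2) hu
  have hlt' : ‖(u' : ℂ)‖ < 1 := lt_of_le_of_ne (mem_closedBall_zero_iff.1 u'.2) hu'
  set r := ‖(u : ℂ)‖ with hr
  set r' := ‖(u' : ℂ)‖ with hr'
  have h0 : 0 ≤ r := norm_nonneg _
  have h0' : 0 ≤ r' := norm_nonneg _
  have hs : 0 < 1 - r ^ 2 := by nlinarith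
  have hs' : 0 < 1 - r' ^ 2 := by nlinarith
  have hn := congrArg norm h
  rw [norm_div, norm_div, norm_mul, norm_mul, Complex.norm_real, Complex.norm_real,
    Real.norm_of_nonneg hs.le, Real.norm_of_nonneg hs'.le, ← hr, ← hr',
    div_eq_div_iff hs.ne' hs'.ne', Complex.norm_ofNat] at hn
  have hrr : (r - r') * (1 + r * r') = 0 := by linarith
  have : r = r' := by
    rcases mul_eq_zero.1 hrr with h | h
    · linarith
    · nlinarith [mul_nonneg h0 h0']
  rw [← this] at h
  have hsc : ((1 - r ^ 2 : ℝ) : ℂ) ≠ 0 := by exact_mod_cast hs.ne'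
  field_simp at h
  exact Subtype.ext h

theorem bijective_affChart (p : OnePoint ℂ) {A : ℂ} (hA : A ≠ 0) (B : ℂ) :
    Function.Bijective (affChart p A B) := by
  constructor
  · intro u u' h
    by_cases hu : ‖(u : ℂ)‖ = 1 <;> by_cases hu' : ‖(u' : ℂ)‖ = 1
    · rw [affChart_boundary hu, affChart_boundary hu'] at h
      injection h with h
      have hne : ∀ u : Disk, ‖(u : ℂ)‖ = 1 → (u : ℂ) ≠ 0 := fun u hu h0 => by
        rw [h0, norm_zero] at hu; exact zero_ne_one hu
      have hne' : ∀ u : Disk, ‖(u : ℂ)‖ = 1 → (starRingEnd ℂ) (u : ℂ) ≠ 0 := fun u hu =>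
        (map_ne_zero _).2 (hne u hu)
      rw [direction_mul (inv_ne_zero hA) (hne' u hu), direction_mul (inv_ne_zero hA) (hne' u' hu'),
        mul_right_inj] at h
      have h2 := congrArg (fun v : Circle => (v : ℂ)) h
      simp only [coe_direction (hne' u hu), coe_direction (hne' u' hu'), Complex.norm_conj, hu, hu',
        Complex.ofReal_one, div_one] at h2
      exact Subtype.ext ((starRingEnd ℂ).injective h2)
    · rw [affChart_boundary hu, affChart_interior hu'] at h
      exact absurd h.symm (ofPoint_ne_dir (affPt_ne p _) _)
    · rw [affChart_interior hu, affChart_boundary hu'] at h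
      exact absurd h (ofPoint_ne_dir (affPt_ne p _) _)
    · rw [affChart_interior hu, affChart_interior hu'] at h
      have h2 := ofPoint_affPt_injective p h
      exact disk_eq_of_eq hu hu' (mul_left_cancel₀ hA (add_right_cancel h2))
  · intro x
    cases x with
    | point x hx =>
      obtain ⟨U, rfl⟩ := exists_affPt hx
      obtain ⟨u, hu, he⟩ := exists_disk_eq ((U - B) / A)
      refine ⟨u, ?_⟩
      rw [affChart_interior hu, he, mul_div_cancel₀ _ hA, sub_add_cancel, ofPoint_affPt]
    | dir v =>
      refine ⟨bdry (Circle.exp (-(Complex.arg (v : ℂ) - Complex.arg A⁻¹))), ?_⟩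
      rw [affChart_bdry_exp (τ := Complex.arg A⁻¹) hA rfl]
      congr 1
      rw [show -(-(Complex.arg (v : ℂ) - Complex.arg A⁻¹) - Complex.arg A⁻¹) = Complex.arg (v : ℂ) by
        ring, Circle.exp_arg]

/-- The affine coordinate `D / (1 - ‖u‖²)` blows up at the boundary but `D` does not, so the local
coordinate `(1 - ‖u‖²) / D` has usable polar coordinates there. Measuring its argument from `c₀`
keeps the angle continuous when `D⁻¹` is near `c₀`. -/
theorem affChart_eq_polar {p : OnePoint ℂ} {A B : ℂ} (hA : A ≠ 0) {u : Disk} {D c₀ : ℂ}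
    (hD : D = 2 * A * u + B * ((1 - ‖(u : ℂ)‖ ^ 2 : ℝ) : ℂ)) (hD0 : D ≠ 0) (hc₀ : c₀ ≠ 0) :
    affChart p A B u = polar p ((1 - ‖(u : ℂ)‖ ^ 2) / ‖D‖)
      (Complex.arg c₀ + Complex.arg (D⁻¹ / c₀)) := by
  have hexp : Circle.exp (Complex.arg c₀ + Complex.arg (D⁻¹ / c₀)) = direction D⁻¹ := by
    rw [Circle.exp_add]
    change direction c₀ * direction (D⁻¹ / c₀) = _
    rw [← direction_mul hc₀ (div_ne_zero (inv_ne_zero hD0) hc₀), mul_div_cancel₀ _ hc₀]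
  have hDn : 0 < ‖D‖ := norm_pos_iff.2 hD0
  by_cases hu : ‖(u : ℂ)‖ = 1
  · have hs : 1 - ‖(u : ℂ)‖ ^ 2 = 0 := by rw [hu]; norm_num
    have hu0 : (u : ℂ) ≠ 0 := fun h0 => by rw [h0, norm_zero] at hu; exact zero_ne_one hu
    rw [affChart_boundary hu, hs, zero_div, polar_zero, hexp]
    rw [hs, Complex.ofReal_zero, mul_zero, add_zero] at hD
    have hconj : (starRingEnd ℂ) (u : ℂ) = (u : ℂ)⁻¹ := by
      rw [Complex.inv_def, Complex.normSq_eq_norm_sq, hu]; simp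
    have : D⁻¹ = ((2⁻¹ : ℝ) : ℂ) * (A⁻¹ * (starRingEnd ℂ) (u : ℂ)) := by
      rw [hD, hconj]; push_cast; field_simp
    rw [this, direction_ofReal_mul (by norm_num)]
  · have hlt : ‖(u : ℂ)‖ < 1 := lt_of_le_of_ne (mem_closedBall_zero_iff.1 u.2) hu
    have hs : 0 < 1 - ‖(u : ℂ)‖ ^ 2 := by nlinarith [norm_nonneg (u : ℂ)]
    have hsc : ((1 - ‖(u : ℂ)‖ ^ 2 : ℝ) : ℂ) ≠ 0 := by exact_mod_cast hs.ne'
    rw [affChart_interior hu, polar, if_neg (not_le.2 (div_pos hs hDn)), hexp,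
      coe_direction (inv_ne_zero hD0)]
    have h1 : A * (2 * (u : ℂ) / ((1 - ‖(u : ℂ)‖ ^ 2 : ℝ) : ℂ)) + B =
        D / ((1 - ‖(u : ℂ)‖ ^ 2 : ℝ) : ℂ) := by
      rw [hD]; field_simp
    have hDc : (‖D‖ : ℂ) ≠ 0 := by exact_mod_cast hDn.ne'
    rw [h1, ← locPt_inv (div_ne_zero hD0 hsc), norm_inv, Complex.ofReal_div, Complex.ofReal_inv]
    congr 2
    field_simp

theorem IsOrientedDiffeo.continuous_comp_affChart {p : OnePoint ℂ} {f : RealBlowup p → Disk}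
    (hf : IsOrientedDiffeo p f) {A : ℂ} (hA : A ≠ 0) (B : ℂ) :
    Continuous fun u => f (affChart p A B u) := by
  rw [continuous_induced_rng, continuous_iff_continuousAt]
  intro u₀
  have hncont : Continuous fun u : Disk => ‖(u : ℂ)‖ := continuous_subtype_val.norm
  by_cases hu₀ : ‖(u₀ : ℂ)‖ = 1
  · set D : Disk → ℂ := fun u => 2 * A * u + B * ((1 - ‖(u : ℂ)‖ ^ 2 : ℝ) : ℂ) with hD
    have hDc : Continuous D := by
      refine (continuous_const.mul continuous_subtype_val).add (continuous_const.mul ?_)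
      exact Complex.continuous_ofReal.comp (by fun_prop)
    have hD₀ : D u₀ ≠ 0 := by
      have hu0 : (u₀ : ℂ) ≠ 0 := fun h0 => by rw [h0, norm_zero] at hu₀; exact zero_ne_one hu₀
      simp [hD, hu₀, hA, hu0]
    have hev : ∀ᶠ u in 𝓝 u₀, D u ≠ 0 := hDc.continuousAt.eventually_ne hD₀
    set θ : Disk → ℝ := fun u => Complex.arg (D u₀)⁻¹ + Complex.arg ((D u)⁻¹ / (D u₀)⁻¹) with hθ
    have hcomp : (fun u => (f (polar p ((1 - ‖(u : ℂ)‖ ^ 2) / ‖D u‖) (θ u)) : ℂ)) =ᶠ[𝓝 u₀]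
        Subtype.val ∘ fun u => f (affChart p A B u) := by
      filter_upwards [hev] with u hu
      rw [Function.comp_apply, affChart_eq_polar hA (rfl : D u = _) hu (inv_ne_zero hD₀)]
    refine ContinuousAt.congr ?_ hcomp
    have hg := hf.smooth_boundary.continuousOn
    have hθc : ContinuousAt θ u₀ := by
      refine continuousAt_const.add ?_
      have h1 : ContinuousAt (fun u => (D u)⁻¹ / (D u₀)⁻¹) u₀ :=
        (hDc.continuousAt.inv₀ hD₀).div_const _
      refine ContinuousAt.comp (g := Complex.arg) ?_ h1
      rw [div_self (inv_ne_zero hD₀)]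
      exact Complex.continuousAt_arg Complex.one_mem_slitPlane
    have hrc : ContinuousAt (fun u : Disk => (1 - ‖(u : ℂ)‖ ^ 2) / ‖D u‖) u₀ := by
      refine ContinuousAt.div (by fun_prop) hDc.norm.continuousAt (norm_ne_zero_iff.2 hD₀)
    have hmem : ∀ u : Disk, ((1 - ‖(u : ℂ)‖ ^ 2) / ‖D u‖, θ u) ∈ {y : ℝ × ℝ | 0 ≤ y.1} := by
      intro u
      have := mem_closedBall_zero_iff.1 u.2
      exact div_nonneg (by nlinarith [norm_nonneg (u : ℂ)]) (norm_nonneg _)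
    have h2 : Tendsto (fun u : Disk => ((1 - ‖(u : ℂ)‖ ^ 2) / ‖D u‖, θ u)) (𝓝 u₀)
        (𝓝[{y : ℝ × ℝ | 0 ≤ y.1}] ((1 - ‖(u₀ : ℂ)‖ ^ 2) / ‖D u₀‖, θ u₀)) :=
      tendsto_nhdsWithin_iff.2 ⟨(hrc.prodMk hθc).tendsto, Eventually.of_forall hmem⟩
    exact (hg _ (hmem u₀)).tendsto.comp h2
  · have hev : ∀ᶠ u : Disk in 𝓝 u₀, ‖(u : ℂ)‖ ≠ 1 := hncont.continuousAt.eventually_ne hu₀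
    have hlt : ‖(u₀ : ℂ)‖ < 1 := lt_of_le_of_ne (mem_closedBall_zero_iff.1 u₀.2) hu₀
    have hs : 1 - ‖(u₀ : ℂ)‖ ^ 2 ≠ 0 := by nlinarith [norm_nonneg (u₀ : ℂ)]
    have hcomp : (fun u : Disk => (f (RealBlowup.ofPoint p (affPt p
        (A * (2 * (u : ℂ) / ((1 - ‖(u : ℂ)‖ ^ 2 : ℝ) : ℂ)) + B))) : ℂ)) =ᶠ[𝓝 u₀]
        Subtype.val ∘ fun u => f (affChart p A B u) := by
      filter_upwards [hev] with u hu
      rw [Function.comp_apply, affChart_interior hu]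
    refine ContinuousAt.congr ?_ hcomp
    refine ContinuousAt.comp (g := fun u : ℂ => (f (RealBlowup.ofPoint p (affPt p u)) : ℂ))
      hf.smooth_interior.continuous.continuousAt ?_
    refine (continuousAt_const.mul (ContinuousAt.div (by fun_prop) ?_ ?_)).add continuousAt_const
    · exact (Complex.continuous_ofReal.comp (by fun_prop)).continuousAt
    · exact_mod_cast hs

/-! ### Biholomorphisms in local coordinates -/

/-- `h`, with derivative `h'`, is the expression of `g` in the local coordinates centred at `x` and
`g x`, and `g` is conformal at `x`. -/
structure HasChart (g : OnePoint ℂ → OnePoint ℂ) (x : OnePoint ℂ) (h h' : ℂ → ℂ) : Prop where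
  map_zero : h 0 = 0
  deriv_ne_zero : h' 0 ≠ 0
  hasDerivAt : ∀ᶠ w in 𝓝 0, HasDerivAt h (h' w) w
  eq_locPt : ∀ᶠ w in 𝓝 0, g (locPt x w) = locPt (g x) (h w)

section
variable {g : OnePoint ℂ → OnePoint ℂ} {x : OnePoint ℂ} {h h' : ℂ → ℂ}

theorem HasChart.coordExpr_eq (H : HasChart g x h h') : coordExpr g x (g x) =ᶠ[𝓝 0] h := by
  filter_upwards [H.eq_locPt] with w hw
  rw [coordExpr, hw, locCoord_locPt]

theorem HasChart.hasDerivAt_coordExpr (H : HasChart g x h h') :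
    HasDerivAt (coordExpr g x (g x)) (h' 0) 0 :=
  H.hasDerivAt.self_of_nhds.congr_of_eventuallyEq H.coordExpr_eq

theorem HasChart.deriv_coordExpr (H : HasChart g x h h') :
    ∀ᶠ w in 𝓝 0, deriv (coordExpr g x (g x)) w = h' w := by
  filter_upwards [H.hasDerivAt, H.coordExpr_eq.eventuallyEq_nhds] with w hw he
  rw [he.deriv_eq, hw.deriv]

theorem HasChart.continuousAt (H : HasChart g x h h') : ContinuousAt g x := by
  have h1 : Tendsto h (𝓝 0) (𝓝 0) := by
    have := H.hasDerivAt.self_of_nhds.continuousAt.tendsto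
    rwa [H.map_zero] at this
  have h2 : Tendsto (fun y => locPt (g x) (h (locCoord x y))) (𝓝 x) (𝓝 (g x)) :=
    (tendsto_locPt (g x)).comp (h1.comp (tendsto_locCoord x))
  refine h2.congr' ?_
  filter_upwards [locPt_locCoord_eventually x, (tendsto_locCoord x).eventually H.eq_locPt] with y hy hy'
  rw [← hy', hy]
end

theorem coordExpr_zero (g : OnePoint ℂ → OnePoint ℂ) (p : OnePoint ℂ) :
    coordExpr g p (g p) 0 = 0 := by
  rw [coordExpr, locPt_zero, locCoord_self]

theorem tendsto_coordExpr (g : OnePoint ℂ ≃ₜ OnePoint ℂ) (p : OnePoint ℂ) :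
    Tendsto (coordExpr g p (g p)) (𝓝 0) (𝓝 0) :=
  (tendsto_locCoord (g p)).comp ((g.continuous.tendsto p).comp (tendsto_locPt p))

theorem locPt_coordExpr (g : OnePoint ℂ ≃ₜ OnePoint ℂ) (p : OnePoint ℂ) :
    ∀ᶠ w in 𝓝 0, locPt (g p) (coordExpr g p (g p) w) = g (locPt p w) :=
  ((g.continuous.tendsto p).comp (tendsto_locPt p)).eventually (locPt_locCoord_eventually (g p))

theorem coordExpr_symm_comp (g : OnePoint ℂ ≃ₜ OnePoint ℂ) (p : OnePoint ℂ) :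
    ∀ᶠ w in 𝓝 0, coordExpr g.symm (g p) p (coordExpr g p (g p) w) = w := by
  filter_upwards [locPt_coordExpr g p] with w hw
  rw [coordExpr, hw, g.symm_apply_apply, locCoord_locPt]

theorem IsBiholomorphism.deriv_ne_zero {g : OnePoint ℂ ≃ₜ OnePoint ℂ} (hg : IsBiholomorphism g)
    (p : OnePoint ℂ) : deriv (coordExpr g p (g p)) 0 ≠ 0 := by
  have h1 := (hg.1 p).hasDerivAt
  have h2 := (hg.2 (g p)).hasDerivAt
  rw [g.symm_apply_apply] at h2
  rw [← coordExpr_zero g p] at h2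
  have h3 := (h2.comp (0 : ℂ) h1).unique
    ((hasDerivAt_id (0 : ℂ)).congr_of_eventuallyEq (coordExpr_symm_comp g p))
  exact right_ne_zero_of_mul_eq_one h3

/-- A continuous inverse of a map with nonzero derivative is differentiable, so only the forward map
needs checking. -/
theorem isBiholomorphism_of_hasDerivAt {g : OnePoint ℂ ≃ₜ OnePoint ℂ}
    (hg : ∀ p, ∃ c ≠ 0, HasDerivAt (coordExpr g p (g p)) c 0) : IsBiholomorphism g := by
  refine ⟨fun p => (hg p).choose_spec.2.differentiableAt, fun q => ?_⟩
  obtain ⟨p, rfl⟩ := g.surjective q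
  obtain ⟨c, hc, hd⟩ := hg p
  rw [g.symm_apply_apply]
  have hcont := tendsto_coordExpr g.symm (g p)
  rw [g.symm_apply_apply] at hcont
  have h0 : coordExpr g.symm (g p) p 0 = 0 := by
    have := coordExpr_zero g.symm (g p)
    rwa [g.symm_apply_apply] at this
  have hleft := coordExpr_symm_comp g.symm (g p)
  rw [Homeomorph.symm_symm, g.symm_apply_apply] at hleft
  refine (HasDerivAt.of_local_left_inverse (f := coordExpr g p (g p)) (f' := c) ?_ ?_ hc
    hleft).differentiableAt
  · rw [ContinuousAt, h0]; exact hcont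
  · rw [h0]; exact hd

theorem locCoord_affPt (p : OnePoint ℂ) (u : ℂ) : locCoord p (affPt p u) = u⁻¹ := by
  induction p using OnePoint.rec with
  | infty => rfl
  | coe a =>
    by_cases hu : u = 0
    · simp [hu, affPt, locCoord]
    · simp [hu, affPt, locCoord]

theorem affPt_locCoord {p x : OnePoint ℂ} (hx : x ≠ p) : affPt p (locCoord p x)⁻¹ = x := by
  obtain ⟨u, rfl⟩ := exists_affPt hx
  rw [locCoord_affPt, inv_inv]

/-- Comparison of the affine coordinate at `p`, recentred at `U`, with the standard local
coordinate. There are three cases: `p = ∞`; `p` finite with `U = 0`, which is the point `∞`; and `p`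
finite with `U ≠ 0`. Later arguments need no further case distinction on `p`. -/
theorem exists_chart_affPt (p : OnePoint ℂ) (U : ℂ) :
    ∃ h h' : ℂ → ℂ, h 0 = 0 ∧ h' 0 ≠ 0 ∧ (∀ᶠ w in 𝓝 0, HasDerivAt h (h' w) w) ∧
      (∀ᶠ w in 𝓝 0, affPt p (U + w) = locPt (affPt p U) (h w)) ∧
      ∀ φ : QuadraticDifferential, ∀ᶠ w in 𝓝[≠] (0 : ℂ), U + w ≠ 0 ∧
        φ.localCoeff (affPt p U) (h w) * h' w ^ 2 = φ.localCoeff p (U + w)⁻¹ * ((U + w)⁻¹) ^ 4 := by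
  have hne : ∀ᶠ w in 𝓝[≠] (0 : ℂ), U + w ≠ 0 := by
    by_cases hU : U = 0
    · filter_upwards [self_mem_nhdsWithin] with w hw
      rw [hU, zero_add]; exact hw
    · refine Filter.Eventually.filter_mono nhdsWithin_le_nhds ?_
      exact ContinuousAt.eventually_ne (by fun_prop) (by simpa using hU)
  induction p using OnePoint.rec with
  | infty =>
    refine ⟨id, fun _ => 1, rfl, one_ne_zero, Eventually.of_forall fun w => hasDerivAt_id w,
      Eventually.of_forall fun w => rfl, fun φ => ?_⟩
    filter_upwards [hne] with w hw
    refine ⟨hw, ?_⟩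
    change φ.coeff (U + w) * 1 ^ 2 = φ.coeffInfty (U + w)⁻¹ * ((U + w)⁻¹) ^ 4
    rw [φ.coeffInfty_inv hw]; field_simp
  | coe a =>
    by_cases hU : U = 0
    · subst hU
      have hD : ∀ᶠ w : ℂ in 𝓝 0, 1 + a * w ≠ 0 :=
        ContinuousAt.eventually_ne (by fun_prop) (by simp)
      refine ⟨fun w => w / (1 + a * w), fun w => 1 / (1 + a * w) ^ 2, by simp, by simp, ?_, ?_, ?_⟩
      · filter_upwards [hD] with w hw
        refine ((hasDerivAt_id w).div (((hasDerivAt_id w).const_mul a).const_add 1) hw).congr_deriv ?_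
        simp only [id]
        field_simp
        ring
      · filter_upwards [hD] with w hw
        by_cases h0 : w = 0
        · simp [h0, affPt, locPt]
        · have h1 : w / (1 + a * w) ≠ 0 := div_ne_zero h0 hw
          simp only [zero_add, affPt, if_neg h0, if_pos, locPt, if_neg h1]
          congr 1
          field_simp
          ring
      · intro φ
        filter_upwards [hne, self_mem_nhdsWithin, nhdsWithin_le_nhds hD] with w hw h0 hw'
        refine ⟨hw, ?_⟩
        have h0 : w ≠ 0 := h0
        have e : affPt (a : OnePoint ℂ) 0 = OnePoint.infty := by simp [affPt]
        rw [e, QuadraticDifferential.localCoeff_infty, QuadraticDifferential.localCoeff_coe]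
        have h1 : w / (1 + a * w) = (a + w⁻¹)⁻¹ := by field_simp; ring
        have h2 : a + w⁻¹ ≠ 0 := by
          rw [show a + w⁻¹ = (1 + a * w) / w by field_simp; ring]
          exact div_ne_zero hw' h0
        rw [h1, φ.coeffInfty_inv h2, zero_add, show a + w⁻¹ = (1 + a * w) / w by field_simp; ring]
        field_simp
    · have hD : ∀ᶠ w : ℂ in 𝓝 0, U + w ≠ 0 :=
        ContinuousAt.eventually_ne (by fun_prop) (by simpa using hU)
      have e : affPt (a : OnePoint ℂ) U = ((a + U⁻¹ : ℂ) : OnePoint ℂ) := by simp [affPt, hU]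
      refine ⟨fun w => (U + w)⁻¹ - U⁻¹, fun w => -1 / (U + w) ^ 2, by simp, by simp [hU], ?_, ?_, ?_⟩
      · filter_upwards [hD] with w hw
        exact (((hasDerivAt_id w).const_add U).inv hw).sub_const _
      · filter_upwards [hD] with w hw
        rw [e]
        simp only [affPt, if_neg hw, locPt]
        congr 1
        ring
      · intro φ
        filter_upwards [hne] with w hw
        refine ⟨hw, ?_⟩
        rw [e, QuadraticDifferential.localCoeff_coe, QuadraticDifferential.localCoeff_coe]
        rw [show a + U⁻¹ + ((U + w)⁻¹ - U⁻¹) = a + (U + w)⁻¹ by ring]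
        field_simp

/-! ### Affine maps in the coordinate at the pole -/

/-- The bijection of the sphere which is `z ↦ α z + β` from the coordinate `z` to the affine
coordinate on the complement of `p`. -/
def affineMap (p : OnePoint ℂ) (α β : ℂ) : OnePoint ℂ → OnePoint ℂ
  | OnePoint.infty => p
  | OnePoint.some z => affPt p (α * z + β)

section
variable {p : OnePoint ℂ} {α β : ℂ}

theorem affineMap_coe (z : ℂ) : affineMap p α β (z : OnePoint ℂ) = affPt p (α * z + β) := rfl

theorem bijective_affineMap (hα : α ≠ 0) : Function.Bijective (affineMap p α β) := by
  constructor
  · intro x y h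
    induction x using OnePoint.rec with
    | infty =>
      induction y using OnePoint.rec with
      | infty => rfl
      | coe z => exact absurd h.symm (affPt_ne p _)
    | coe z =>
      induction y using OnePoint.rec with
      | infty => exact absurd h (affPt_ne p _)
      | coe z' =>
        rw [affineMap_coe, affineMap_coe] at h
        rw [mul_left_cancel₀ hα (add_right_cancel (affPt_injective p h))]
  · intro y
    by_cases hy : y = p
    · exact ⟨OnePoint.infty, hy.symm⟩
    · obtain ⟨u, rfl⟩ := exists_affPt hy
      refine ⟨(((u - β) / α : ℂ) : OnePoint ℂ), ?_⟩
      rw [affineMap_coe, mul_div_cancel₀ _ hα, sub_add_cancel]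

theorem hasChart_affineMap_infty (hα : α ≠ 0) :
    HasChart (affineMap p α β) OnePoint.infty (fun w => w / (α + β * w))
      (fun w => α / (α + β * w) ^ 2) := by
  have hD : ∀ᶠ w : ℂ in 𝓝 0, α + β * w ≠ 0 :=
    ContinuousAt.eventually_ne (by fun_prop) (by simpa using hα)
  refine ⟨by simp, by simp [hα], ?_, ?_⟩
  · filter_upwards [hD] with w hw
    refine ((hasDerivAt_id w).div (((hasDerivAt_id w).const_mul β).const_add α) hw).congr_deriv ?_
    simp only [id]
    field_simp
    ring
  · filter_upwards [hD] with w hw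
    by_cases h0 : w = 0
    · simp only [h0, zero_div, locPt_zero]
    · have h1 : locPt OnePoint.infty w = ((w⁻¹ : ℂ) : OnePoint ℂ) := by simp [locPt, h0]
      have h2 : α * w⁻¹ + β = (w / (α + β * w))⁻¹ := by field_simp
      rw [h1, affineMap_coe, h2, affPt_inv (div_ne_zero h0 hw)]
      rfl

theorem exists_hasChart_affineMap_coe (hα : α ≠ 0) (z : ℂ) :
    ∃ h h' : ℂ → ℂ, HasChart (affineMap p α β) z h h' ∧
      ∀ φ : QuadraticDifferential, ∀ᶠ w in 𝓝[≠] (0 : ℂ), α * (z + w) + β ≠ 0 ∧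
        φ.localCoeff (affineMap p α β z) (h w) * h' w ^ 2 =
          φ.localCoeff p (α * (z + w) + β)⁻¹ * ((α * (z + w) + β)⁻¹) ^ 4 * α ^ 2 := by
  obtain ⟨h, h', h0, h0', hd, heq, hφ⟩ := exists_chart_affPt p (α * z + β)
  have ht : Tendsto (fun w : ℂ => α * w) (𝓝 0) (𝓝 0) := by
    have : ContinuousAt (fun w : ℂ => α * w) 0 := by fun_prop
    simpa [ContinuousAt] using this
  have ht' : Tendsto (fun w : ℂ => α * w) (𝓝[≠] 0) (𝓝[≠] 0) :=
    tendsto_nhdsWithin_iff.2 ⟨ht.mono_left nhdsWithin_le_nhds, by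
      filter_upwards [self_mem_nhdsWithin] with w hw using mul_ne_zero hα hw⟩
  have hz : ∀ w, α * z + β + α * w = α * (z + w) + β := fun w => by ring
  refine ⟨fun w => h (α * w), fun w => h' (α * w) * α, ⟨by simpa using h0, ?_, ?_, ?_⟩, fun φ => ?_⟩
  · simpa [hα] using h0'
  · filter_upwards [ht.eventually hd] with w hw
    exact hw.comp w (((hasDerivAt_id w).const_mul α).congr_deriv (mul_one α))
  · filter_upwards [ht.eventually heq] with w hw
    rw [hz] at hw
    exact hw
  · filter_upwards [ht'.eventually (hφ φ)] with w hw
    rw [hz] at hw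
    refine ⟨hw.1, ?_⟩
    rw [mul_pow, ← mul_assoc, ← hw.2]
    rfl

variable (p β) in
/-- `affineMap` as a homeomorphism. -/
def affineHomeo (hα : α ≠ 0) : OnePoint ℂ ≃ₜ OnePoint ℂ :=
  Continuous.homeoOfEquivCompactToT2 (f := Equiv.ofBijective _ (bijective_affineMap (p := p) (β := β) hα))
    (continuous_iff_continuousAt.2 fun x => by
      induction x using OnePoint.rec with
      | infty => exact (hasChart_affineMap_infty hα).continuousAt
      | coe z =>
        obtain ⟨h, h', H, -⟩ := exists_hasChart_affineMap_coe (p := p) (β := β) hα z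
        exact H.continuousAt)

theorem coe_affineHomeo (hα : α ≠ 0) : ⇑(affineHomeo p β hα) = affineMap p α β := rfl

theorem isBiholomorphism_affineHomeo (hα : α ≠ 0) : IsBiholomorphism (affineHomeo p β hα) := by
  refine isBiholomorphism_of_hasDerivAt fun x => ?_
  rw [coe_affineHomeo]
  induction x using OnePoint.rec with
  | infty =>
    have H := hasChart_affineMap_infty (p := p) (β := β) hα
    exact ⟨_, H.deriv_ne_zero, H.hasDerivAt_coordExpr⟩
  | coe z =>
    obtain ⟨h, h', H, -⟩ := exists_hasChart_affineMap_coe (p := p) (β := β) hα z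
    exact ⟨_, H.deriv_ne_zero, H.hasDerivAt_coordExpr⟩

theorem isPullback_affineHomeo (hα : α ≠ 0) {φ₁ φ₂ : QuadraticDifferential}
    (hφ : ∀ z, α * z + β ≠ 0 → φ₂.localCoeff p (α * z + β)⁻¹ =
      φ₁.coeff z * (α ^ 2)⁻¹ * (α * z + β) ^ 4) :
    QuadraticDifferential.IsPullback (affineHomeo p β hα) φ₂ φ₁ := by
  intro x
  rw [coe_affineHomeo]
  induction x using OnePoint.rec with
  | infty =>
    have H := hasChart_affineMap_infty (p := p) (β := β) hα
    have hD : ∀ᶠ w : ℂ in 𝓝 0, α + β * w ≠ 0 :=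
      ContinuousAt.eventually_ne (by fun_prop) (by simpa using hα)
    filter_upwards [nhdsWithin_le_nhds H.coordExpr_eq, nhdsWithin_le_nhds H.deriv_coordExpr,
      nhdsWithin_le_nhds hD, self_mem_nhdsWithin] with w h1 h2 h3 h4
    have h4 : w ≠ 0 := h4
    rw [h1, h2]
    have h5 : w / (α + β * w) = (α * w⁻¹ + β)⁻¹ := by field_simp
    have h6 : α * w⁻¹ + β = (α + β * w) / w := by field_simp
    change φ₁.coeffInfty w = φ₂.localCoeff p _ * _
    rw [h5, hφ _ (by rw [h6]; exact div_ne_zero h3 h4), φ₁.coeff_inv h4, h6]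
    generalize α + β * w = D at h3 ⊢
    field_simp
  | coe z =>
    obtain ⟨h, h', H, hφ₂⟩ := exists_hasChart_affineMap_coe (p := p) (β := β) hα z
    filter_upwards [nhdsWithin_le_nhds H.coordExpr_eq, nhdsWithin_le_nhds H.deriv_coordExpr,
      hφ₂ φ₂] with w h1 h2 h3
    rw [h1, h2, h3.2, hφ _ h3.1, QuadraticDifferential.localCoeff_coe]
    have h4 := h3.1
    generalize α * (z + w) + β = D at h4 ⊢
    field_simp

/-- In the disk parametrizations of the two blowups, the induced map becomes the identity, so
framings can be compared as self-maps of one disk. -/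
theorem blowupMap_affineHomeo (hα : α ≠ 0) (u : Disk) :
    blowupMap (affineHomeo p β hα) OnePoint.infty p (affChart OnePoint.infty 1 0 u) =
      affChart p α β u := by
  by_cases hu : ‖(u : ℂ)‖ = 1
  · rw [affChart_boundary hu, affChart_boundary hu]
    have hu0 : (u : ℂ) ≠ 0 := fun h0 => by rw [h0, norm_zero] at hu; exact zero_ne_one hu
    have hd : deriv (coordExpr (affineHomeo p β hα) OnePoint.infty p) 0 = α⁻¹ := by
      have := (hasChart_affineMap_infty (p := p) (β := β) hα).hasDerivAt_coordExpr.deriv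
      rw [coe_affineHomeo]
      refine this.trans ?_
      rw [mul_zero, add_zero]; field_simp
    rw [blowupMap, hd, inv_one, one_mul, coe_direction ((map_ne_zero _).2 hu0), Complex.norm_conj, hu]
    simp
  · rw [affChart_interior hu, affChart_interior hu, ofPoint_affPt, blowupMap, coe_affineHomeo]
    rw [one_mul, add_zero]
    rfl

end

/-! ### Biholomorphisms are affine -/

theorem differentiableAt_inv_locCoord_locPt {q y : OnePoint ℂ} (hy : y ≠ q) :
    DifferentiableAt ℂ (fun w => (locCoord q (locPt y w))⁻¹) 0 := by
  induction q using OnePoint.rec with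
  | infty =>
    induction y using OnePoint.rec with
    | infty => exact absurd rfl hy
    | coe b =>
      have : (fun w : ℂ => (locCoord OnePoint.infty (locPt (b : OnePoint ℂ) w))⁻¹) =
          fun w => b + w := by
        funext w
        simp [locPt, locCoord]
      rw [this]; fun_prop
  | coe a =>
    induction y using OnePoint.rec with
    | infty =>
      have : (fun w : ℂ => (locCoord (a : OnePoint ℂ) (locPt OnePoint.infty w))⁻¹) =
          fun w => w / (1 - a * w) := by
        funext w
        by_cases hw : w = 0
        · simp [hw, locPt, locCoord]
        · simp only [locPt, if_neg hw, locCoord]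
          rw [show w⁻¹ - a = (1 - a * w) / w by field_simp, inv_div]
      rw [this]
      exact DifferentiableAt.div (by fun_prop) (by fun_prop) (by simp)
    | coe b =>
      have hab : b - a ≠ 0 := sub_ne_zero.2 fun h => hy (by rw [h])
      have : (fun w : ℂ => (locCoord (a : OnePoint ℂ) (locPt (b : OnePoint ℂ) w))⁻¹) =
          fun w => (b + w - a)⁻¹ := by
        funext w
        simp [locPt, locCoord]
      rw [this]
      exact DifferentiableAt.inv (by fun_prop) (by simpa using hab)

/-- In affine coordinates `g` is entire. A nonzero derivative at the pole makes it grow linearly, so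
it is a polynomial of degree one with leading coefficient the inverse of that derivative. -/
theorem IsBiholomorphism.exists_affine {g : OnePoint ℂ ≃ₜ OnePoint ℂ} (hg : IsBiholomorphism g)
    {p q : OnePoint ℂ} (hpq : g p = q) :
    ∃ A B : ℂ, A ≠ 0 ∧ (∀ u, g (affPt p u) = affPt q (A * u + B)) ∧
      deriv (coordExpr g p q) 0 = A⁻¹ := by
  subst hpq
  set e : ℂ → ℂ := fun u => (locCoord (g p) (g (affPt p u)))⁻¹ with he
  have hne : ∀ u, g (affPt p u) ≠ g p := fun u h => affPt_ne p u (g.injective h)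
  have hge : ∀ u, affPt (g p) (e u) = g (affPt p u) := fun u => affPt_locCoord (hne u)
  have hdiff : Differentiable ℂ e := by
    intro u
    obtain ⟨h, h', h0, -, hd, heq, -⟩ := exists_chart_affPt p u
    set x := affPt p u with hx
    have hh : HasDerivAt h (h' 0) 0 := hd.self_of_nhds
    have ht : Tendsto h (𝓝 0) (𝓝 0) := by
      have := hh.continuousAt.tendsto
      rwa [h0] at this
    have h1 : DifferentiableAt ℂ (fun w => (locCoord (g p) (locPt (g x)
        (coordExpr g x (g x) (h w))))⁻¹) 0 := by
      have h2 : DifferentiableAt ℂ (fun w => coordExpr g x (g x) (h w)) 0 := by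
        refine DifferentiableAt.comp (g := coordExpr g x (g x)) (0 : ℂ) ?_ hh.differentiableAt
        rw [h0]; exact hg.1 x
      refine DifferentiableAt.comp (g := fun w => (locCoord (g p) (locPt (g x) w))⁻¹) (0 : ℂ) ?_ h2
      rw [h0, coordExpr_zero]
      exact differentiableAt_inv_locCoord_locPt (hne u)
    have h3 : DifferentiableAt ℂ (fun w => e (u + w)) 0 := by
      refine h1.congr_of_eventuallyEq ?_
      filter_upwards [heq, ht.eventually (locPt_coordExpr g x)] with w hw hw'
      rw [hw', ← hw]
    have h4 : DifferentiableAt ℂ (fun v => e (u + (v - u))) u := by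
      refine DifferentiableAt.comp (g := fun w => e (u + w)) u ?_ (by fun_prop)
      rw [sub_self]; exact h3
    simpa using h4
  set k := coordExpr g p (g p) with hk
  set κ := deriv k 0 with hκ
  have hκ0 : κ ≠ 0 := hg.deriv_ne_zero p
  have hk0 : k 0 = 0 := coordExpr_zero g p
  have hek : ∀ u ≠ 0, e u = (k u⁻¹)⁻¹ := fun u hu => by
    rw [he, hk, coordExpr, locPt_inv hu]
  have hlim : Tendsto (fun u => e u / u ^ 1) (Bornology.cobounded ℂ) (𝓝 κ⁻¹) := by
    have h1 : Tendsto (fun w => k w / w) (𝓝[≠] 0) (𝓝 κ) := by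
      have := (hg.1 p).hasDerivAt.tendsto_slope_zero
      simp only [zero_add, ← hk, hk0, sub_zero, smul_eq_mul] at this
      exact this.congr fun w => by rw [inv_mul_eq_div]
    have h2 := (h1.comp tendsto_inv₀_cobounded').inv₀ hκ0
    refine h2.congr' ?_
    filter_upwards [Bornology.eventually_ne_cobounded (0 : ℂ)] with u hu
    rw [Function.comp_apply, hek u hu, pow_one, inv_div, div_eq_mul_inv, div_eq_mul_inv, mul_comm]
  have hgrow : ∃ R, ∀ u, R ≤ ‖u‖ → ‖e u‖ ≤ (‖κ⁻¹‖ + 1) * ‖u‖ ^ 1 := by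
    have h1 : ∀ᶠ u in Bornology.cobounded ℂ, ‖e u / u ^ 1‖ < ‖κ⁻¹‖ + 1 :=
      hlim.norm.eventually_lt_const (lt_add_one _)
    have h2 := h1.and (Bornology.eventually_ne_cobounded (0 : ℂ))
    rw [← comap_norm_atTop, eventually_comap, eventually_atTop] at h2
    obtain ⟨R, hR⟩ := h2
    refine ⟨R, fun u hu => ?_⟩
    obtain ⟨h3, h4⟩ := hR ‖u‖ hu u rfl
    rw [norm_div, norm_pow, div_lt_iff₀ (by positivity)] at h3
    exact h3.le
  obtain ⟨R, hR⟩ := hgrow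
  obtain ⟨Q, hQ, heQ⟩ := exists_polynomial_of_growth 1 hdiff hR
  have hc : Q.coeff 1 = κ⁻¹ := by
    refine (natDegree_eq_of_tendsto hQ (inv_ne_zero hκ0) ?_).2
    exact hlim.congr fun u => by rw [heQ]
  refine ⟨κ⁻¹, Q.coeff 0, inv_ne_zero hκ0, fun u => ?_, (inv_inv κ).symm⟩
  rw [← hge, heQ, Polynomial.eq_X_add_C_of_natDegree_le_one hQ, hc]
  simp

/-! ### The polynomial of a framed differential -/

open Polynomial in
theorem eq_of_eventually_eval_inv_eq {P Q : ℂ[X]}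
    (h : ∀ᶠ w in 𝓝[≠] (0 : ℂ), P.eval w⁻¹ = Q.eval w⁻¹) : P = Q := by
  refine Polynomial.eq_of_infinite_eval_eq P Q ?_
  have h1 : {w : ℂ | P.eval w⁻¹ = Q.eval w⁻¹}.Infinite := by
    have h2 := infinite_of_mem_nhds (0 : ℂ) (insert_mem_nhds_iff.2 h)
    exact (h2.sdiff (Set.finite_singleton (0 : ℂ))).mono fun w hw => hw.1.resolve_left hw.2
  exact (h1.image inv_injective.injOn).mono (by rintro _ ⟨w, hw, rfl⟩; exact hw)

section
variable {n : ℕ} {M : Finset Circle} (x : FramedDifferential n M)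

open Polynomial in
/-- The polynomial `Q` such that the differential is `Q(u) du²` in the affine coordinate on the
complement of the pole. -/
def FramedDifferential.poly : ℂ[X] := (x.diff.exists_polynomial x.simple).choose

open FramedDifferential

theorem FramedDifferential.natDegree_poly : x.poly.natDegree = n + 1 :=
  (x.diff.exists_polynomial x.simple).choose_spec.1

theorem FramedDifferential.eval_derivative_poly_ne_zero {u : ℂ} (hu : x.poly.eval u = 0) :
    (Polynomial.derivative x.poly).eval u ≠ 0 :=
  (x.diff.exists_polynomial x.simple).choose_spec.2.1 u hu

theorem FramedDifferential.localCoeff_inv {u : ℂ} (hu : u ≠ 0) :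
    x.diff.localCoeff x.pole u⁻¹ = x.poly.eval u * u ^ 4 :=
  (x.diff.exists_polynomial x.simple).choose_spec.2.2 u hu

theorem FramedDifferential.coeff_poly_ne_zero : x.poly.coeff (n + 1) ≠ 0 := by
  rw [← x.natDegree_poly]
  refine Polynomial.leadingCoeff_ne_zero.2 fun h => ?_
  have := x.natDegree_poly
  rw [h, Polynomial.natDegree_zero] at this
  omega

variable {x}

theorem FramedDifferential.poly_eq {Q : Polynomial ℂ}
    (h : ∀ᶠ w in 𝓝[≠] (0 : ℂ), x.diff.localCoeff x.pole w = Q.eval w⁻¹ * w⁻¹ ^ 4) : x.poly = Q := by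
  refine eq_of_eventually_eval_inv_eq ?_
  filter_upwards [h, self_mem_nhdsWithin] with w hw hw0
  have hw0 : w ≠ 0 := hw0
  have h1 := x.localCoeff_inv (inv_ne_zero hw0)
  rw [inv_inv, hw] at h1
  exact (mul_right_cancel₀ (pow_ne_zero 4 (inv_ne_zero hw0)) h1).symm

-- Only the pullback identity near the pole is used: polynomials that agree near infinity are equal.
open Polynomial in
theorem QuadraticDifferential.IsPullback.poly_eq {x₁ x₂ : FramedDifferential n M}
    {g : OnePoint ℂ ≃ₜ OnePoint ℂ} (hg : QuadraticDifferential.IsPullback g x₂.diff x₁.diff)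
    (hp : g x₁.pole = x₂.pole) {A B : ℂ} (hA : A ≠ 0)
    (hAB : ∀ u, g (affPt x₁.pole u) = affPt x₂.pole (A * u + B)) :
    x₁.poly = C (A ^ 2) * x₂.poly.comp (C A * X + C B) := by
  have hD : ∀ᶠ w : ℂ in 𝓝 0, A + B * w ≠ 0 :=
    ContinuousAt.eventually_ne (by fun_prop) (by simpa using hA)
  have hk : coordExpr g x₁.pole x₂.pole =ᶠ[𝓝 0] fun w => w / (A + B * w) := by
    filter_upwards [hD] with w hw
    by_cases h0 : w = 0
    · rw [coordExpr, h0, locPt_zero, hp, locCoord_self, zero_div]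
    · rw [coordExpr, ← affPt_inv h0, hAB, locCoord_affPt]
      field_simp
  have hk' : ∀ᶠ w in 𝓝 0, deriv (coordExpr g x₁.pole x₂.pole) w = A / (A + B * w) ^ 2 := by
    filter_upwards [hk.eventuallyEq_nhds, hD] with w he hw
    rw [he.deriv_eq]
    refine (((hasDerivAt_id w).div (((hasDerivAt_id w).const_mul B).const_add A) hw).congr_deriv
      ?_).deriv
    simp only [id]
    field_simp
    ring
  have h1 := hg x₁.pole
  rw [hp] at h1
  refine FramedDifferential.poly_eq ?_
  filter_upwards [h1, nhdsWithin_le_nhds hk, nhdsWithin_le_nhds hk', nhdsWithin_le_nhds hD,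
    self_mem_nhdsWithin] with w h2 h3 h4 h5 h6
  have h6 : w ≠ 0 := h6
  have h7 : w / (A + B * w) = (A * w⁻¹ + B)⁻¹ := by field_simp
  have h8 : A * w⁻¹ + B = (A + B * w) / w := by field_simp
  have h9 : A * w⁻¹ + B ≠ 0 := by rw [h8]; exact div_ne_zero h5 h6
  rw [h2, h3, h4, h7, x₂.localCoeff_inv h9]
  simp only [eval_mul, eval_C, eval_comp, eval_add, eval_X]
  generalize x₂.poly.eval (A * w⁻¹ + B) = E
  rw [h8]
  generalize A + B * w = D at h5 ⊢
  field_simp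

end

/-! ### Normalizations of framed differentials -/

open Polynomial in
/-- The affine change of coordinate `u = α z + β` brings `x` into normal form, with coefficient
vector `a`. -/
structure Normalizes {n : ℕ} {M : Finset Circle} (f₀ : Fin (n + 3) → Circle)
    (x : FramedDifferential n M) (a : Fin n → ℂ) (α β : ℂ) : Prop where
  ne_zero : α ≠ 0
  poly_eq : centredPoly a = C (α ^ 2) * x.poly.comp (C α * X + C β)
  framing_eq : ∀ k : Fin (n + 3),
    x.framing (RealBlowup.dir (direction α⁻¹ *
      Circle.exp (-(2 * Real.pi * (k : ℝ) / ((n : ℝ) + 3))))) = bdry (f₀ k)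

theorem bdry_injective : Function.Injective bdry := fun _ _ h =>
  Circle.ext (congrArg (fun x : Disk => (x : ℂ)) h)

section
variable {n : ℕ} {M : Finset Circle} {f₀ : Fin (n + 3) → Circle} {x : FramedDifferential n M}
  {a : Fin n → ℂ} {α β : ℂ}

theorem FramedDifferential.ncard_distinguishedDirections (hM : M.card = n + 3) :
    (x.diff.distinguishedDirections x.pole).ncard = n + 3 := by
  rw [← hM, ← Set.ncard_coe_finset, ← Set.ncard_image_of_injective (M : Set Circle) bdry_injective,
    ← x.marked.image_eq, Set.InjOn.ncard_image x.marked.injOn]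

theorem IsCyclicLabelling.injective (hf₀ : IsCyclicLabelling M f₀) : Function.Injective f₀ := by
  obtain ⟨⟨t, ht, ht2, hft⟩, -⟩ := hf₀
  intro i j h
  rw [hft, hft] at h
  exact ht.injective (exp_injOn (c := t 0) h ⟨ht.monotone (Fin.zero_le i), ht2 0 i⟩
    ⟨ht.monotone (Fin.zero_le j), ht2 0 j⟩)

theorem IsCyclicLabelling.card_eq (hf₀ : IsCyclicLabelling M f₀) : M.card = n + 3 := by
  rw [← Set.ncard_coe_finset, ← hf₀.2, ← Set.image_univ,
    Set.ncard_image_of_injective _ hf₀.injective, Set.ncard_univ, Nat.card_fin]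

/-- The inclusion in the solution set comes from asymptotics of trajectories. Equality follows by
counting: the framing matches the directions with the `n + 3` marked points, and the equation has at
most `n + 3` solutions. -/
theorem FramedDifferential.distinguishedDirections_eq (hM : M.card = n + 3)
    (hα : x.poly.coeff (n + 1) * α ^ (n + 3) = 1) :
    x.diff.distinguishedDirections x.pole =
      {v : Circle | ((v * direction α : Circle) : ℂ) ^ (n + 3) = 1} := by
  have hα0 : α ≠ 0 := by
    rintro rfl
    rw [zero_pow (by omega), mul_zero] at hα
    exact zero_ne_one hα
  have hN : n + 3 ≠ 0 := by omega
  set e : Fin (n + 3) → Circle := fun k =>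
    (direction α)⁻¹ * Circle.exp (-(2 * Real.pi * (k : ℝ) / ((n + 3 : ℕ) : ℝ))) with he
  have hsub : {v : Circle | ((v * direction α : Circle) : ℂ) ^ (n + 3) = 1} ⊆ Set.range e := by
    intro v hv
    obtain ⟨k, hk⟩ := exists_eq_exp_of_pow_eq_one hN hv
    exact ⟨k, by rw [he]; simp only; rw [← hk, mul_comm v, inv_mul_cancel_left]⟩
  refine Set.eq_of_subset_of_ncard_le (fun v hv => ?_) ?_ ((Set.finite_range e).subset hsub)
  · obtain ⟨r, hr, he⟩ := QuadraticDifferential.pow_pos_of_mem_distinguishedDirections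
      x.natDegree_poly (fun u hu => x.localCoeff_inv hu) hv
    set y : Circle := (v * direction α) ^ (n + 3) with hy
    have hyc : (y : ℂ) = ((v * direction α : Circle) : ℂ) ^ (n + 3) := rfl
    have hαn : 0 < ‖α‖ := norm_pos_iff.2 hα0
    have h1 : (((r * ‖α‖ ^ (n + 3) : ℝ) : ℂ)) * (y : ℂ) = 1 := by
      rw [hyc, Circle.coe_mul, coe_direction hα0, Complex.ofReal_mul, ← he, mul_pow, div_pow, inv_pow,
        Complex.ofReal_pow]
      have hv0 : (v : ℂ) ≠ 0 := Circle.coe_ne_zero v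
      have hn0 : (‖α‖ : ℂ) ≠ 0 := by exact_mod_cast hαn.ne'
      field_simp
      exact hα
    have h2 := congrArg norm h1
    rw [norm_mul, Circle.norm_coe, mul_one, Complex.norm_real, Real.norm_of_nonneg (by positivity),
      norm_one] at h2
    rw [h2, Complex.ofReal_one, one_mul] at h1
    exact hyc.symm.trans h1
  · rw [x.ncard_distinguishedDirections hM]
    refine (Set.ncard_le_ncard hsub (Set.finite_range e)).trans ?_
    rw [← Set.image_univ]
    refine (Set.ncard_image_le Set.finite_univ).trans ?_
    rw [Set.ncard_univ, Nat.card_fin]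

open Polynomial in
theorem normalizes_of_coeff (hα : x.poly.coeff (n + 1) * α ^ (n + 3) = 1)
    (hβ : x.poly.coeff n + x.poly.coeff (n + 1) * ((n + 1) * β) = 0)
    (hk : ∀ k : Fin (n + 3), x.framing (RealBlowup.dir (direction α⁻¹ *
      Circle.exp (-(2 * Real.pi * (k : ℝ) / ((n : ℝ) + 3))))) = bdry (f₀ k)) :
    Normalizes f₀ x
      (fun i : Fin n => (C (α ^ 2) * x.poly.comp (C α * X + C β)).coeff i) α β := by
  obtain ⟨h1, h2, h3⟩ := coeff_comp_affine x.natDegree_poly.le α β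
  refine ⟨?_, (eq_centredPoly ((natDegree_C_mul_le _ _).trans h1) ?_ ?_).symm, hk⟩
  · rintro rfl
    rw [zero_pow (by omega), mul_zero] at hα
    exact zero_ne_one hα
  · rw [coeff_C_mul, h2, ← hα]; ring
  · rw [coeff_C_mul, h3]
    linear_combination α ^ 2 * α ^ n * hβ

theorem Normalizes.coeff (h : Normalizes f₀ x a α β) :
    x.poly.coeff (n + 1) * α ^ (n + 3) = 1 ∧
      x.poly.coeff n + x.poly.coeff (n + 1) * ((n + 1) * β) = 0 := by
  obtain ⟨h1, h2, h3⟩ := coeff_comp_affine x.natDegree_poly.le α β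
  constructor
  · have := coeff_centredPoly_succ a
    rw [h.poly_eq, Polynomial.coeff_C_mul, h2] at this
    rw [← this]; ring
  · have := coeff_centredPoly_self a
    rw [h.poly_eq, Polynomial.coeff_C_mul, h3] at this
    have h4 : α ^ (n + 2) ≠ 0 := pow_ne_zero _ h.ne_zero
    refine mul_left_cancel₀ h4 ?_
    rw [mul_zero, ← this]; ring

open Polynomial in
theorem Normalizes.notMem_discriminantLocus (h : Normalizes f₀ x a α β) :
    a ∉ discriminantLocus n := by
  rw [mem_discriminantLocus_iff]
  rintro ⟨z, h0, h1⟩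
  have hα := h.ne_zero
  rw [h.poly_eq] at h0 h1
  simp only [eval_mul, eval_C, eval_comp, eval_add, eval_X, derivative_mul, derivative_C, zero_mul,
    zero_add, derivative_comp, derivative_add, derivative_X, mul_one, add_zero] at h0 h1
  refine x.eval_derivative_poly_ne_zero (u := α * z + β) ?_ ?_
  · exact (mul_eq_zero.1 h0).resolve_left (pow_ne_zero 2 hα)
  · simpa [hα] using h1

/-- The leading coefficient fixes `‖α‖`, the preimage of the marked point `f₀ 0` fixes the direction
of `α`, and the subleading coefficient fixes `β`. -/
theorem Normalizes.unique {a' : Fin n → ℂ} {α' β' : ℂ} (h : Normalizes f₀ x a α β)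
    (h' : Normalizes f₀ x a' α' β') : a = a' := by
  obtain ⟨h1, h2⟩ := h.coeff
  obtain ⟨h1', h2'⟩ := h'.coeff
  have hc := x.coeff_poly_ne_zero
  have hnorm : ‖α‖ = ‖α'‖ := by
    have := congrArg norm (mul_left_cancel₀ hc (h1.trans h1'.symm))
    rw [norm_pow, norm_pow] at this
    exact (pow_left_inj₀ (norm_nonneg _) (norm_nonneg _) (by omega)).1 this
  have hdir : direction α⁻¹ = direction α'⁻¹ := by
    have h3 := x.diffeo.bijective.1 ((h.framing_eq 0).trans (h'.framing_eq 0).symm)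
    injection h3 with h3
    exact mul_right_cancel h3
  have hα : α = α' := by
    rw [direction_inv h.ne_zero, direction_inv h'.ne_zero, inv_inj] at hdir
    rw [← norm_mul_direction α, ← norm_mul_direction α', hnorm, hdir]
  have hβ : β = β' := by
    have hn : (n : ℂ) + 1 ≠ 0 := by exact_mod_cast Nat.succ_ne_zero n
    exact mul_left_cancel₀ hn (mul_left_cancel₀ hc (add_left_cancel (h2.trans h2'.symm)))
  refine centredPoly_injective ?_
  rw [h.poly_eq, h'.poly_eq, hα, hβ]

/-- Any root `α₀` makes the polynomial monic. Rotating it by a root of unity sends the positive ray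
to the direction labelled `f₀ 0`, and the remaining labels follow from cyclic order. -/
theorem exists_normalizes (hf₀ : IsCyclicLabelling M f₀) (x : FramedDifferential n M) :
    ∃ a α β, Normalizes f₀ x a α β := by
  have hc := x.coeff_poly_ne_zero
  obtain ⟨α₀, hα₀⟩ := IsAlgClosed.exists_pow_nat_eq (x.poly.coeff (n + 1))⁻¹
    (show 0 < n + 3 by omega)
  have hα₀' : x.poly.coeff (n + 1) * α₀ ^ (n + 3) = 1 := by rw [hα₀, mul_inv_cancel₀ hc]
  have hα₀0 : α₀ ≠ 0 := by
    rintro rfl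
    rw [zero_pow (by omega), mul_zero] at hα₀'
    exact zero_ne_one hα₀'
  have hdist := x.distinguishedDirections_eq hf₀.card_eq hα₀'
  have hmem : bdry (f₀ 0) ∈ bdry '' (M : Set Circle) :=
    Set.mem_image_of_mem _ (hf₀.2 ▸ Set.mem_range_self 0)
  obtain ⟨v₀, hv₀, hv₀f⟩ := x.marked.surjOn hmem
  simp only at hv₀f
  rw [hdist] at hv₀
  have hv₀ : ((v₀ * direction α₀ : Circle) : ℂ) ^ (n + 3) = 1 := hv₀
  -- The correction is an `(n + 3)`rd root of unity, chosen so that `direction α⁻¹ = v₀`.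
  set α : ℂ := α₀ * ((v₀ * direction α₀)⁻¹ : Circle) with hα
  have hα0 : α ≠ 0 := mul_ne_zero hα₀0 (Circle.coe_ne_zero _)
  have hdir : direction α⁻¹ = v₀ := by
    rw [direction_inv hα0, hα, direction_mul hα₀0 (Circle.coe_ne_zero _), direction_coe]
    simp [mul_comm]
  have hα1 : x.poly.coeff (n + 1) * α ^ (n + 3) = 1 := by
    rw [hα, mul_pow, Circle.coe_inv, inv_pow, hv₀, inv_one, mul_one, hα₀']
  obtain ⟨ℓ, hℓc, hℓm, hℓp, hℓ⟩ := x.diffeo.exists_boundary_lift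
  set θ₁ : ℝ := -Complex.arg (v₀ : ℂ) with hθ₁
  have hv : ∀ k : Fin (n + 3), v₀ * Circle.exp (-(2 * Real.pi * (k : ℝ) / ((n : ℝ) + 3))) =
      Circle.exp (-(θ₁ + 2 * Real.pi * k / ((n : ℝ) + 3))) := fun k => by
    rw [hθ₁, neg_add, neg_neg, Circle.exp_add, Circle.exp_arg]
  have hfv : ∀ k : Fin (n + 3), x.framing (RealBlowup.dir
      (v₀ * Circle.exp (-(2 * Real.pi * (k : ℝ) / ((n : ℝ) + 3))))) =
      bdry (Circle.exp (ℓ (θ₁ + 2 * Real.pi * k / ((n : ℝ) + 3)))) := fun k => by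
    rw [hv, hℓ]
  have hlab := lift_eq_labelling hf₀ hℓm hℓp (θ₁ := θ₁) (by
    apply bdry_injective
    rw [← hℓ, ← hv₀f, hθ₁, neg_neg, Circle.exp_arg]) (fun k => by
    have hd : v₀ * Circle.exp (-(2 * Real.pi * (k : ℝ) / ((n : ℝ) + 3))) ∈
        x.diff.distinguishedDirections x.pole := by
      rw [hdist]
      change ((_ * _ * _ : Circle) : ℂ) ^ (n + 3) = 1
      rw [mul_right_comm, Circle.coe_mul, mul_pow, hv₀, one_mul]
      have := exp_pow_eq_one (N := n + 3) (by omega) k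
      rwa [Nat.cast_add, Nat.cast_ofNat] at this
    obtain ⟨m, hm, he⟩ := x.marked.mapsTo hd
    simp only at he
    rw [hfv] at he
    rw [← bdry_injective he]; exact hm)
  have hn : (n : ℂ) + 1 ≠ 0 := by exact_mod_cast Nat.succ_ne_zero n
  refine ⟨_, α, -x.poly.coeff n / (x.poly.coeff (n + 1) * (n + 1)), normalizes_of_coeff hα1 ?_ ?_⟩
  · field_simp; ring
  · intro k
    rw [hdir, hfv, hlab]

open Polynomial in
theorem Equivalent.normalizes {x₁ x₂ : FramedDifferential n M} (hf₀ : Set.range f₀ = (M : Set Circle))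
    (he : Equivalent x₁ x₂) (h : Normalizes f₀ x₁ a α β) : ∃ α' β', Normalizes f₀ x₂ a α' β' := by
  obtain ⟨g, hg, hp, hpb, H, -, -, hHM, hH1⟩ := he
  obtain ⟨A, B, hA, hAB, hd⟩ := hg.exists_affine hp
  have hpoly := hpb.poly_eq hp hA hAB
  have hα := h.ne_zero
  refine ⟨A * α, A * β + B, mul_ne_zero hA hα, ?_, fun k => ?_⟩
  · rw [h.poly_eq, hpoly]
    refine Polynomial.funext fun z => ?_
    simp only [eval_mul, eval_C, eval_comp, eval_add, eval_X]
    rw [show A * (α * z + β) + B = A * α * z + (A * β + B) by ring]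
    ring
  · have h1 := hH1 (RealBlowup.dir (direction α⁻¹ *
      Circle.exp (-(2 * Real.pi * (k : ℝ) / ((n : ℝ) + 3)))))
    rw [h.framing_eq k, hHM 1 _ (by
      have : f₀ k ∈ (M : Set Circle) := hf₀ ▸ Set.mem_range_self k
      exact this), Function.comp_apply, blowupMap, hd, direction_mul (inv_ne_zero hA)
      (Circle.coe_ne_zero _), direction_coe, ← mul_assoc,
      ← direction_mul (inv_ne_zero hA) (inv_ne_zero hα), ← mul_inv] at h1
    exact h1

theorem IsNormalForm.normalizes (h : IsNormalForm f₀ x a) : Normalizes f₀ x a 1 0 := by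
  obtain ⟨hp, hc, hk⟩ := h
  refine ⟨one_ne_zero, ?_, fun k => ?_⟩
  · have : x.poly = centredPoly a := by
      refine FramedDifferential.poly_eq ?_
      filter_upwards [self_mem_nhdsWithin] with w hw
      have hw : w ≠ 0 := hw
      rw [hp, QuadraticDifferential.localCoeff_infty, ← hc, x.diff.coeff_inv hw]
      field_simp
    rw [this]; simp
  · rw [inv_one, show (1 : ℂ) = ((1 : Circle) : ℂ) from rfl, direction_coe, one_mul]
    exact hk k

/-- The required biholomorphism is `z ↦ α z + β`. Transported to the disk, the two framings have
boundary lifts that hit the same marked points in the same order, hence are isotopic. -/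
theorem IsNormalForm.equivalent {y : FramedDifferential n M} (hf₀ : Set.range f₀ = (M : Set Circle))
    (hy : IsNormalForm f₀ y a) (hx : Normalizes f₀ x a α β) : Equivalent y x := by
  obtain ⟨φ, p, hφ, f, hf, hfM⟩ := y
  obtain ⟨hp, hc, hk⟩ := hy
  simp only at hp hc hk
  subst hp
  have hα := hx.ne_zero
  refine ⟨affineHomeo x.pole β hα, isBiholomorphism_affineHomeo hα, rfl,
    isPullback_affineHomeo hα fun z hz => ?_, ?_⟩
  · rw [x.localCoeff_inv hz, hc, hx.poly_eq]
    simp only [Polynomial.eval_mul, Polynomial.eval_C, Polynomial.eval_comp, Polynomial.eval_add,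
      Polynomial.eval_X]
    field_simp
  obtain ⟨ℓ₁, hc₁, hm₁, hp₁, hℓ₁⟩ := hf.exists_boundary_lift
  obtain ⟨ℓ₂, hc₂, hm₂, hp₂, hℓ₂⟩ := x.diffeo.exists_boundary_lift
  set τ : ℝ := Complex.arg α⁻¹ with hτ
  have hτ' : Circle.exp τ = direction α⁻¹ := rfl
  have hone : Circle.exp 0 = direction (1 : ℂ)⁻¹ := by
    rw [inv_one, show (1 : ℂ) = ((1 : Circle) : ℂ) from rfl, direction_coe, Circle.exp_zero]
  have hF₁ : ∀ θ, f (affChart OnePoint.infty 1 0 (bdry (Circle.exp θ))) =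
      bdry (Circle.exp (ℓ₁ θ)) := fun θ => by
    rw [affChart_bdry_exp one_ne_zero hone, sub_zero, hℓ₁]
  have hF₂ : ∀ θ, x.framing (affChart x.pole α β (bdry (Circle.exp θ))) =
      bdry (Circle.exp (ℓ₂ (θ - τ))) := fun θ => by
    rw [affChart_bdry_exp hα hτ', hℓ₂]
  -- The lift of the second framing is shifted by the argument of `α⁻¹`, because the affine map
  -- rotates directions at the pole.
  obtain ⟨H, hH, hH0, hHM, hH1⟩ := exists_isotopy_of_lifts (ℓ₂ := fun θ => ℓ₂ (θ - τ)) hf₀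
    (hf.continuous_comp_affChart one_ne_zero 0)
    (hf.bijective.comp (bijective_affChart OnePoint.infty one_ne_zero 0))
    (x.diffeo.continuous_comp_affChart hα β) (x.diffeo.bijective.comp (bijective_affChart _ hα β))
    hc₁ hm₁ hp₁ (hc₂.comp (continuous_id.sub continuous_const))
    (fun s t hst => hm₂ (sub_lt_sub_right hst τ))
    (fun θ => by rw [add_sub_right_comm, hp₂]) hF₁ hF₂
    (fun k => by
      apply bdry_injective
      rw [← hℓ₁, hk])
    (fun k => by
      apply bdry_injective
      rw [← hℓ₂, ← hx.framing_eq k, neg_sub, sub_eq_add_neg, Circle.exp_add, hτ'])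
  refine ⟨H, hH, hH0, hHM, fun w => ?_⟩
  obtain ⟨u, rfl⟩ := (bijective_affChart OnePoint.infty one_ne_zero 0).2 w
  rw [← hH1, Function.comp_apply]
  exact congrArg x.framing (blowupMap_affineHomeo hα u)

end

/-! ### Families with moving pole -/

open Classical in
/-- For a pole at the point with local coordinate `ε` centred at `p`, and the coordinate `v` with
`ε + 1/v` the local coordinate centred at `p`, the affine coordinate at the pole is
`poleScale p ε * v + poleShift p ε`. -/
def poleScale : OnePoint ℂ → ℂ → ℂ
  | OnePoint.infty, ε => if ε = 0 then 1 else -ε ^ 2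
  | OnePoint.some _, _ => 1

/-- See `poleScale`. -/
def poleShift : OnePoint ℂ → ℂ → ℂ
  | OnePoint.infty, ε => -ε
  | OnePoint.some _, _ => 0

theorem poleScale_zero (p : OnePoint ℂ) : poleScale p 0 = 1 := by
  induction p using OnePoint.rec with
  | infty => simp [poleScale]
  | coe a => rfl

theorem poleScale_infty {ε : ℂ} (hε : ε ≠ 0) : poleScale OnePoint.infty ε = -ε ^ 2 := if_neg hε

theorem poleShift_infty (ε : ℂ) : poleShift OnePoint.infty ε = -ε := rfl

theorem poleScale_ne_zero (p : OnePoint ℂ) (ε : ℂ) : poleScale p ε ≠ 0 := by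
  induction p using OnePoint.rec with
  | infty =>
    by_cases h : ε = 0
    · simp [poleScale, h]
    · simp [poleScale, h]
  | coe a => exact one_ne_zero

theorem deriv_locCoord_locPt (p : OnePoint ℂ) (ε : ℂ) :
    deriv (fun w => locCoord (locPt p ε) (locPt p (ε + w))) 0 = (poleScale p ε)⁻¹ := by
  have hid : ∀ f : ℂ → ℂ, (∀ w, f w = w) → deriv f 0 = (1 : ℂ)⁻¹ := fun f hf => by
    rw [show f = id from funext hf, deriv_id, inv_one]
  induction p using OnePoint.rec with
  | infty =>
    by_cases h : ε = 0
    · rw [h, poleScale_zero, locPt_zero]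
      refine hid _ fun w => ?_
      rw [zero_add, locCoord_locPt]
    · have hev : (fun w => locCoord (locPt OnePoint.infty ε) (locPt OnePoint.infty (ε + w)))
          =ᶠ[𝓝 0] fun w => (ε + w)⁻¹ - ε⁻¹ := by
        have : ∀ᶠ w : ℂ in 𝓝 0, ε + w ≠ 0 :=
          ContinuousAt.eventually_ne (by fun_prop) (by simpa using h)
        filter_upwards [this] with w hw
        simp only [locPt, if_neg h, if_neg hw, locCoord]
      rw [hev.deriv_eq]
      have hd : HasDerivAt (fun w : ℂ => (ε + w)⁻¹ - ε⁻¹) (-1 / (ε + 0) ^ 2) 0 :=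
        (((hasDerivAt_id (0 : ℂ)).const_add ε).inv (by simpa using h)).sub_const _
      rw [hd.deriv, poleScale_infty h, add_zero, inv_neg, neg_div, one_div]
  | coe a =>
    refine hid _ fun w => ?_
    simp only [locPt, locCoord]
    ring

theorem polarAt_zero (p : OnePoint ℂ) (ε : ℂ) (θ : ℝ) :
    polarAt p (locPt p ε) 0 θ =
      RealBlowup.dir (direction ((poleScale p ε)⁻¹ * (Circle.exp θ : ℂ))) := by
  rw [polarAt, if_pos le_rfl, locCoord_locPt, deriv_locCoord_locPt]

section
variable {n : ℕ} {M : Finset Circle}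

/-- Substitute `u = A v + B` in `Q(u) du²` and pass from `v` to the fixed local coordinate `ε +
1/v`; the factor `v⁴` comes from `d(1/v)²`. -/
theorem FramedDifferential.localCoeff_of_pole_eq (x : FramedDifferential n M) {p : OnePoint ℂ}
    {ε v : ℂ} (hp : x.pole = locPt p ε) (hv : v ≠ 0) (hεv : ε + v⁻¹ ≠ 0) :
    x.diff.localCoeff p (ε + v⁻¹) =
      poleScale p ε ^ 2 * x.poly.eval (poleScale p ε * v + poleShift p ε) * v ^ 4 := by
  induction p using OnePoint.rec with
  | infty =>
    by_cases h : ε = 0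
    · subst h
      rw [poleScale_zero, poleShift_infty, one_pow, one_mul, one_mul, neg_zero, add_zero, zero_add,
        ← x.localCoeff_inv hv, hp, locPt_zero]
    · have hu : -ε ^ 2 * v + -ε ≠ 0 := by
        rw [show -ε ^ 2 * v + -ε = -ε * v * (ε + v⁻¹) by field_simp; ring]
        exact mul_ne_zero (mul_ne_zero (neg_ne_zero.2 h) hv) hεv
      have h1 := x.localCoeff_inv hu
      rw [hp] at h1
      simp only [locPt, if_neg h] at h1
      rw [QuadraticDifferential.localCoeff_coe] at h1
      have h2 : ε⁻¹ + (-ε ^ 2 * v + -ε)⁻¹ = (ε + v⁻¹)⁻¹ := by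
        have h3 : ε * v + 1 ≠ 0 := by
          rw [show ε * v + 1 = v * (ε + v⁻¹) by field_simp]
          exact mul_ne_zero hv hεv
        rw [show -ε ^ 2 * v + -ε = -ε * (ε * v + 1) by ring,
          show ε + v⁻¹ = (ε * v + 1) / v by field_simp]
        field_simp
        ring
      rw [h2, x.diff.coeff_inv hεv] at h1
      have h4 : (ε + v⁻¹) ^ 4 ≠ 0 := pow_ne_zero 4 hεv
      rw [QuadraticDifferential.localCoeff_infty, poleScale_infty h, poleShift_infty]
      refine mul_right_cancel₀ h4 (h1.trans ?_)
      rw [show (-ε ^ 2 * v + -ε) ^ 4 = ε ^ 4 * v ^ 4 * (ε + v⁻¹) ^ 4 by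
        rw [show -ε ^ 2 * v + -ε = -ε * v * (ε + v⁻¹) by field_simp; ring]; ring]
      ring
  | coe a =>
    have h1 := x.localCoeff_inv hv
    rw [hp] at h1
    change x.diff.coeff (a + ε + v⁻¹) = _ at h1
    rw [QuadraticDifferential.localCoeff_coe, ← add_assoc, h1]
    simp [poleScale, poleShift]

variable {m : ℕ} {V : Set (Fin m → ℂ)} {x : (Fin m → ℂ) → FramedDifferential n M}
  {b₀ : Fin m → ℂ}

/-- Holomorphy is given in the coordinate centred at the regular point; this transfers it to the
fixed coordinate centred at the initial pole, evaluated at a moving point. -/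
theorem IsHolomorphicFamily.differentiableAt_localCoeff (hx : IsHolomorphicFamily V x)
    (hb₀ : b₀ ∈ V) {ε : (Fin m → ℂ) → ℂ} (hε : DifferentiableAt ℂ ε b₀) (hε0 : ε b₀ = 0) {w₀ : ℂ}
    (hw₀ : w₀ ≠ 0) :
    DifferentiableAt ℂ (fun b => (x b).diff.localCoeff (x b₀).pole (ε b + w₀)) b₀ := by
  have hd := hx.diff_holomorphic b₀ hb₀ (locPt (x b₀).pole w₀) (locPt_ne hw₀)
  generalize (x b₀).pole = p at hd ⊢
  induction p using OnePoint.rec with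
  | infty =>
    have hne : ∀ᶠ b in 𝓝 b₀, ε b + w₀ ≠ 0 :=
      (hε.continuousAt.add continuousAt_const).eventually_ne (by simpa [hε0] using hw₀)
    have h0 : ε b₀ + w₀ ≠ 0 := hne.self_of_nhds
    have hk : DifferentiableAt ℂ (fun b => (ε b + w₀)⁻¹ - w₀⁻¹) b₀ :=
      ((hε.add_const w₀).inv h0).sub_const _
    have h1 : DifferentiableAt ℂ (fun b => (x b).diff.localCoeff (locPt OnePoint.infty w₀)
        ((ε b + w₀)⁻¹ - w₀⁻¹)) b₀ := by
      refine DifferentiableAt.comp (g := fun y : (Fin m → ℂ) × ℂ =>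
        (x y.1).diff.localCoeff (locPt OnePoint.infty w₀) y.2) b₀ ?_ (differentiableAt_id.prodMk hk)
      simp only [id, hε0, zero_add, sub_self]
      exact hd
    refine (h1.mul (((hε.add_const w₀).inv h0).pow 4)).congr_of_eventuallyEq ?_
    filter_upwards [hne] with b hb
    change (x b).diff.localCoeff OnePoint.infty (ε b + w₀) =
      (x b).diff.localCoeff (locPt OnePoint.infty w₀) ((ε b + w₀)⁻¹ - w₀⁻¹) * (ε b + w₀)⁻¹ ^ 4
    simp only [locPt, if_neg hw₀]
    rw [QuadraticDifferential.localCoeff_coe, QuadraticDifferential.localCoeff_infty,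
      add_sub_cancel, (x b).diff.coeff_inv hb]
    field_simp
  | coe a =>
    have h1 : DifferentiableAt ℂ (fun b => (x b).diff.localCoeff (locPt (a : OnePoint ℂ) w₀)
        (ε b)) b₀ := by
      refine DifferentiableAt.comp (g := fun y : (Fin m → ℂ) × ℂ =>
        (x y.1).diff.localCoeff (locPt (a : OnePoint ℂ) w₀) y.2) b₀ ?_ (differentiableAt_id.prodMk hε)
      simp only [id, hε0]
      exact hd
    refine h1.congr_of_eventuallyEq (Eventually.of_forall fun b => ?_)
    change (x b).diff.coeff (a + (ε b + w₀)) = (x b).diff.coeff (a + w₀ + ε b)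
    congr 1; ring

theorem exists_root_near_one {s : (Fin m → ℂ) → ℂ} (hs : DifferentiableAt ℂ s b₀) (hs1 : s b₀ = 1)
    {N : ℕ} (hN : N ≠ 0) :
    ∃ S : (Fin m → ℂ) → ℂ, DifferentiableAt ℂ S b₀ ∧ S b₀ = 1 ∧ ∀ᶠ b in 𝓝 b₀, S b ^ N = s b := by
  have hN' : (N : ℂ) ≠ 0 := by exact_mod_cast hN
  refine ⟨fun b => Complex.exp (Complex.log (s b) / N), ?_, by simp [hs1], ?_⟩
  · simp only [div_eq_mul_inv]
    refine ((hs.clog ?_).mul_const _).cexp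
    rw [hs1]; exact Complex.one_mem_slitPlane
  · filter_upwards [hs.continuousAt.eventually_ne (by rw [hs1]; exact one_ne_zero)] with b hb
    rw [← Complex.exp_nat_mul, mul_div_cancel₀ _ hN', Complex.exp_log hb]

variable {f₀ : Fin (n + 3) → Circle}

open Polynomial in
theorem IsHolomorphicFamily.differentiableAt (hf₀ : Function.Injective f₀) (hV : IsOpen V)
    (hx : IsHolomorphicFamily V x) (hb₀ : b₀ ∈ V) {a : (Fin m → ℂ) → Fin n → ℂ}
    {α β : (Fin m → ℂ) → ℂ} (h : ∀ b ∈ V, Normalizes f₀ (x b) (a b) (α b) (β b)) :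
    DifferentiableAt ℂ a b₀ := by
  set p := (x b₀).pole with hp
  set ε : (Fin m → ℂ) → ℂ := fun b => locCoord p (x b).pole with hε
  have hεd : DifferentiableAt ℂ ε b₀ := hx.pole_holomorphic b₀ hb₀
  have hε0 : ε b₀ = 0 := locCoord_self p
  have hVe : ∀ᶠ b in 𝓝 b₀, b ∈ V := hV.mem_nhds hb₀
  have hpole : ∀ᶠ b in 𝓝 b₀, (x b).pole = locPt p (ε b) := by
    filter_upwards [(hx.pole_continuous b₀ hb₀).eventually (locPt_locCoord_eventually p)] with b hb
    exact hb.symm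
  -- When the pole passes through `∞` the affine coordinate jumps, so neither the polynomial nor `α`
  -- need vary continuously. The coordinate `v` does not jump, and `R b` is the polynomial of the
  -- differential in `v`.
  set A : (Fin m → ℂ) → ℂ := fun b => poleScale p (ε b) with hA
  set B : (Fin m → ℂ) → ℂ := fun b => poleShift p (ε b) with hB
  have hA0 : ∀ b, A b ≠ 0 := fun b => poleScale_ne_zero p _
  set R : (Fin m → ℂ) → ℂ[X] := fun b => C (A b ^ 2) * (x b).poly.comp (C (A b) * X + C (B b))
    with hR
  have hRc : ∀ b, (R b).natDegree ≤ n + 1 ∧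
      (R b).coeff (n + 1) = (x b).poly.coeff (n + 1) * A b ^ (n + 3) ∧
      (R b).coeff n = A b ^ (n + 2) * ((x b).poly.coeff n +
        (x b).poly.coeff (n + 1) * ((n + 1) * B b)) := by
    intro b
    obtain ⟨h1, h2, h3⟩ := coeff_comp_affine (x b).natDegree_poly.le (A b) (B b)
    refine ⟨(natDegree_C_mul_le _ _).trans h1, ?_, ?_⟩
    · rw [hR]; simp only; rw [coeff_C_mul, h2]; ring
    · rw [hR]; simp only; rw [coeff_C_mul, h3]; ring
  have hReval : ∀ b v, (R b).eval v = A b ^ 2 * (x b).poly.eval (A b * v + B b) := fun b v => by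
    simp only [hR, eval_mul, eval_C, eval_comp, eval_add, eval_X]
  have hRd : ∀ v ≠ 0, DifferentiableAt ℂ (fun b => (R b).eval v) b₀ := by
    intro v hv
    refine ((hx.differentiableAt_localCoeff hb₀ hεd hε0 (inv_ne_zero hv)).mul_const
      (v ^ 4)⁻¹).congr_of_eventuallyEq ?_
    have hne : ∀ᶠ b in 𝓝 b₀, ε b + v⁻¹ ≠ 0 :=
      (hεd.continuousAt.add continuousAt_const).eventually_ne (by simpa [hε0] using hv)
    filter_upwards [hpole, hne] with b hb hb'
    rw [(x b).localCoeff_of_pole_eq hb hv hb', hReval, mul_inv_cancel_right₀ (pow_ne_zero 4 hv)]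
  have hcoeff : ∀ i, DifferentiableAt ℂ (fun b => (R b).coeff i) b₀ :=
    differentiableAt_coeff (Eventually.of_forall fun b => (hRc b).1) hRd
  have hlead : ∀ b, (R b).coeff (n + 1) ≠ 0 := fun b => by
    rw [(hRc b).2.1]; exact mul_ne_zero (x b).coeff_poly_ne_zero (pow_ne_zero _ (hA0 b))
  -- The same normalization written for `v`, that is `v = α' z + β'`.
  set α' : (Fin m → ℂ) → ℂ := fun b => α b / A b with hα'
  set β' : (Fin m → ℂ) → ℂ := fun b => -(R b).coeff n / ((R b).coeff (n + 1) * (n + 1)) with hβ'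
  have hn : (n : ℂ) + 1 ≠ 0 := by exact_mod_cast Nat.succ_ne_zero n
  have hα'1 : ∀ b ∈ V, (R b).coeff (n + 1) * α' b ^ (n + 3) = 1 := fun b hb => by
    rw [(hRc b).2.1, hα', ← (h b hb).coeff.1, div_pow]
    have := pow_ne_zero (n + 3) (hA0 b)
    field_simp
  have hα'0 : ∀ b ∈ V, α' b ≠ 0 := fun b hb => div_ne_zero (h b hb).ne_zero (hA0 b)
  have hβA : ∀ b ∈ V, A b * β' b + B b = β b := fun b hb => by
    have h1 := (h b hb).coeff.2
    have hc := (x b).coeff_poly_ne_zero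
    have hAb := hA0 b
    simp only [hβ']
    rw [(hRc b).2.1, (hRc b).2.2]
    have h2 : (x b).poly.coeff n = -((x b).poly.coeff (n + 1) * ((n + 1) * β b)) := by
      linear_combination h1
    rw [h2]
    field_simp
    ring
  have hP : ∀ b ∈ V, ∀ z, (centredPoly (a b)).eval z =
      α' b ^ 2 * (R b).eval (α' b * z + β' b) := fun b hb z => by
    rw [(h b hb).poly_eq, hReval]
    simp only [eval_mul, eval_C, eval_comp, eval_add, eval_X]
    rw [show A b * (α' b * z + β' b) + B b = A b * α' b * z + (A b * β' b + B b) by ring, hβA b hb]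
    simp only [hα']
    rw [mul_div_cancel₀ _ (hA0 b), div_pow]
    have := hA0 b
    field_simp
  have hfr : ∀ b ∈ V, (x b).pole = locPt p (ε b) → ∀ (k : Fin (n + 3)) (θ : ℝ),
      Circle.exp θ = direction (α' b)⁻¹ *
        Circle.exp (-(2 * Real.pi * (k : ℝ) / ((n : ℝ) + 3))) →
      (x b).framing (polarAt p (x b).pole 0 θ) = bdry (f₀ k) := by
    intro b hb hpb k θ hθ
    rw [← (h b hb).framing_eq k]
    congr 1
    have h1 := polarAt_zero p (ε b) θ
    rw [← hpb] at h1
    rw [h1]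
    congr 1
    rw [direction_mul (inv_ne_zero (hA0 b)) (Circle.coe_ne_zero _), direction_coe, hθ, ← mul_assoc,
      ← direction_mul (inv_ne_zero (hA0 b)) (inv_ne_zero (hα'0 b hb)), ← mul_inv]
    simp only [hα']
    rw [mul_div_cancel₀ _ (hA0 b)]
  -- The equation `α'ⁿ⁺³ = 1 / lead R` determines `α'` up to a root of unity relative to the
  -- holomorphic branch `α' b₀ * S b`; that root has to be shown to be `1` near `b₀`.
  have hα'd : DifferentiableAt ℂ α' b₀ := by
    obtain ⟨S, hSd, hS1, hSp⟩ := exists_root_near_one (N := n + 3)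
      (s := fun b => (R b₀).coeff (n + 1) / (R b).coeff (n + 1))
      (by
        simp only [div_eq_mul_inv]
        exact ((hcoeff (n + 1)).fun_inv (hlead b₀)).const_mul _) (div_self (hlead b₀)) (by omega)
    have hS0 : ∀ᶠ b in 𝓝 b₀, S b ≠ 0 :=
      hSd.continuousAt.eventually_ne (by rw [hS1]; exact one_ne_zero)
    -- At `b₀` the framing sends the `k`th direction to `f₀ k ≠ f₀ 0`. By continuity, the direction
    -- continued along the branch still avoids `f₀ 0` nearby, which excludes a jump by the `k`th
    -- root of unity.
    have hbranch : ∀ k : Fin (n + 3), k ≠ 0 → ∀ᶠ b in 𝓝 b₀,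
        (x b).framing (polarAt p (x b).pole 0 (Complex.arg (α' b₀)⁻¹ +
          -(2 * Real.pi * (k : ℝ) / ((n : ℝ) + 3)) + Complex.arg (S b)⁻¹)) ≠ bdry (f₀ 0) := by
      intro k hk
      set θ₀ : ℝ := Complex.arg (α' b₀)⁻¹ + -(2 * Real.pi * (k : ℝ) / ((n : ℝ) + 3)) with hθ₀
      have hlim := hx.framing_boundary b₀ hb₀ θ₀
      have hval : (x b₀).framing (polarAt p (x b₀).pole 0 θ₀) = bdry (f₀ k) :=
        hfr b₀ hb₀ (by rw [hε0, locPt_zero]) k θ₀ (by rw [hθ₀, Circle.exp_add]; rfl)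
      have harg : ContinuousAt (fun b => θ₀ + Complex.arg (S b)⁻¹) b₀ := by
        refine continuousAt_const.add ?_
        refine ContinuousAt.comp (g := Complex.arg) ?_
          (hSd.continuousAt.inv₀ (by rw [hS1]; exact one_ne_zero))
        rw [hS1, inv_one]
        exact Complex.continuousAt_arg Complex.one_mem_slitPlane
      have htend : Tendsto (fun b => (b, (0 : ℝ), θ₀ + Complex.arg (S b)⁻¹)) (𝓝 b₀)
          (𝓝[{y : (Fin m → ℂ) × ℝ × ℝ | 0 ≤ y.2.1}] (b₀, 0, θ₀)) := by
        refine tendsto_nhdsWithin_iff.2 ⟨?_, Eventually.of_forall fun b => le_refl (0 : ℝ)⟩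
        have h1 := (continuousAt_id (x := b₀)).prodMk
          ((continuousAt_const (y := (0 : ℝ)) (x := b₀)).prodMk harg)
        have h2 := h1.tendsto
        simp only [id, hS1, inv_one, Complex.arg_one, add_zero] at h2
        exact h2
      have h2 := hlim.tendsto.comp htend
      refine h2.eventually_ne ?_
      simp only
      rw [hval]
      exact fun he => hk (hf₀ (bdry_injective he))
    refine ((differentiableAt_const (α' b₀)).mul hSd).congr_of_eventuallyEq ?_
    filter_upwards [hVe, hpole, hSp, hS0, eventually_all.2 fun k => eventually_imp_distrib_left.2
      (hbranch k)] with b hb hpb hSb hS0b hk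
    have hz : (α' b₀ * S b / α' b) ^ (n + 3) = 1 := by
      have h1 := hα'1 b hb
      have h2 := hα'1 b₀ hb₀
      have h3 := hlead b
      rw [div_pow, mul_pow, hSb, div_eq_one_iff_eq (pow_ne_zero _ (hα'0 b hb)),
        ← mul_right_inj' h3, h1, ← h2]
      field_simp
    set z := α' b₀ * S b / α' b with hzdef
    have hz0 : z ≠ 0 := div_ne_zero (mul_ne_zero (hα'0 b₀ hb₀) hS0b) (hα'0 b hb)
    have hzn : ‖z‖ = 1 := by
      have := congrArg norm hz
      rw [norm_pow, norm_one] at this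
      exact (pow_eq_one_iff_of_nonneg (norm_nonneg _) (by omega)).1 this
    have hzd : (direction z : ℂ) = z := by rw [coe_direction hz0, hzn]; simp
    obtain ⟨k, hkz⟩ := exists_eq_exp_of_pow_eq_one (N := n + 3) (v := direction z) (by omega)
      (by rw [hzd, hz])
    have hinv : (α' b)⁻¹ = (α' b₀)⁻¹ * (S b)⁻¹ * z := by
      have h1 := hα'0 b hb
      have h2 := hα'0 b₀ hb₀
      rw [hzdef]; field_simp
    have hkz' : direction z = Circle.exp (-(2 * Real.pi * (k : ℝ) / ((n : ℝ) + 3))) := by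
      rw [hkz, Nat.cast_add, Nat.cast_ofNat]
    by_cases hk0 : k = 0
    · rw [hk0] at hkz'
      simp only [Fin.val_zero, Nat.cast_zero, mul_zero, zero_div, neg_zero, Circle.exp_zero] at hkz'
      have hz1 : z = 1 := by rw [← hzd, hkz']; rfl
      rw [hz1, mul_one, ← mul_inv, inv_inj] at hinv
      exact hinv
    -- A nontrivial root would make the continued `k`th direction the zeroth one at `b`, whose image
    -- is `f₀ 0`.
    · refine absurd (hfr b hb hpb 0 _ ?_) (hk k hk0)
      rw [hinv, direction_mul (mul_ne_zero (inv_ne_zero (hα'0 b₀ hb₀)) (inv_ne_zero hS0b)) hz0,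
        direction_mul (inv_ne_zero (hα'0 b₀ hb₀)) (inv_ne_zero hS0b), hkz', Circle.exp_add,
        Circle.exp_add]
      simp only [Fin.val_zero, Nat.cast_zero, mul_zero, zero_div, neg_zero, Circle.exp_zero, mul_one]
      exact mul_right_comm _ _ _
  have hβ'd : DifferentiableAt ℂ β' b₀ := by
    simp only [hβ', div_eq_mul_inv]
    exact (hcoeff n).fun_neg.mul
      (((hcoeff (n + 1)).mul_const _).fun_inv (mul_ne_zero (hlead b₀) hn))
  have hPd : ∀ z ≠ 0, DifferentiableAt ℂ (fun b => (centredPoly (a b)).eval z) b₀ := by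
    intro z _
    have h1 : DifferentiableAt ℂ (fun b => α' b ^ 2 * ∑ i ∈ Finset.range (n + 2),
        (R b).coeff i * (α' b * z + β' b) ^ i) b₀ := by
      refine (hα'd.pow 2).mul (DifferentiableAt.fun_sum fun i _ => (hcoeff i).mul ?_)
      exact ((hα'd.mul_const z).add hβ'd).pow i
    refine h1.congr_of_eventuallyEq ?_
    filter_upwards [hVe] with b hb
    rw [hP b hb z, eval_eq_sum_range' (n := n + 2) (by have := (hRc b).1; omega)]
  rw [differentiableAt_pi]
  intro i
  have := differentiableAt_coeff (R := fun b => centredPoly (a b)) (d := n + 1)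
    (Eventually.of_forall fun b => (natDegree_centredPoly (a b)).le) hPd i
  simpa only [coeff_centredPoly] using this

end

/-! ### Families of polynomial differentials -/

theorem polarAt_self (p : OnePoint ℂ) {r : ℝ} (hr : 0 ≤ r) (θ : ℝ) :
    polarAt p p r θ = polar p r θ := by
  rcases hr.eq_or_lt with rfl | hr
  · have h := polarAt_zero p 0 θ
    rw [locPt_zero, poleScale_zero, inv_one, one_mul, direction_coe] at h
    rw [h, polar_zero]
  · rw [polarAt, polar, if_neg (not_le.2 hr), if_neg (not_le.2 hr), locCoord_self, zero_add]

section
variable {n : ℕ} {M : Finset Circle} {f : RealBlowup OnePoint.infty → Disk}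
  (hf : IsOrientedDiffeo OnePoint.infty f)
  (hM : ∀ a : Fin n → ℂ, Set.BijOn (fun v => f (RealBlowup.dir v))
    ((polyDifferential a).distinguishedDirections OnePoint.infty) (bdry '' (M : Set Circle)))
  {f₀ : Fin (n + 3) → Circle}

theorem isNormalForm_polyFramed (hk : ∀ k : Fin (n + 3), f (RealBlowup.dir
      (Circle.exp (-(2 * Real.pi * (k : ℝ) / ((n : ℝ) + 3))))) = bdry (f₀ k))
    {a : Fin n → ℂ} (ha : a ∉ discriminantLocus n) :
    IsNormalForm f₀ (polyFramed f hf hM a ha) a :=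
  ⟨rfl, fun _ => rfl, hk⟩

/-- Pole and framing are constant; only the coefficients of the polynomial move. -/
theorem isHolomorphicFamily_polyFramed {m : ℕ} {U : Set (Fin m → ℂ)} (hU : IsOpen U)
    {c : (Fin m → ℂ) → ((discriminantLocus n)ᶜ : Set (Fin n → ℂ))}
    (hc : DifferentiableOn ℂ (fun b => (c b : Fin n → ℂ)) U) :
    IsHolomorphicFamily U fun b => polyFramed f hf hM (c b) (c b).2 where
  pole_continuous _ _ := continuousAt_const
  pole_holomorphic _ _ := differentiableAt_const _
  diff_holomorphic b hb q hq := by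
    induction q using OnePoint.rec with
    | infty => exact absurd rfl hq
    | coe z =>
      have h1 : DifferentiableAt ℂ (fun b => (c b : Fin n → ℂ)) b :=
        hc.differentiableAt (hU.mem_nhds hb)
      have h2 : ∀ i, DifferentiableAt ℂ (fun y : (Fin m → ℂ) × ℂ => (c y.1 : Fin n → ℂ) i) (b, 0) :=
        fun i => DifferentiableAt.comp (g := fun b => (c b : Fin n → ℂ) i) (b, (0 : ℂ))
          (differentiableAt_pi.1 h1 i) differentiableAt_fst
      have h3 : (fun y : (Fin m → ℂ) × ℂ => (polyFramed f hf hM (c y.1) (c y.1).2).diff.localCoeff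
          (z : OnePoint ℂ) y.2) = fun y => (z + y.2) ^ (n + 1) +
            ∑ i : Fin n, (c y.1 : Fin n → ℂ) i * (z + y.2) ^ (i : ℕ) := by
        funext y
        rw [QuadraticDifferential.localCoeff_coe, ← eval_centredPoly]
        rfl
      rw [h3]
      have h4 : DifferentiableAt ℂ (fun y : (Fin m → ℂ) × ℂ => z + y.2) (b, 0) :=
        differentiableAt_snd.const_add z
      exact (h4.pow _).add (DifferentiableAt.fun_sum fun i _ => (h2 i).mul (h4.pow _))
  framing_interior b _ q hq := by
    induction q using OnePoint.rec with
    | infty => exact absurd rfl hq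
    | coe z =>
      have h1 : ContinuousAt (fun x : OnePoint ℂ => f (RealBlowup.ofPoint OnePoint.infty x)) z := by
        rw [OnePoint.continuousAt_coe]
        exact continuous_induced_rng.2 hf.smooth_interior.continuous |>.continuousAt
      exact ContinuousAt.comp (g := fun x : OnePoint ℂ => f (RealBlowup.ofPoint OnePoint.infty x))
        (x := (b, (z : OnePoint ℂ))) h1 continuousAt_snd
  framing_boundary b _ θ := by
    have h1 : ContinuousWithinAt (fun y : ℝ × ℝ => f (polar OnePoint.infty y.1 y.2)) {y | 0 ≤ y.1}
        (0, θ) :=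
      Topology.IsInducing.subtypeVal.continuousWithinAt_iff.2
        (hf.smooth_boundary.continuousOn (0, θ) (le_refl (0 : ℝ)))
    have h2 : ContinuousWithinAt (fun y : (Fin m → ℂ) × ℝ × ℝ =>
        f (polar OnePoint.infty y.2.1 y.2.2)) {y | 0 ≤ y.2.1} (b, 0, θ) :=
      ContinuousWithinAt.comp (g := fun y : ℝ × ℝ => f (polar OnePoint.infty y.1 y.2))
        (x := (b, (0 : ℝ), θ)) h1 continuousWithinAt_snd fun y hy => hy
    exact h2.congr (fun y hy => congrArg f (polarAt_self _ hy _))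
      (congrArg f (polarAt_self _ le_rfl _))
end

/-! ### The classifying map -/

section
variable {n : ℕ} {M : Finset Circle} {f₀ : Fin (n + 3) → Circle} (hf₀ : IsCyclicLabelling M f₀)

/-- The coefficient vector of the normal form of a framed differential. -/
def coeffVector (x : FramedDifferential n M) : Fin n → ℂ := (exists_normalizes hf₀ x).choose

theorem exists_normalizes_coeffVector (x : FramedDifferential n M) :
    ∃ α β, Normalizes f₀ x (coeffVector hf₀ x) α β := (exists_normalizes hf₀ x).choose_spec

theorem Normalizes.coeffVector_eq {x : FramedDifferential n M} {a : Fin n → ℂ} {α β : ℂ}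
    (h : Normalizes f₀ x a α β) : coeffVector hf₀ x = a := by
  obtain ⟨α', β', h'⟩ := exists_normalizes_coeffVector hf₀ x
  exact h'.unique h

theorem coeffVector_notMem (x : FramedDifferential n M) :
    coeffVector hf₀ x ∈ ((discriminantLocus n)ᶜ : Set (Fin n → ℂ)) := by
  obtain ⟨α, β, h⟩ := exists_normalizes_coeffVector hf₀ x
  exact h.notMem_discriminantLocus

/-- The map from the moduli space to the space of polynomials with simple roots. -/
def classify : QuadFr n M → ((discriminantLocus n)ᶜ : Set (Fin n → ℂ)) :=
  Quot.lift (fun x => ⟨coeffVector hf₀ x, coeffVector_notMem hf₀ x⟩) fun x₁ x₂ he => by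
    obtain ⟨α, β, h⟩ := exists_normalizes_coeffVector hf₀ x₁
    obtain ⟨α', β', h'⟩ := he.normalizes hf₀.2 h
    exact Subtype.ext (h'.coeffVector_eq hf₀).symm

theorem coe_classify_mk (x : FramedDifferential n M) :
    (classify hf₀ (QuadFr.mk x) : Fin n → ℂ) = coeffVector hf₀ x := rfl

theorem classify_mk_of_isNormalForm {x : FramedDifferential n M}
    {a : ((discriminantLocus n)ᶜ : Set (Fin n → ℂ))} (h : IsNormalForm f₀ x (a : Fin n → ℂ)) :
    classify hf₀ (QuadFr.mk x) = a := Subtype.ext (h.normalizes.coeffVector_eq hf₀)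

theorem exists_isNormalForm (hf₀ : IsCyclicLabelling M f₀)
    (a : ((discriminantLocus n)ᶜ : Set (Fin n → ℂ))) :
    ∃ x : FramedDifferential n M, IsNormalForm f₀ x (a : Fin n → ℂ) := by
  obtain ⟨f, hf, hk, hM⟩ := exists_framing hf₀
  exact ⟨_, isNormalForm_polyFramed hf hM hk a.2⟩

theorem mk_eq_of_isNormalForm {y : FramedDifferential n M} {q : QuadFr n M}
    (h : IsNormalForm f₀ y (classify hf₀ q : Fin n → ℂ)) : QuadFr.mk y = q := by
  induction q using Quot.ind with
  | mk x =>
    obtain ⟨α, β, hx⟩ := exists_normalizes_coeffVector hf₀ x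
    exact Quot.sound (h.equivalent hf₀.2 hx)

/-- Every class contains the normal form with its coefficient vector, so the vector determines the
class; every vector off the discriminant has a normal form. -/
theorem bijective_classify : Function.Bijective (classify hf₀) := by
  constructor
  · intro q₁ q₂ h
    obtain ⟨y, hy⟩ := exists_isNormalForm hf₀ (classify hf₀ q₁)
    rw [← mk_eq_of_isNormalForm hf₀ hy]
    rw [h] at hy
    exact mk_eq_of_isNormalForm hf₀ hy
  · intro a
    obtain ⟨y, hy⟩ := exists_isNormalForm hf₀ a
    exact ⟨QuadFr.mk y, classify_mk_of_isNormalForm hf₀ hy⟩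

theorem isHolomorphicMap_iff {m : ℕ} {U : Set (Fin m → ℂ)} (hU : IsOpen U)
    {c : (Fin m → ℂ) → QuadFr n M} :
    IsHolomorphicMap U c ↔ DifferentiableOn ℂ (fun b => (classify hf₀ (c b) : Fin n → ℂ)) U := by
  constructor
  · intro hc b hb
    obtain ⟨V, hV, hbV, -, x, hx, hxc⟩ := hc b hb
    choose α β hαβ using exists_normalizes_coeffVector hf₀
    have h1 := hx.differentiableAt hf₀.injective hV hbV (a := fun b => coeffVector hf₀ (x b))
      (α := fun b => α (x b)) (β := fun b => β (x b)) fun b _ => hαβ (x b)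
    refine (h1.congr_of_eventuallyEq ?_).differentiableWithinAt
    filter_upwards [hV.mem_nhds hbV] with b' hb'
    rw [← hxc b' hb', coe_classify_mk]
  · intro hc b hb
    obtain ⟨f, hf, hk, hM⟩ := exists_framing hf₀
    refine ⟨U, hU, hb, subset_rfl, _, isHolomorphicFamily_polyFramed hf hM hU hc, fun b' _ => ?_⟩
    exact mk_eq_of_isNormalForm hf₀ (isNormalForm_polyFramed hf hM hk _)

theorem continuous_classify : Continuous (classify hf₀) := by
  refine continuous_def.2 fun W hW m U c hU hc => ?_
  have h1 := ((isHolomorphicMap_iff hf₀ hU).1 hc).continuousOn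
  have h2 : ContinuousOn (fun b => classify hf₀ (c b)) U :=
    Topology.IsInducing.subtypeVal.continuousOn_iff.2 h1
  exact h2.isOpen_inter_preimage hU hW

open Classical in
-- The inverse is itself a holomorphic map on the complement of the discriminant, and open sets of
-- the moduli space have open preimages under holomorphic maps by definition.
theorem isOpenMap_classify : IsOpenMap (classify hf₀) := by
  intro W hW
  set e := Equiv.ofBijective _ (bijective_classify hf₀) with he
  -- A point of the moduli space is needed as a default value, to extend the inverse to all of `ℂⁿ`.
  rcases W.eq_empty_or_nonempty with rfl | ⟨q₀, -⟩
  · simp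
  set s : (Fin n → ℂ) → ((discriminantLocus n)ᶜ : Set (Fin n → ℂ)) := fun b =>
    if h : b ∈ ((discriminantLocus n)ᶜ : Set (Fin n → ℂ)) then ⟨b, h⟩ else classify hf₀ q₀ with hs
  have hse : ∀ b ∈ ((discriminantLocus n)ᶜ : Set (Fin n → ℂ)), (s b : Fin n → ℂ) = b :=
    fun b hb => by simp only [hs, dif_pos hb]
  have hce : ∀ a, classify hf₀ (e.symm a) = a := fun a => e.apply_symm_apply a
  have hU : IsOpen ((discriminantLocus n)ᶜ : Set (Fin n → ℂ)) :=
    (isClosed_discriminantLocus n).isOpen_compl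
  have hc : IsHolomorphicMap ((discriminantLocus n)ᶜ : Set (Fin n → ℂ)) fun b => e.symm (s b) := by
    rw [isHolomorphicMap_iff hf₀ hU]
    refine differentiableOn_id.congr fun b hb => ?_
    rw [hce, hse b hb]; rfl
  have h1 := hW n _ _ hU hc
  refine isOpen_induced_iff.2 ⟨_, h1, ?_⟩
  ext a
  have hsa : s (a : Fin n → ℂ) = a := Subtype.ext (hse _ a.2)
  constructor
  · rintro ⟨-, ha⟩
    simp only [Set.mem_preimage, hsa] at ha
    exact ⟨_, ha, hce a⟩
  · rintro ⟨q, hq, rfl⟩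
    refine ⟨(classify hf₀ q).2, ?_⟩
    simp only [Set.mem_preimage, hsa]
    rwa [show e.symm (classify hf₀ q) = q from e.symm_apply_apply q]

/-- The classifying map as a homeomorphism. -/
def classifyHomeo : QuadFr n M ≃ₜ ((discriminantLocus n)ᶜ : Set (Fin n → ℂ)) :=
  (Equiv.ofBijective _ (bijective_classify hf₀)).toHomeomorphOfContinuousOpen
    (continuous_classify hf₀) (isOpenMap_classify hf₀)

end

end FramedQuad

end

theorem mainTheorem5 (n : ℕ) (M : Finset Circle) (hM : M.card = n + 3) :
    (∃ f₀ : Fin (n + 3) → Circle, FramedQuad.IsCyclicLabelling M f₀) ∧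
    ∀ f₀ : Fin (n + 3) → Circle, FramedQuad.IsCyclicLabelling M f₀ →
      ∃ Φ : FramedQuad.QuadFr n M ≃ₜ ((FramedQuad.discriminantLocus n)ᶜ : Set (Fin n → ℂ)),
        (∀ (m : ℕ) (U : Set (Fin m → ℂ)) (c : (Fin m → ℂ) → FramedQuad.QuadFr n M), IsOpen U →
          (FramedQuad.IsHolomorphicMap U c ↔
            DifferentiableOn ℂ (fun b => (Φ (c b) : Fin n → ℂ)) U)) ∧
        (∀ (x : FramedQuad.FramedDifferential n M)
          (a : ((FramedQuad.discriminantLocus n)ᶜ : Set (Fin n → ℂ))),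
          FramedQuad.IsNormalForm f₀ x (a : Fin n → ℂ) → Φ (FramedQuad.QuadFr.mk x) = a) ∧
        (∀ a : ((FramedQuad.discriminantLocus n)ᶜ : Set (Fin n → ℂ)),
          ∃ x : FramedQuad.FramedDifferential n M,
            FramedQuad.IsNormalForm f₀ x (a : Fin n → ℂ)) := by
  refine ⟨FramedQuad.exists_cyclicLabelling hM, fun f₀ hf₀ =>
    ⟨FramedQuad.classifyHomeo hf₀, fun m U c hU => FramedQuad.isHolomorphicMap_iff hf₀ hU,
      fun x a h => FramedQuad.classify_mk_of_isNormalForm hf₀ h,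
      FramedQuad.exists_isNormalForm hf₀⟩⟩
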